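/- **Theorem 4.8.** Let $\mu>0$, let $L^2_\mu(\mathbb R)$ be the $L^2$ space of the measure $|t|^{2\mu}dt$ with norm $\|\cdot\|_\mu$, and put $$\gamma_\mu(2m)=\frac{2^{2m}m!\,\Gamma(m+\mu+\frac12)}{\Gamma(\mu+\frac12)},\quad \gamma_\mu(2m+1)=\frac{2^{2m+1}m!\,\Gamma(m+\mu+\frac32)}{\Gamma(\mu+\frac12)},\quad \mathbf e_\mu(z)=\sum_{n\ge0}\frac{z^n}{\gamma_\mu(n)},$$ $$(\mathfrak D_\mu f)(z)=f'(z)+\frac{\mu}{z}\bigl(f(z)-f(-z)\bigr)\quad(f\text{ entire}).$$ Let $\mathfrak S$ be the space of functions $p(x)e^{-x^2}$, $p$ a complex polynomial. For real $y$ and $g\in\mathfrak S$ let $\mathfrak T_yg=\mathbf e_\mu(y\mathfrak D_\mu)g=\sum_n\frac{y^n}{\gamma_\mu(n)}\mathfrak D_\mu^ng$. For a function $\phi:\mathbb R\to\mathbb C$ in $L^\infty(\mathbb R)$ or in $L^2_\mu(\mathbb R)$ let $$(\mathfrak T_y\phi)(x)=\frac12\int_{-1}^1\Bigl(1+\frac{x+y}{\widetilde\omega(t)}\Bigr)\phi(\widetilde\omega(t))\,\alpha_\mu(dt)+\frac12\int_{-1}^1\Bigl(1-\frac{x+y}{\widetilde\omega(t)}\Bigr)\phi(-\widetilde\omega(t))\,\alpha_\mu(dt),$$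 where $\widetilde\omega(t)=(x^2+2xyt+y^2)^{1/2}$ and $\alpha_\mu(dt)=B(\frac12,\mu)^{-1}(1-t)^{\mu-1}(1+t)^\mu dt$ on $(-1,1)$. Then: 1. Let $\phi\in L^\infty(\mathbb R)$. For every real $y$, $\mathfrak T_y\phi$ is the extension of $\mathbf e_\mu(y\mathfrak D_\mu)$ to bounded functions, that is, up to equality almost everywhere it is the unique $\psi\in L^\infty(\mathbb R)$ with $\int\psi\,g\,|x|^{2\mu}dx=\int\phi\,(\mathfrak T_{-y}g)\,|x|^{2\mu}dx$ for all $g\in\mathfrak S$ (the series $\mathfrak T_{-y}g$ converges at every real point, with sum integrable for $|x|^{2\mu}dx$). Moreover $$(\mathfrak T_y\phi)(x)=(\mathfrak T_x\phi)(y)\quad\text{for almost all real }x,y.$$ 2. Let $\phi\in L^2_\mu(\mathbb R)$ and $y\in\mathbb R$. Then $\mathfrak T_y\phi=\mathbf e_\mu(iyP_\mu)\phi$ almost everywhere, where $P_\mu=\mathcal F_\mu^*Q\,\mathcal F_\mu$ is the selfadjoint realization of $-i\mathfrak D_\mu$, $Q$ is multiplication by the variable, and $\mathcal F_\mu$ is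 the closure in $L^2_\mu(\mathbb R)$ of $f\mapsto\bigl(2^{\mu+1/2}\Gamma(\mu+\tfrac12)\bigr)^{-1}\int_{\mathbb R}\mathbf e_\mu(-ixt)f(t)|t|^{2\mu}dt$ on $\mathfrak S$. That is, $\psi=\mathfrak T_y\phi$ is, up to equality almost everywhere, the unique $\psi\in L^2_\mu(\mathbb R)$ with $(\mathcal F_\mu\psi)(t)=\mathbf e_\mu(iyt)(\mathcal F_\mu\phi)(t)$. Moreover $\mathfrak T_y\phi\in L^2_\mu(\mathbb R)$ and $$\|\mathfrak T_y\phi\|_\mu\le\|\phi\|_\mu.$$ -/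

import Mathlib

open MeasureTheory Set

noncomputable section

namespace GenHermite

/-- The generalized factorial `γ_μ(n)`:
`γ_μ(2m) = 2^{2m} m! Γ(m+μ+1/2) / Γ(μ+1/2)` and
`γ_μ(2m+1) = 2^{2m+1} m! Γ(m+μ+3/2) / Γ(μ+1/2)`
(natural-number division is intended: `n / 2 = m` in both cases). -/
def gammaMu (μ : ℝ) (n : ℕ) : ℝ :=
  2 ^ n * ((n / 2).factorial : ℝ) * Real.Gamma (((n + 1) / 2 : ℕ) + μ + 1 / 2)
    / Real.Gamma (μ + 1 / 2)

/-- The generalized exponential function `e_μ(z) = ∑ zⁿ / γ_μ(n)`. -/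
def expMu (μ : ℝ) (z : ℂ) : ℂ := ∑' n : ℕ, z ^ n / (gammaMu μ n : ℂ)

/-- The measure `|t|^{2μ} dt` on the real line; `L²_μ(ℝ)` is its `L²` space. -/
def weightMeasure (μ : ℝ) : Measure ℝ :=
  volume.withDensity fun t => ENNReal.ofReal (|t| ^ (2 * μ))

/-- The generalized derivative of an entire function,
`(𝔇_μ f)(z) = f'(z) + (μ/z) (f(z) - f(-z))`, with its limit value `(1+2μ) f'(0)` at `z = 0`. -/
def dunklDeriv (μ : ℝ) (f : ℂ → ℂ) (z : ℂ) : ℂ :=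
  if z = 0 then (1 + 2 * (μ : ℂ)) * deriv f 0
  else deriv f z + (μ : ℂ) / z * (f z - f (-z))

/-- The entire function `p(z) exp(-z²)`. As `p` runs through the complex polynomials, the
restrictions to `ℝ` are the linear span `𝔖` of the functions `xⁿ exp(-x²)`. -/
def gaussPoly (p : Polynomial ℂ) (z : ℂ) : ℂ := p.eval z * Complex.exp (-z ^ 2)

/-- The `n`-th term of the series `(𝔗_y f)(z) = ∑ₙ (yⁿ / γ_μ(n)) (𝔇_μⁿ f)(z)` that defines
`𝔗_y f = e_μ(y 𝔇_μ) f` for an entire function `f`. -/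
def translationTerm (μ y : ℝ) (f : ℂ → ℂ) (z : ℂ) (n : ℕ) : ℂ :=
  (y : ℂ) ^ n / (gammaMu μ n : ℂ) * (dunklDeriv μ)^[n] f z

/-- `ψ ∈ L^∞(ℝ)` is the image of `φ` under the extension of `𝔗_y = e_μ(y 𝔇_μ)` to bounded
functions: since `𝔇_μ` is skew-symmetric for `|x|^{2μ} dx`, this is
`∫ ψ g |x|^{2μ} dx = ∫ φ (𝔗_{-y} g) |x|^{2μ} dx` for all `g` of the form `p(x) exp(-x²)`, where
`h = 𝔗_{-y} g` is given by its defining series (whose pointwise convergence is required). -/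
def IsBoundedTranslate (μ y : ℝ) (φ ψ : ℝ → ℂ) : Prop :=
  MemLp ψ ⊤ volume ∧
    ∀ p : Polynomial ℂ, ∃ h : ℝ → ℂ,
      (∀ x : ℝ, HasSum (translationTerm μ (-y) (gaussPoly p) x) (h x)) ∧
      Integrable h (weightMeasure μ) ∧
      ∫ x, ψ x * gaussPoly p x ∂(weightMeasure μ) = ∫ x, φ x * h x ∂(weightMeasure μ)

/-- The generalized Fourier integral
`(2^{μ+1/2} Γ(μ+1/2))⁻¹ ∫ e_μ(-ixt) f(t) |t|^{2μ} dt`. -/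
def fourierIntegralMu (μ : ℝ) (f : ℝ → ℂ) (x : ℝ) : ℂ :=
  (((2 : ℝ) ^ (μ + 1 / 2) * Real.Gamma (μ + 1 / 2) : ℝ) : ℂ)⁻¹ *
    ∫ t, expMu μ (-(Complex.I * x * t)) * f t ∂(weightMeasure μ)

/-- `g = 𝓕_μ f` in `L²_μ(ℝ)`: the pair `(f, g)` lies in the closure, in `L²_μ × L²_μ`, of the
graph of the generalized Fourier integral on `𝔖`. -/
def IsFourierMu (μ : ℝ) (f g : ℝ → ℂ) : Prop :=
  MemLp f 2 (weightMeasure μ) ∧ MemLp g 2 (weightMeasure μ) ∧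
    ∀ ε : ENNReal, 0 < ε → ∃ p : Polynomial ℂ,
      eLpNorm (fun x : ℝ => f x - gaussPoly p x) 2 (weightMeasure μ) < ε ∧
      eLpNorm (fun x : ℝ => g x - fourierIntegralMu μ (fun t : ℝ => gaussPoly p t) x) 2
        (weightMeasure μ) < ε

/-- `ψ = e_μ(i y P_μ) φ` in `L²_μ(ℝ)`, where `P_μ = 𝓕_μ* Q 𝓕_μ` is the selfadjoint realization of
`-i 𝔇_μ` (`Q` is multiplication by the variable): functions of `P_μ` act through `𝓕_μ` as
multiplication operators, that is, `(𝓕_μ ψ)(t) = e_μ(i y t) (𝓕_μ φ)(t)`. -/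
def IsL2Translate (μ y : ℝ) (φ ψ : ℝ → ℂ) : Prop :=
  ∃ g : ℝ → ℂ, IsFourierMu μ φ g ∧
    IsFourierMu μ ψ (fun t : ℝ => expMu μ (Complex.I * y * t) * g t)

/-- The probability measure `α_μ(dt) = B(1/2, μ)⁻¹ (1-t)^{μ-1} (1+t)^μ dt` on `(-1, 1)`. -/
def alphaMu (μ : ℝ) : Measure ℝ :=
  (volume.restrict (Ioo (-1) 1)).withDensity fun t =>
    ENNReal.ofReal ((1 - t) ^ (μ - 1) * (1 + t) ^ μ / ProbabilityTheory.beta (1 / 2) μ)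

/-- `ω̃(t) = (x² + 2xyt + y²)^{1/2}`. -/
def omegaTilde (x y t : ℝ) : ℝ := Real.sqrt (x ^ 2 + 2 * x * y * t + y ^ 2)

/-- The function `𝔗_y φ` on the real line, in integral form. That it is the operator
`e_μ(y 𝔇_μ)` is not part of this definition; see `IsBoundedTranslate` and `IsL2Translate`. -/
def genTranslation (μ y : ℝ) (φ : ℝ → ℂ) (x : ℝ) : ℂ :=
  1 / 2 * (∫ t, ((1 + (x + y) / omegaTilde x y t : ℝ) : ℂ) * φ (omegaTilde x y t) ∂(alphaMu μ)) +
  1 / 2 * (∫ t, ((1 - (x + y) / omegaTilde x y t : ℝ) : ℂ) * φ (-omegaTilde x y t) ∂(alphaMu μ))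

end GenHermite

end

noncomputable section

namespace GenHermite

/-! The normalization of `gammaMu` makes the generalized derivative send `z^(n+1)/γ(n+1)` to
`z^n/γ(n)`, so `e_μ` plays the role of the exponential and the polynomials `dunklBinom` play the
role of `(x+y)^n`. The key identity is that the integral formula sends `z^n` to `dunklBinom μ n x
y`. In odd degree a factor `x+y` splits off (`dunklBinom_succ_of_even`). In even degree one needs
the moments of `omegaTilde^2` under `α_μ` (`alphaMu_integral_pow`): both sides have the same
generalized derivative in `x` and the same value at `x = 0`, and an energy estimate (`energy_le`)
makes such a function unique. Hence for entire functions and `x ≠ 0` the integral is the sum of the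
series `e_μ(y𝔇)f`, and it has the product formula `genTranslation_expMu`.

To reach non-smooth functions, substitute `z = omegaTilde x y t`. The translation becomes an
integral operator whose kernel satisfies `|x|^(2μ) K_y(x,z) = |z|^(2μ) K_{-y}(z,x)`
(`weight_mul_transKernel`, Heron's formula for the triangle with sides `x, y, z`). The kernel
changes sign, but its absolute row integrals are uniformly bounded. Schur's test then gives
boundedness on `L^∞`, `L¹_μ` and `L²_μ`, and Fubini gives that the transpose of translation by `y`
is translation by `-y`. With the series formula on `𝔖` this is the weak identity of the first claim.
Uniqueness there holds because a function of moderate growth is determined by its integrals against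
`x^n exp(-x²)` (`ModerateGrowth.ae_eq_zero`). Symmetry in `x, y` is visible in the formula.

For `L²`, Plancherel is proved algebraically on `𝔖`: multiplication by `t` becomes `i𝔇` under the
transform, a Gaussian goes to a Gaussian, and `𝔇` is skew-symmetric on Gaussian functions. The
isometry passes to the closure. Transposing the translation onto the Fourier kernel and using the
product formula shows that translation by `y` is multiplication by `e_μ(iyx)` on `L¹_μ`
(`fourierC_genTranslation`), hence on `L²_μ` by density. The energy estimate also gives `|e_μ(ix)| ≤
1`, and Plancherel turns this into the norm bound with constant 1, which the kernel estimate alone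
does not give. -/

/-! ### Generalized integers and factorials -/

/-- `dunklCoeff μ n = n + 2μ` for odd `n` and `n` for even `n`, so that
`𝔇_μ zⁿ = dunklCoeff μ n * zⁿ⁻¹`. -/
def dunklCoeff (μ : ℝ) (n : ℕ) : ℝ := n + μ * (1 - (-1) ^ n)

lemma dunklCoeff_zero (μ : ℝ) : dunklCoeff μ 0 = 0 := by simp [dunklCoeff]

lemma dunklCoeff_even (μ : ℝ) {n : ℕ} (hn : Even n) : dunklCoeff μ n = n := by
  simp [dunklCoeff, hn.neg_one_pow]

lemma dunklCoeff_odd (μ : ℝ) {n : ℕ} (hn : Odd n) : dunklCoeff μ n = n + 2 * μ := by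
  simp only [dunklCoeff, hn.neg_one_pow]; ring

lemma le_dunklCoeff {μ : ℝ} (hμ : 0 < μ) (n : ℕ) : (n : ℝ) ≤ dunklCoeff μ n := by
  rcases n.even_or_odd with h | h
  · rw [dunklCoeff_even μ h]
  · rw [dunklCoeff_odd μ h]; linarith

/-- An odd sum has exactly one odd summand, so the shift `2μ` occurs once on each side; with two odd
summands this fails. It drives both the factorization of the generalized binomial and the
skew-symmetry of `𝔇`. -/
lemma dunklCoeff_add (μ : ℝ) {j k : ℕ} (h : Odd (j + k)) :
    dunklCoeff μ j + dunklCoeff μ k = dunklCoeff μ (j + k) := by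
  rcases j.even_or_odd with hj | hj
  · have hk : Odd k := by grind
    rw [dunklCoeff_even μ hj, dunklCoeff_odd μ hk, dunklCoeff_odd μ h]; push_cast; ring
  · have hk : Even k := by grind
    rw [dunklCoeff_odd μ hj, dunklCoeff_even μ hk, dunklCoeff_odd μ h]; push_cast; ring

lemma gammaMu_zero {μ : ℝ} (hμ : 0 < μ) : gammaMu μ 0 = 1 := by
  have : Real.Gamma (μ + 1 / 2) ≠ 0 := (Real.Gamma_pos_of_pos (by linarith)).ne'
  simp only [gammaMu]
  norm_num
  norm_num at this
  exact this

/-- For even `n` the new factor comes from `Γ(s+1) = sΓ(s)`, for odd `n` from the factorial. All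
later use of `gammaMu` goes through this recurrence, except the explicit Gaussian transform. -/
lemma gammaMu_succ {μ : ℝ} (hμ : 0 < μ) (n : ℕ) :
    gammaMu μ (n + 1) = dunklCoeff μ (n + 1) * gammaMu μ n := by
  have h0 : Real.Gamma (μ + 1 / 2) ≠ 0 := (Real.Gamma_pos_of_pos (by linarith)).ne'
  rcases n.even_or_odd' with ⟨m, rfl | rfl⟩
  · rw [dunklCoeff_odd μ ⟨m, rfl⟩]
    have e1 : (2 * m + 1) / 2 = m := by omega
    have e2 : (2 * m + 1 + 1) / 2 = m + 1 := by omega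
    have e3 : (2 * m) / 2 = m := by omega
    simp only [gammaMu, e1, e2, e3]
    have : ((m + 1 : ℕ) : ℝ) + μ + 1 / 2 = (m + μ + 1 / 2) + 1 := by push_cast; ring
    rw [this, Real.Gamma_add_one (by positivity)]
    push_cast
    field_simp
    ring
  · rw [dunklCoeff_even μ (by grind)]
    have e1 : (2 * m + 1) / 2 = m := by omega
    have e2 : (2 * m + 1 + 1) / 2 = m + 1 := by omega
    have e3 : (2 * m + 1 + 1 + 1) / 2 = m + 1 := by omega
    simp only [gammaMu, e1, e2, e3, Nat.factorial_succ]
    push_cast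
    field_simp
    ring

/-- Makes every series in `1/γ` dominated by an exponential series. -/
lemma factorial_le_gammaMu {μ : ℝ} (hμ : 0 < μ) (n : ℕ) : (n.factorial : ℝ) ≤ gammaMu μ n := by
  induction n with
  | zero => simp [gammaMu_zero hμ]
  | succ n ih =>
    rw [gammaMu_succ hμ, Nat.factorial_succ]
    push_cast
    have := le_dunklCoeff hμ (n + 1)
    push_cast at this
    exact mul_le_mul this ih (by positivity) (by linarith [(n.cast_nonneg : (0 : ℝ) ≤ n)])

lemma gammaMu_pos {μ : ℝ} (hμ : 0 < μ) (n : ℕ) : 0 < gammaMu μ n :=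
  lt_of_lt_of_le (by positivity) (factorial_le_gammaMu hμ n)

lemma gammaMu_ne_zero {μ : ℝ} (hμ : 0 < μ) (n : ℕ) : (gammaMu μ n : ℂ) ≠ 0 := by
  exact_mod_cast (gammaMu_pos hμ n).ne'

/-! ### Entire functions and their power series -/

lemma hasSum_of_eq {ι : Type*} {f g : ι → ℂ} {a b : ℂ} (h : HasSum f a) (hfg : ∀ i, g i = f i)
    (hab : b = a) : HasSum g b := by
  rw [funext hfg, hab]; exact h

lemma hasSum_zero_index {f : ℕ → ℂ} {a : ℂ} (hf : ∀ n ≠ 0, f n = 0) (ha : f 0 = a) :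
    HasSum f a := ha ▸ hasSum_single 0 hf

/-- `f` is the sum of the everywhere convergent power series with coefficients `a`. -/
def HasEntireSeries (a : ℕ → ℂ) (f : ℂ → ℂ) : Prop := ∀ z, HasSum (fun n => a n * z ^ n) (f z)

lemma exists_hasEntireSeries {f : ℂ → ℂ} (hf : Differentiable ℂ f) :
    ∃ a, HasEntireSeries a f := by
  refine ⟨fun n => (n.factorial : ℂ)⁻¹ * iteratedDeriv n f 0, fun z => ?_⟩
  refine hasSum_of_eq (Complex.hasSum_taylorSeries_of_entire hf 0 z) (fun n => ?_) rfl
  simp only [sub_zero, smul_eq_mul]; ring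

lemma HasEntireSeries.summable_norm {a : ℕ → ℂ} {f : ℂ → ℂ} (h : HasEntireSeries a f) (r : ℝ) :
    Summable fun n => ‖a n‖ * |r| ^ n := by
  have := (h r).summable.norm
  simpa [norm_mul, norm_pow] using this

lemma HasEntireSeries.hasDerivAt {a : ℕ → ℂ} {f : ℂ → ℂ} (h : HasEntireSeries a f) (z : ℂ) :
    ∃ f', HasDerivAt f f' z ∧ HasSum (fun n => a (n + 1) * ((n + 1 : ℕ) : ℂ) * z ^ n) f' := by
  set R : ℝ := ‖z‖ + 1 with hR
  have hR1 : 1 ≤ R := by simp [hR]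
  -- Evaluating at radius `2R` supplies a factor `2^n` that absorbs the `n` from differentiation.
  set u : ℕ → ℝ := fun n => ‖a n‖ * |2 * R| ^ n
  have hu : Summable u := h.summable_norm (2 * R)
  have hb : ∀ n, ∀ w ∈ Metric.ball (0 : ℂ) R, ‖a n * (n * w ^ (n - 1))‖ ≤ u n := by
    intro n w hw
    have hw' : ‖w‖ ≤ R := by simpa using (mem_ball_zero_iff.1 hw).le
    rw [norm_mul, norm_mul, norm_pow, Complex.norm_natCast]
    refine mul_le_mul_of_nonneg_left ?_ (norm_nonneg _)
    rw [abs_of_nonneg (by positivity), mul_pow]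
    refine mul_le_mul ?_ ?_ (by positivity) (by positivity)
    · exact_mod_cast Nat.lt_two_pow_self.le
    · exact (pow_le_pow_left₀ (norm_nonneg _) hw' _).trans (pow_le_pow_right₀ hR1 (by omega))
  have hz : z ∈ Metric.ball (0 : ℂ) R := by simp [hR]
  have hd := hasDerivAt_tsum_of_isPreconnected (g := fun n w => a n * w ^ n) hu Metric.isOpen_ball
    (convex_ball (0 : ℂ) R).isPreconnected
    (fun n w _ => (hasDerivAt_pow n w).const_mul (a n)) hb hz (h z).summable hz
  have hf : (fun w => ∑' n, a n * w ^ n) = f := funext fun w => (h w).tsum_eq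
  rw [hf] at hd
  refine ⟨_, hd, ?_⟩
  have hs : Summable fun n => a n * (n * z ^ (n - 1)) :=
    Summable.of_norm_bounded hu (fun n => hb n z hz)
  have := (hasSum_nat_add_iff' 1).2 hs.hasSum
  simp only [Finset.range_one, Finset.sum_singleton, Nat.cast_zero, zero_mul, mul_zero,
    sub_zero] at this
  refine hasSum_of_eq this (fun n => ?_) rfl
  simp [mul_assoc]

lemma HasEntireSeries.differentiable {a : ℕ → ℂ} {f : ℂ → ℂ} (h : HasEntireSeries a f) :
    Differentiable ℂ f := fun z => (h.hasDerivAt z).choose_spec.1.differentiableAt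

/-- The reflection term kills even powers and doubles odd ones, which adds `2μ` to the exponent in
odd degree. At `0` only the coefficient `(1+2μ) a 1` survives, in agreement with the limit value
chosen in the definition. -/
lemma HasEntireSeries.dunklDeriv {a : ℕ → ℂ} {f : ℂ → ℂ} (h : HasEntireSeries a f) (μ : ℝ) :
    HasEntireSeries (fun n => dunklCoeff μ (n + 1) * a (n + 1)) (dunklDeriv μ f) := by
  intro z
  obtain ⟨f', hf', hs⟩ := h.hasDerivAt z
  by_cases hz : z = 0
  · subst hz
    rw [GenHermite.dunklDeriv, if_pos rfl, hf'.deriv]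
    have e : f' = a 1 := by
      exact hs.unique (hasSum_zero_index (fun n hn => by simp [hn]) (by simp))
    refine hasSum_zero_index (fun n hn => by simp [hn]) ?_
    simp only [zero_add, pow_zero, mul_one, e]
    rw [dunklCoeff_odd μ odd_one]
    push_cast
    ring
  · rw [GenHermite.dunklDeriv, if_neg hz, hf'.deriv]
    have h1 := (hasSum_nat_add_iff' 1).2 ((h z).sub (h (-z)))
    simp only [Finset.range_one, Finset.sum_singleton, pow_zero, sub_self, sub_zero] at h1
    have h2 := hs.add (h1.mul_left ((μ : ℂ) / z))
    refine hasSum_of_eq h2 (fun n => ?_) rfl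
    simp only [GenHermite.dunklCoeff, neg_pow z (n + 1)]
    push_cast
    field_simp
    ring

lemma HasEntireSeries.dunklDeriv_iterate {a : ℕ → ℂ} {f : ℂ → ℂ} (h : HasEntireSeries a f)
    {μ : ℝ} (hμ : 0 < μ) (j : ℕ) :
    HasEntireSeries (fun n => ((gammaMu μ (n + j) / gammaMu μ n : ℝ) : ℂ) * a (n + j))
      ((GenHermite.dunklDeriv μ)^[j] f) := by
  induction j with
  | zero =>
    intro z
    refine hasSum_of_eq (h z) (fun n => ?_) rfl
    simp [div_self (gammaMu_ne_zero hμ n)]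
  | succ j ih =>
    rw [Function.iterate_succ_apply']
    convert ih.dunklDeriv μ using 2 with n
    have e : n + (j + 1) = n + 1 + j := by ring
    have h1 := gammaMu_ne_zero hμ n
    have h2 : (dunklCoeff μ (n + 1) : ℂ) ≠ 0 := by
      have := le_dunklCoeff hμ (n + 1)
      push_cast at this
      exact_mod_cast (by linarith [(n.cast_nonneg : (0 : ℝ) ≤ n)] : 0 < dunklCoeff μ (n + 1)).ne'
    rw [e, gammaMu_succ hμ n]
    push_cast
    field_simp

lemma hasEntireSeries_expMu {μ : ℝ} (hμ : 0 < μ) (c : ℂ) :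
    HasEntireSeries (fun n => c ^ n / (gammaMu μ n : ℂ)) (fun z => expMu μ (c * z)) := by
  intro z
  have : Summable fun n : ℕ => (c * z) ^ n / (gammaMu μ n : ℂ) := by
    refine Summable.of_norm_bounded (Real.summable_pow_div_factorial ‖c * z‖) (fun n => ?_)
    rw [norm_div, norm_pow, Complex.norm_real, Real.norm_of_nonneg (gammaMu_pos hμ n).le]
    gcongr
    exact factorial_le_gammaMu hμ n
  refine hasSum_of_eq this.hasSum (fun n => ?_) rfl
  rw [mul_pow]; ring

lemma norm_expMu_le {μ : ℝ} (hμ : 0 < μ) (z : ℂ) : ‖expMu μ z‖ ≤ Real.exp ‖z‖ := by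
  have h := (hasEntireSeries_expMu hμ z 1)
  simp only [mul_one, one_pow] at h
  rw [← h.tsum_eq]
  refine tsum_of_norm_bounded (g := fun n => ‖z‖ ^ n / n.factorial) ?_ (fun n => ?_)
  · rw [Real.exp_eq_exp_ℝ]; exact NormedSpace.expSeries_div_hasSum_exp ‖z‖
  · rw [norm_div, norm_pow, Complex.norm_real, Real.norm_of_nonneg (gammaMu_pos hμ n).le]
    gcongr
    exact factorial_le_gammaMu hμ n

lemma expMu_zero {μ : ℝ} (hμ : 0 < μ) : expMu μ 0 = 1 := by
  have h := (hasEntireSeries_expMu hμ 0 0)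
  simp only [mul_zero] at h
  exact h.unique (hasSum_zero_index (fun n hn => by simp [hn]) (by simp [gammaMu_zero hμ]))

lemma differentiable_expMu {μ : ℝ} (hμ : 0 < μ) : Differentiable ℂ (expMu μ) := by
  simpa using (hasEntireSeries_expMu hμ 1).differentiable

lemma continuous_expMu {μ : ℝ} (hμ : 0 < μ) : Continuous (expMu μ) :=
  (differentiable_expMu hμ).continuous

lemma HasEntireSeries.unique {a : ℕ → ℂ} {f g : ℂ → ℂ} (h : HasEntireSeries a f)
    (h' : HasEntireSeries a g) : f = g := funext fun z => (h z).unique (h' z)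

lemma dunklDeriv_expMu {μ : ℝ} (hμ : 0 < μ) (c : ℂ) :
    dunklDeriv μ (fun z => expMu μ (c * z)) = fun z => c * expMu μ (c * z) := by
  refine ((hasEntireSeries_expMu hμ c).dunklDeriv μ).unique fun z => ?_
  refine hasSum_of_eq ((hasEntireSeries_expMu hμ c z).mul_left c) (fun n => ?_) rfl
  beta_reduce
  rw [gammaMu_succ hμ n]
  have h2 : (dunklCoeff μ (n + 1) : ℂ) ≠ 0 := by
    have := le_dunklCoeff hμ (n + 1)
    push_cast at this
    exact_mod_cast (by linarith [(n.cast_nonneg : (0 : ℝ) ≤ n)] : 0 < dunklCoeff μ (n + 1)).ne'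
  have := gammaMu_ne_zero hμ n
  push_cast
  field_simp
  ring

/-! ### The energy estimate for the equation `𝔇_μ f = iλ f` on the real line -/

/-- The quantity `|f(x)|² + |f(-x)|²` is nonincreasing for `x ≥ 0`: the term `iλf` is skew and drops
out of its derivative, and the reflection terms combine to `-2(μ/x)|f(x) - f(-x)|²`. -/
lemma energy_le {μ : ℝ} (hμ : 0 < μ) (l : ℝ) {f f' : ℝ → ℂ} (hf : ∀ x, HasDerivAt f (f' x) x)
    (heq : ∀ x : ℝ, x ≠ 0 → f' x + μ / x * (f x - f (-x)) = Complex.I * l * f x) (x : ℝ)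
    (hx : 0 ≤ x) : ‖f x‖ ^ 2 + ‖f (-x)‖ ^ 2 ≤ 2 * ‖f 0‖ ^ 2 := by
  have hd : ∀ x, HasDerivAt (fun x => ‖f x‖ ^ 2 + ‖f (-x)‖ ^ 2)
      (2 * (f' x * (starRingEnd ℂ) (f x)).re - 2 * (f' (-x) * (starRingEnd ℂ) (f (-x))).re) x := by
    intro x
    have h1 : ∀ x, HasDerivAt (fun x => ‖f x‖ ^ 2) (2 * (f' x * (starRingEnd ℂ) (f x)).re) x := by
      intro x
      refine (hf x).norm_sq.congr_deriv ?_
      simp [Complex.inner, mul_comm]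
    have h2 := (h1 (-x)).comp x (hasDerivAt_neg x)
    refine ((h1 x).add h2).congr_deriv ?_
    ring
  have hanti : AntitoneOn (fun x => ‖f x‖ ^ 2 + ‖f (-x)‖ ^ 2) (Ici 0) := by
    refine antitoneOn_of_deriv_nonpos (convex_Ici 0)
      (fun x _ => (hd x).continuousAt.continuousWithinAt)
      (fun x _ => (hd x).differentiableAt.differentiableWithinAt) fun x hx => ?_
    rw [interior_Ici] at hx
    have hx : 0 < x := hx
    rw [(hd x).deriv]
    have e1 : f' x = Complex.I * l * f x - ((μ / x : ℝ) : ℂ) * (f x - f (-x)) := by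
      rw [← heq x hx.ne']; push_cast; ring
    have e2 : f' (-x) = Complex.I * l * f (-x) + ((μ / x : ℝ) : ℂ) * (f (-x) - f x) := by
      have := heq (-x) (by linarith)
      rw [neg_neg] at this
      rw [← this]; push_cast
      field_simp
      ring
    have hp : 0 ≤ μ / x := by positivity
    rw [e1, e2]
    simp only [Complex.mul_re, Complex.sub_re, Complex.add_re, Complex.sub_im, Complex.add_im,
      Complex.mul_im, Complex.I_re, Complex.I_im, Complex.ofReal_re, Complex.ofReal_im,
      Complex.conj_re, Complex.conj_im]
    have := mul_nonneg hp (add_nonneg (sq_nonneg ((f x).re - (f (-x)).re))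
      (sq_nonneg ((f x).im - (f (-x)).im)))
    nlinarith [this]
  have := hanti (mem_Ici.2 le_rfl) (mem_Ici.2 hx) hx
  simp only [neg_zero] at this
  linarith

/-- The function `f(x) = e_μ(ix)` solves the equation with `λ = 1` and `f(0) = 1`, and its values at
`x` and `-x` are conjugate, so the energy is `2|f(x)|² ≤ 2`. -/
lemma norm_expMu_I_mul_le {μ : ℝ} (hμ : 0 < μ) (x : ℝ) : ‖expMu μ (Complex.I * x)‖ ≤ 1 := by
  have hconj : ∀ x : ℝ, (starRingEnd ℂ) (expMu μ (Complex.I * x)) = expMu μ (Complex.I * (-x : ℝ)) := by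
    intro x
    refine (((Complex.hasSum_conj' (L := _)).2 (hasEntireSeries_expMu hμ Complex.I x)).unique ?_)
    refine hasSum_of_eq (hasEntireSeries_expMu hμ Complex.I ((-x : ℝ) : ℂ)) (fun n => ?_) rfl
    simp [neg_pow Complex.I, neg_pow (x : ℂ)]
    ring
  have key : ∀ x : ℝ, 0 ≤ x → ‖expMu μ (Complex.I * x)‖ ≤ 1 := by
    intro x hx
    have hser := hasEntireSeries_expMu hμ Complex.I
    have hD : ∀ x : ℝ, HasDerivAt (fun x : ℝ => expMu μ (Complex.I * x))
        (deriv (fun z : ℂ => expMu μ (Complex.I * z)) x) x := fun x =>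
      ((hser.differentiable x).hasDerivAt).comp_ofReal
    have := energy_le hμ 1 hD (fun x hx => ?_) x hx
    · simp only [← hconj x, RCLike.norm_conj] at this
      simp [expMu_zero hμ] at this
      nlinarith [norm_nonneg (expMu μ (Complex.I * x))]
    · have := congrFun (dunklDeriv_expMu hμ Complex.I) x
      rw [dunklDeriv, if_neg (by exact_mod_cast hx)] at this
      simpa using this
  rcases le_total 0 x with h | h
  · exact key x h
  · have := key (-x) (by linarith)
    rwa [← hconj, RCLike.norm_conj] at this

/-! ### The measure `α_μ` -/

/-- Splitting at `0` leaves one singular endpoint on each half. -/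
lemma intervalIntegrable_jacobi {a b : ℝ} (ha : -1 < a) (hb : -1 < b) :
    IntervalIntegrable (fun t : ℝ => (1 - t) ^ a * (1 + t) ^ b) volume (-1) 1 := by
  refine IntervalIntegrable.trans (b := 0) ?_ ?_
  · have h1 : IntervalIntegrable (fun t : ℝ => (1 + t) ^ b) volume (-1) 0 := by
      simpa using (intervalIntegral.intervalIntegrable_rpow' (a := 0) (b := 1) hb).comp_add_left 1
    refine h1.continuousOn_mul (ContinuousOn.rpow_const (by fun_prop) fun t ht => Or.inl ?_)
    rw [uIcc_of_le (by norm_num)] at ht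
    linarith [ht.2]
  · have h1 : IntervalIntegrable (fun t : ℝ => (1 - t) ^ a) volume 0 1 := by
      simpa using
        ((intervalIntegral.intervalIntegrable_rpow' (a := 0) (b := 1) ha).comp_sub_left 1).symm
    refine h1.mul_continuousOn (ContinuousOn.rpow_const (by fun_prop) fun t ht => Or.inl ?_)
    rw [uIcc_of_le (by norm_num)] at ht
    linarith [ht.1]

lemma integrableOn_jacobi {a b : ℝ} (ha : -1 < a) (hb : -1 < b) :
    IntegrableOn (fun t : ℝ => (1 - t) ^ a * (1 + t) ^ b) (Ioo (-1) 1) :=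
  (intervalIntegrable_iff_integrableOn_Ioo_of_le (by norm_num)).1 (intervalIntegrable_jacobi ha hb)

/-- The density of `α_μ` on `(-1, 1)`. -/
def alphaDensity (μ t : ℝ) : ℝ :=
  (1 - t) ^ (μ - 1) * (1 + t) ^ μ / ProbabilityTheory.beta (1 / 2) μ

lemma beta_half_pos {μ : ℝ} (hμ : 0 < μ) : 0 < ProbabilityTheory.beta (1 / 2) μ :=
  ProbabilityTheory.beta_pos (by norm_num) hμ

lemma alphaDensity_nonneg {μ : ℝ} (hμ : 0 < μ) {t : ℝ} (ht : t ∈ Ioo (-1 : ℝ) 1) :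
    0 ≤ alphaDensity μ t := by
  have h1 : 0 ≤ 1 - t := by linarith [ht.2]
  have h2 : 0 ≤ 1 + t := by linarith [ht.1]
  have := (beta_half_pos hμ).le
  exact div_nonneg (mul_nonneg (Real.rpow_nonneg h1 _) (Real.rpow_nonneg h2 _)) this

lemma measurable_alphaDensity (μ : ℝ) : Measurable (alphaDensity μ) := by
  unfold alphaDensity
  fun_prop

lemma integral_alphaMu {E : Type*} [NormedAddCommGroup E] [NormedSpace ℝ E] {μ : ℝ} (hμ : 0 < μ)
    (f : ℝ → E) : ∫ t, f t ∂(alphaMu μ) = ∫ t in Ioo (-1) 1, alphaDensity μ t • f t := by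
  rw [alphaMu, integral_withDensity_eq_integral_toReal_smul]
  · refine setIntegral_congr_fun measurableSet_Ioo fun t ht => ?_
    have := alphaDensity_nonneg hμ ht
    rw [alphaDensity] at this
    simp only [ENNReal.toReal_ofReal this, alphaDensity]
  · exact (measurable_alphaDensity μ).ennreal_ofReal
  · exact Filter.Eventually.of_forall fun t => ENNReal.ofReal_lt_top

lemma lintegral_alphaMu (μ : ℝ) (f : ℝ → ENNReal) :
    ∫⁻ t, f t ∂(alphaMu μ) = ∫⁻ t in Ioo (-1) 1, ENNReal.ofReal (alphaDensity μ t) * f t := by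
  rw [alphaMu, lintegral_withDensity_eq_lintegral_mul_non_measurable]
  · rfl
  · exact (measurable_alphaDensity μ).ennreal_ofReal
  · exact Filter.Eventually.of_forall fun t => ENNReal.ofReal_lt_top

lemma integrable_alphaMu_iff {E : Type*} [NormedAddCommGroup E] [NormedSpace ℝ E] {μ : ℝ}
    (hμ : 0 < μ) (f : ℝ → E) : Integrable f (alphaMu μ) ↔
      IntegrableOn (fun t => alphaDensity μ t • f t) (Ioo (-1) 1) := by
  rw [alphaMu, integrable_withDensity_iff_integrable_smul']
  · refine integrableOn_congr_fun (fun t ht => ?_) measurableSet_Ioo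
    have := alphaDensity_nonneg hμ ht
    rw [alphaDensity] at this
    simp only [ENNReal.toReal_ofReal this, alphaDensity]
  · exact (measurable_alphaDensity μ).ennreal_ofReal
  · exact Filter.Eventually.of_forall fun t => ENNReal.ofReal_lt_top

/-- Substituting `t = 2s - 1` gives `2^(2μ) B(μ+1, μ)`; the duplication formula for `Γ` at `μ + 1/2`
turns this into `B(1/2, μ)`. -/
lemma integral_jacobi {μ : ℝ} (hμ : 0 < μ) :
    ∫ t in (-1 : ℝ)..1, (1 - t) ^ (μ - 1) * (1 + t) ^ μ = ProbabilityTheory.beta (1 / 2) μ := by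
  have h1 : ∫ s in (0 : ℝ)..1, s ^ μ * (1 - s) ^ (μ - 1) = ProbabilityTheory.beta (μ + 1) μ := by
    rw [ProbabilityTheory.beta_eq_betaIntegralReal _ _ (by linarith) hμ, Complex.betaIntegral]
    have : ∀ s ∈ uIcc (0 : ℝ) 1, (s : ℂ) ^ (((μ + 1 : ℝ) : ℂ) - 1) * (1 - (s : ℂ)) ^ ((μ : ℂ) - 1) =
        ((s ^ μ * (1 - s) ^ (μ - 1) : ℝ) : ℂ) := by
      intro s hs
      rw [uIcc_of_le (by norm_num)] at hs
      rw [Complex.ofReal_mul, Complex.ofReal_cpow hs.1, Complex.ofReal_cpow (by linarith [hs.2])]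
      push_cast
      ring_nf
    rw [intervalIntegral.integral_congr this, intervalIntegral.integral_ofReal, Complex.ofReal_re]
  have h2 := intervalIntegral.integral_comp_mul_add (a := 0) (b := 1)
    (fun t : ℝ => (1 - t) ^ (μ - 1) * (1 + t) ^ μ) (two_ne_zero) (-1)
  rw [show (2 : ℝ) * 0 + -1 = -1 by norm_num, show (2 : ℝ) * 1 + -1 = 1 by norm_num,
    smul_eq_mul] at h2
  have h3 : ∫ s in (0 : ℝ)..1, (1 - (2 * s + -1)) ^ (μ - 1) * (1 + (2 * s + -1)) ^ μ =
      2 ^ (2 * μ - 1) * ∫ s in (0 : ℝ)..1, s ^ μ * (1 - s) ^ (μ - 1) := by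
    rw [← intervalIntegral.integral_const_mul]
    refine intervalIntegral.integral_congr fun s hs => ?_
    rw [uIcc_of_le (by norm_num)] at hs
    have e1 : 1 - (2 * s + -1) = 2 * (1 - s) := by ring
    have e2 : 1 + (2 * s + -1) = 2 * s := by ring
    have e3 : (2 : ℝ) * μ - 1 = (μ - 1) + μ := by ring
    simp only [e1, e2, e3]
    rw [Real.mul_rpow (by norm_num) (by linarith [hs.2]), Real.mul_rpow (by norm_num) hs.1,
      Real.rpow_add (by norm_num)]
    ring
  have h4 : ∫ t in (-1 : ℝ)..1, (1 - t) ^ (μ - 1) * (1 + t) ^ μ =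
      2 ^ (2 * μ) * ProbabilityTheory.beta (μ + 1) μ := by
    have e : (2 : ℝ) ^ (2 * μ) = 2 * 2 ^ (2 * μ - 1) := by
      rw [Real.rpow_sub (by norm_num), Real.rpow_one]; ring
    rw [e, ← h1, mul_assoc, ← h3, h2]; ring
  rw [h4, ProbabilityTheory.beta, ProbabilityTheory.beta]
  have d := Real.Gamma_mul_Gamma_add_half (μ + 1 / 2)
  have e1 : μ + 1 / 2 + 1 / 2 = μ + 1 := by ring
  have e2 : 2 * (μ + 1 / 2) = μ + 1 + μ := by ring
  have e3 : 1 - (μ + 1 + μ) = - (2 * μ) := by ring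
  rw [e1, e2, e3, Real.rpow_neg (by norm_num)] at d
  rw [Real.Gamma_one_half_eq, add_comm (1 / 2) μ]
  have p1 : Real.Gamma (μ + 1 / 2) ≠ 0 := (Real.Gamma_pos_of_pos (by linarith)).ne'
  have p2 : Real.Gamma (μ + 1 + μ) ≠ 0 := (Real.Gamma_pos_of_pos (by linarith)).ne'
  have p3 : (2 : ℝ) ^ (2 * μ) ≠ 0 := by positivity
  field_simp at d ⊢
  linear_combination d

instance isProbabilityMeasure_alphaMu {μ : ℝ} [hμ : Fact (0 < μ)] :
    IsProbabilityMeasure (alphaMu μ) := by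
  have hμ := hμ.out
  refine ⟨?_⟩
  rw [← lintegral_one, lintegral_alphaMu]
  simp only [mul_one]
  have hi : IntegrableOn (alphaDensity μ) (Ioo (-1) 1) :=
    (integrableOn_jacobi (by linarith) (by linarith)).div_const _
  rw [← ofReal_integral_eq_lintegral_ofReal hi
    ((ae_restrict_iff' measurableSet_Ioo).2
      (Filter.Eventually.of_forall fun t ht => alphaDensity_nonneg hμ ht))]
  unfold alphaDensity
  rw [integral_div, ← integral_Ioc_eq_integral_Ioo,
    ← intervalIntegral.integral_of_le (by norm_num), integral_jacobi hμ,
    div_self (beta_half_pos hμ).ne', ENNReal.ofReal_one]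

lemma ae_alphaMu (μ : ℝ) : ∀ᵐ t ∂(alphaMu μ), t ∈ Ioo (-1 : ℝ) 1 :=
  (withDensity_absolutelyContinuous _ _).ae_le (ae_restrict_mem measurableSet_Ioo)

lemma integrable_alphaMu_of_continuous {E : Type*} [NormedAddCommGroup E]
    [SecondCountableTopology E] {μ : ℝ} [Fact (0 < μ)]
    {f : ℝ → E} (hf : Continuous f) : Integrable f (alphaMu μ) := by
  obtain ⟨C, hC⟩ := (isCompact_Icc (a := (-1 : ℝ)) (b := 1)).exists_bound_of_continuousOn
    hf.continuousOn
  refine Integrable.of_bound ?_ C ?_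
  · borelize E
    exact hf.measurable.aestronglyMeasurable
  filter_upwards [ae_alphaMu μ] with t ht using hC t (Ioo_subset_Icc_self ht)

/-- Integration by parts against `α_μ`. -/
lemma alphaMu_integral_sub_reflect {μ : ℝ} [Fact (0 < μ)] {F F' : ℝ → ℝ}
    (hF : ∀ t, HasDerivAt F (F' t) t) (hF' : Continuous F') :
    μ * (∫ t, F t ∂(alphaMu μ) - ∫ t, F (-t) ∂(alphaMu μ)) = ∫ t, F' t * (1 - t) ∂(alphaMu μ) := by
  have hμ : 0 < μ := Fact.out
  have hFc : Continuous F := continuous_iff_continuousAt.2 fun t => (hF t).continuousAt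
  have toInt : ∀ g : ℝ → ℝ, ∫ t, g t ∂(alphaMu μ) =
      ∫ t in (-1 : ℝ)..1, alphaDensity μ t * g t := fun g => by
    rw [integral_alphaMu hμ, intervalIntegral.integral_of_le (by norm_num),
      integral_Ioc_eq_integral_Ioo]
    rfl
  have hdi : IntervalIntegrable (alphaDensity μ) volume (-1) 1 :=
    (intervalIntegrable_jacobi (by linarith) (by linarith)).div_const _
  have hdi' : IntervalIntegrable (fun t => alphaDensity μ (-t)) volume (-1) 1 := by
    simpa using hdi.comp_mul_left (c := -1) |>.symm
  have hrefl : ∫ t in (-1 : ℝ)..1, alphaDensity μ t * F (-t) =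
      ∫ t in (-1 : ℝ)..1, alphaDensity μ (-t) * F t := by
    have := intervalIntegral.integral_comp_neg (a := -1) (b := 1)
      (fun t => alphaDensity μ (-t) * F t)
    simpa using this
  rw [toInt, toInt, toInt, hrefl, ← intervalIntegral.integral_sub
    (hdi.mul_continuousOn hFc.continuousOn) (hdi'.mul_continuousOn hFc.continuousOn),
    ← intervalIntegral.integral_const_mul]
  set B := ProbabilityTheory.beta (1 / 2) μ with hB
  have hBpos : 0 < B := beta_half_pos hμ
  -- The odd part of the density has an explicit primitive: `μ(α(t) - α(-t))` is the derivative of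
  -- `-(1-t²)^μ/B`. That primitive vanishes at both endpoints and equals `-(1-t)α(t)`, which
  -- produces the factor `1 - t`.
  have hv : ∀ t ∈ Ioo (-1 : ℝ) 1, HasDerivAt (fun t : ℝ => -(1 - t ^ 2) ^ μ / B)
      (2 * μ * t * (1 - t ^ 2) ^ (μ - 1) / B) t := by
    intro t ht
    have hp : 0 < 1 - t ^ 2 := by nlinarith [ht.1, ht.2]
    have h1 : HasDerivAt (fun t : ℝ => 1 - t ^ 2) (-(2 * t)) t := by
      simpa using (hasDerivAt_pow 2 t).const_sub 1
    refine ((h1.rpow_const (p := μ) (Or.inl hp.ne')).neg.div_const B).congr_deriv ?_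
    ring
  have hdens : ∀ t ∈ Ioo (-1 : ℝ) 1, μ * (alphaDensity μ t - alphaDensity μ (-t)) =
      2 * μ * t * (1 - t ^ 2) ^ (μ - 1) / B := by
    intro t ht
    have p1 : 0 < 1 - t := by linarith [ht.2]
    have p2 : 0 < 1 + t := by linarith [ht.1]
    have e : 1 - t ^ 2 = (1 - t) * (1 + t) := by ring
    rw [e, Real.mul_rpow p1.le p2.le, alphaDensity, alphaDensity, Real.rpow_sub_one p1.ne',
      Real.rpow_sub_one p2.ne', sub_neg_eq_add, ← sub_eq_add_neg, Real.rpow_sub_one p2.ne', ← hB]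
    field_simp
    ring
  have hdens2 : ∀ t ∈ Ioo (-1 : ℝ) 1, alphaDensity μ t * (1 - t) = (1 - t ^ 2) ^ μ / B := by
    intro t ht
    have p1 : 0 < 1 - t := by linarith [ht.2]
    have p2 : 0 < 1 + t := by linarith [ht.1]
    have e : 1 - t ^ 2 = (1 - t) * (1 + t) := by ring
    rw [e, Real.mul_rpow p1.le p2.le, alphaDensity, Real.rpow_sub_one p1.ne', ← hB]
    field_simp
  have hcongr : ∀ {f g : ℝ → ℝ}, (∀ t ∈ Ioo (-1 : ℝ) 1, f t = g t) →
      ∫ t in (-1 : ℝ)..1, f t = ∫ t in (-1 : ℝ)..1, g t := fun {f g} h => by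
    rw [intervalIntegral.integral_of_le (by norm_num), intervalIntegral.integral_of_le (by norm_num),
      integral_Ioc_eq_integral_Ioo, integral_Ioc_eq_integral_Ioo]
    exact setIntegral_congr_fun measurableSet_Ioo h
  have hvint : IntervalIntegrable (fun t : ℝ => 2 * μ * t * (1 - t ^ 2) ^ (μ - 1) / B)
      volume (-1) 1 := by
    rw [intervalIntegrable_iff_integrableOn_Ioo_of_le (by norm_num)]
    refine ((integrableOn_congr_fun hdens measurableSet_Ioo)).1 ?_
    rw [← intervalIntegrable_iff_integrableOn_Ioo_of_le (by norm_num)]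
    exact (hdi.sub hdi').const_mul μ
  have ibp := intervalIntegral.integral_mul_deriv_eq_deriv_mul_of_hasDerivAt
    (a := -1) (b := 1) (u := F) (u' := F')
    (v := fun t : ℝ => -(1 - t ^ 2) ^ μ / B) (v' := fun t => 2 * μ * t * (1 - t ^ 2) ^ (μ - 1) / B)
    hFc.continuousOn ?_ (fun t _ => hF t) ?_ (hF'.intervalIntegrable _ _) hvint
  · calc _ = ∫ t in (-1 : ℝ)..1, F t * (2 * μ * t * (1 - t ^ 2) ^ (μ - 1) / B) := by
          refine hcongr fun t ht => ?_
          rw [← hdens t ht]; ring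
      _ = ∫ t in (-1 : ℝ)..1, alphaDensity μ t * (F' t * (1 - t)) := by
          rw [ibp]
          norm_num [Real.zero_rpow hμ.ne']
          rw [← intervalIntegral.integral_neg]
          refine hcongr fun t ht => ?_
          have := hdens2 t ht
          linear_combination (-F' t) * this
  · refine ContinuousOn.div_const (ContinuousOn.neg ?_) _
    exact (Continuous.rpow_const (by fun_prop) fun _ => Or.inr hμ.le).continuousOn
  · intro t ht
    rw [min_eq_left (by norm_num), max_eq_right (by norm_num)] at ht
    exact hv t ht

/-! ### The generalized binomial -/

/-- The image of `xⁿ` under the generalized translation, a homogeneous polynomial in `x, y`. -/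
def dunklBinom (μ : ℝ) (n : ℕ) (x y : ℝ) : ℝ :=
  ∑ p ∈ Finset.HasAntidiagonal.antidiagonal n, gammaMu μ n / (gammaMu μ p.1 * gammaMu μ p.2) * (x ^ p.1 * y ^ p.2)

lemma dunklBinom_zero_left {μ : ℝ} (hμ : 0 < μ) (n : ℕ) (y : ℝ) : dunklBinom μ n 0 y = y ^ n := by
  cases n with
  | zero => simp [dunklBinom, gammaMu_zero hμ]
  | succ n =>
    rw [dunklBinom, Finset.Nat.sum_antidiagonal_succ]
    simp [gammaMu_zero hμ, div_self (gammaMu_pos hμ (n + 1)).ne']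

lemma dunklCoeff_pos {μ : ℝ} (hμ : 0 < μ) (n : ℕ) : 0 < dunklCoeff μ (n + 1) := by
  have := le_dunklCoeff hμ (n + 1)
  push_cast at this
  linarith [(n.cast_nonneg : (0 : ℝ) ≤ n)]

/-- Pascal's rule: for `j + k = n + 1` odd, the top coefficient splits as the sum of those of `j`
and `k`, and the two halves reindex to `x` and `y` times the polynomial of degree `n`. Parity is
essential. -/
lemma dunklBinom_succ_of_even {μ : ℝ} (hμ : 0 < μ) {n : ℕ} (hn : Even n) (x y : ℝ) :
    dunklBinom μ (n + 1) x y = (x + y) * dunklBinom μ n x y := by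
  have h : dunklBinom μ (n + 1) x y =
      ∑ p ∈ Finset.HasAntidiagonal.antidiagonal (n + 1), (gammaMu μ n * dunklCoeff μ p.1 /
        (gammaMu μ p.1 * gammaMu μ p.2) * (x ^ p.1 * y ^ p.2)) +
      ∑ p ∈ Finset.HasAntidiagonal.antidiagonal (n + 1), (gammaMu μ n * dunklCoeff μ p.2 /
        (gammaMu μ p.1 * gammaMu μ p.2) * (x ^ p.1 * y ^ p.2)) := by
    rw [← Finset.sum_add_distrib, dunklBinom]
    refine Finset.sum_congr rfl fun p hp => ?_
    rw [Finset.HasAntidiagonal.mem_antidiagonal] at hp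
    rw [gammaMu_succ hμ, ← hp, ← dunklCoeff_add μ (by rw [hp]; exact hn.add_one)]
    ring
  rw [h, Finset.Nat.sum_antidiagonal_succ, Finset.Nat.sum_antidiagonal_succ', add_mul, dunklBinom,
    Finset.mul_sum, Finset.mul_sum]
  simp only [dunklCoeff_zero, mul_zero, zero_div, zero_mul, zero_add]
  congr 1 <;>
  · refine Finset.sum_congr rfl fun p _ => ?_
    have h1 := (gammaMu_pos hμ p.1).ne'
    have h2 := (gammaMu_pos hμ p.2).ne'
    have h3 := (dunklCoeff_pos hμ p.1).ne'
    have h4 := (dunklCoeff_pos hμ p.2).ne'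
    simp only [gammaMu_succ hμ]
    field_simp
    ring

lemma hasDerivAt_dunklBinom (μ : ℝ) (n : ℕ) (x y : ℝ) :
    HasDerivAt (fun x => dunklBinom μ n x y) (∑ p ∈ Finset.HasAntidiagonal.antidiagonal n,
      gammaMu μ n / (gammaMu μ p.1 * gammaMu μ p.2) * (p.1 * x ^ (p.1 - 1) * y ^ p.2)) x := by
  unfold dunklBinom
  refine HasDerivAt.fun_sum fun p _ => ?_
  exact ((hasDerivAt_pow p.1 x).mul_const _).const_mul _

lemma dunkl_dunklBinom {μ : ℝ} (hμ : 0 < μ) (n : ℕ) {x : ℝ} (hx : x ≠ 0) (y : ℝ) :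
    deriv (fun x => dunklBinom μ (n + 1) x y) x +
      μ / x * (dunklBinom μ (n + 1) x y - dunklBinom μ (n + 1) (-x) y) =
      dunklCoeff μ (n + 1) * dunklBinom μ n x y := by
  rw [(hasDerivAt_dunklBinom μ (n + 1) x y).deriv]
  simp only [dunklBinom]
  rw [← Finset.sum_sub_distrib, Finset.mul_sum, ← Finset.sum_add_distrib, Finset.mul_sum,
    Finset.Nat.sum_antidiagonal_succ]
  simp only [pow_zero, sub_self, mul_zero, Nat.cast_zero, zero_mul, zero_add]
  refine Finset.sum_congr rfl fun p _ => ?_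
  have h1 := (gammaMu_pos hμ p.1).ne'
  have h2 := (gammaMu_pos hμ p.2).ne'
  have h3 := (dunklCoeff_pos hμ p.1).ne'
  simp only [gammaMu_succ hμ, neg_pow x, Nat.add_sub_cancel]
  have e : ((p.1 + 1 : ℕ) : ℝ) * x ^ p.1 * y ^ p.2 +
      μ / x * (x ^ (p.1 + 1) * y ^ p.2 - (-1) ^ (p.1 + 1) * x ^ (p.1 + 1) * y ^ p.2) =
      dunklCoeff μ (p.1 + 1) * (x ^ p.1 * y ^ p.2) := by
    rw [dunklCoeff]; field_simp; ring
  field_simp at e ⊢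
  linear_combination (dunklCoeff μ (n + 1) * gammaMu μ n) * e

/-- The energy estimate with `λ = 0`: zero energy at the origin stays zero. -/
lemma eq_zero_of_dunkl_eq_zero {μ : ℝ} (hμ : 0 < μ) {f f' : ℝ → ℝ}
    (hf : ∀ x, HasDerivAt f (f' x) x)
    (heq : ∀ x : ℝ, x ≠ 0 → f' x + μ / x * (f x - f (-x)) = 0) (h0 : f 0 = 0) (x : ℝ) :
    f x = 0 := by
  have key : ∀ x, 0 ≤ x → f x = 0 ∧ f (-x) = 0 := by
    intro x hx
    have := energy_le hμ 0 (fun x => (hf x).ofReal_comp) (fun x hx => by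
      have := heq x hx
      simp only [Complex.ofReal_zero, mul_zero, zero_mul]
      exact_mod_cast this) x hx
    simp only [h0, Complex.norm_real, Real.norm_eq_abs, sq_abs] at this
    constructor <;> nlinarith [sq_nonneg (f x), sq_nonneg (f (-x))]
  rcases le_total 0 x with h | h
  · exact (key x h).1
  · simpa using (key (-x) (by linarith)).2

/-- Induction on `m` through uniqueness for `𝔇` in `x`. Replacing `x` by `-x` in the integrand is
the same as replacing `t` by `-t`, so integration by parts rewrites the reflection term. Added to
the `x`-derivative, `2x + 2yt + 2y(1-t) = 2(x+y)`, and the integral for `m` reappears. -/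
lemma alphaMu_integral_pow {μ : ℝ} [Fact (0 < μ)] (m : ℕ) (x y : ℝ) :
    ∫ t, (x ^ 2 + 2 * x * y * t + y ^ 2) ^ m ∂(alphaMu μ) = dunklBinom μ (2 * m) x y := by
  have hμ : 0 < μ := Fact.out
  induction m generalizing x with
  | zero => simp [dunklBinom, gammaMu_zero hμ]
  | succ m ih =>
    set W : ℝ → ℝ → ℝ := fun x t => x ^ 2 + 2 * x * y * t + y ^ 2 with hW
    have hWc : ∀ x, Continuous (W x) := fun x => by simp only [hW]; fun_prop
    have hder : ∀ x, HasDerivAt (fun x => ∫ t, W x t ^ (m + 1) ∂(alphaMu μ))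
        (∫ t, ((m + 1 : ℕ) * W x t ^ m * (2 * x + 2 * y * t)) ∂(alphaMu μ)) x := by
      intro x
      have hcont : Continuous fun q : ℝ × ℝ =>
          ‖((m + 1 : ℕ) : ℝ) * W q.1 q.2 ^ m * (2 * q.1 + 2 * y * q.2)‖ := by
        simp only [hW]; fun_prop
      obtain ⟨C, hC⟩ := ((isCompact_closedBall x 1).prod (isCompact_Icc (a := (-1 : ℝ)) (b := 1))
        ).exists_bound_of_continuousOn hcont.continuousOn
      refine (hasDerivAt_integral_of_dominated_loc_of_deriv_le
        (F := fun x t => W x t ^ (m + 1)) (μ := alphaMu μ) (x₀ := x) (bound := fun _ => C)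
        (F' := fun x t => ((m + 1 : ℕ) : ℝ) * W x t ^ m * (2 * x + 2 * y * t))
        (Metric.ball_mem_nhds x one_pos) ?_ ?_ ?_ ?_ (integrable_const C) ?_).2
      · exact Filter.Eventually.of_forall fun x => ((hWc x).pow _).aestronglyMeasurable
      · exact integrable_alphaMu_of_continuous ((hWc x).pow _)
      · have := hWc x
        exact Continuous.aestronglyMeasurable (by fun_prop)
      · filter_upwards [ae_alphaMu μ] with t ht z hz
        simpa using hC (z, t) ⟨Metric.ball_subset_closedBall hz, Ioo_subset_Icc_self ht⟩
      · refine Filter.Eventually.of_forall fun t z _ => ?_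
        have h1 : HasDerivAt (fun x => W x t) (2 * z + 2 * y * t) z := by
          have := ((hasDerivAt_pow 2 z).add ((hasDerivAt_id z).const_mul (2 * y * t))).add_const
            (y ^ 2)
          refine (this.congr_deriv (by simp)).congr_of_eventuallyEq
            (Filter.Eventually.of_forall fun x => ?_)
          simp [hW]; ring
        exact (h1.fun_pow (m + 1)).congr_deriv (by simp)
    have hdunkl : ∀ x : ℝ, x ≠ 0 →
        (∫ t, ((m + 1 : ℕ) * W x t ^ m * (2 * x + 2 * y * t)) ∂(alphaMu μ)) +
        μ / x * ((∫ t, W x t ^ (m + 1) ∂(alphaMu μ)) - ∫ t, W (-x) t ^ (m + 1) ∂(alphaMu μ)) =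
        2 * (m + 1 : ℕ) * ((x + y) * dunklBinom μ (2 * m) x y) := by
      intro x hx
      have h1 := alphaMu_integral_sub_reflect (μ := μ) (F := fun t => W x t ^ (m + 1))
        (F' := fun t => (m + 1 : ℕ) * W x t ^ m * (2 * x * y)) (fun t => by
          have h1 : HasDerivAt (fun t => W x t) (2 * x * y) t := by
            have := (((hasDerivAt_id t).const_mul (2 * x * y)).const_add (x ^ 2)).add_const (y ^ 2)
            exact this.congr_deriv (mul_one _)
          exact (h1.fun_pow (m + 1)).congr_deriv (by simp)) (by have := hWc x; fun_prop)
      have h2 : ∀ t, W (-x) t = W x (-t) := fun t => by simp only [hW]; ring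
      simp only [h2]
      rw [div_mul_eq_mul_div, h1, ← ih x, ← integral_div, ← integral_add, ← integral_const_mul,
        ← integral_const_mul]
      · refine integral_congr_ae (Filter.Eventually.of_forall fun t => ?_)
        simp only [hW]
        field_simp
        ring
      · have := hWc x
        exact integrable_alphaMu_of_continuous (by fun_prop)
      · have := hWc x
        exact integrable_alphaMu_of_continuous (by fun_prop)
    have e2 : 2 * (m + 1) = 2 * m + 1 + 1 := by ring
    -- The difference of the two sides is annihilated by `𝔇` and vanishes at `0`, where both equal
    -- `y^(2m+2)`.
    have := eq_zero_of_dunkl_eq_zero hμ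
      (fun x => (hder x).sub (hasDerivAt_dunklBinom μ (2 * (m + 1)) x y)) (fun x hx => ?_) ?_ x
    · exact sub_eq_zero.1 this
    · rw [e2]
      have h1 := hdunkl x hx
      have h2 := dunkl_dunklBinom hμ (2 * m + 1) hx y
      rw [(hasDerivAt_dunklBinom μ (2 * m + 1 + 1) x y).deriv,
        dunklBinom_succ_of_even hμ (even_two_mul m), dunklCoeff_even μ (by grind)] at h2
      simp only [Pi.sub_apply]
      push_cast at h1 h2 ⊢
      linear_combination h1 - h2
    · simp [hW, dunklBinom_zero_left hμ, ← pow_mul]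

/-! ### Generalized translation of entire functions -/

lemma omegaTilde_sq {x y t : ℝ} (ht : t ∈ Ioo (-1 : ℝ) 1) :
    omegaTilde x y t ^ 2 = x ^ 2 + 2 * x * y * t + y ^ 2 := by
  rw [omegaTilde, Real.sq_sqrt]
  nlinarith [sq_nonneg (x + t * y), mul_nonneg (mul_nonneg (by linarith [ht.1] : 0 ≤ 1 + t)
    (by linarith [ht.2] : 0 ≤ 1 - t)) (sq_nonneg y)]

lemma omegaTilde_nonneg (x y t : ℝ) : 0 ≤ omegaTilde x y t := Real.sqrt_nonneg _

lemma omegaTilde_pos {x y t : ℝ} (hx : x ≠ 0) (ht : t ∈ Ioo (-1 : ℝ) 1) :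
    0 < omegaTilde x y t := by
  refine Real.sqrt_pos.2 ?_
  have h1 : 0 < 1 + t := by linarith [ht.1]
  have h2 : 0 < 1 - t := by linarith [ht.2]
  have hx2 : 0 < x ^ 2 := by positivity
  nlinarith [sq_nonneg (y + t * x), mul_pos (mul_pos h1 h2) hx2]

lemma omegaTilde_le {x y t : ℝ} (ht : t ∈ Ioo (-1 : ℝ) 1) : omegaTilde x y t ≤ |x| + |y| := by
  refine abs_le_of_sq_le_sq' ?_ (by positivity) |>.2
  rw [omegaTilde_sq ht, add_sq, sq_abs, sq_abs]
  have : x * y * t ≤ |x| * |y| := by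
    calc x * y * t ≤ |x * y * t| := le_abs_self _
      _ = |x| * |y| * |t| := by rw [abs_mul, abs_mul]
      _ ≤ |x| * |y| * 1 := by gcongr; exact abs_le.2 ⟨ht.1.le, ht.2.le⟩
      _ = _ := mul_one _
  linarith

lemma continuous_omegaTilde (x y : ℝ) : Continuous (omegaTilde x y) := by
  unfold omegaTilde; fun_prop

/-- This is `2ω² - (1+t)(x+y)² = (1-t)(x-y)² ≥ 0`. The bound does not depend on `x, y`, which is the
source of all uniform kernel estimates. -/
lemma abs_add_div_omegaTilde_le {x y t : ℝ} (ht : t ∈ Ioo (-1 : ℝ) 1) :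
    |(x + y) / omegaTilde x y t| ≤ Real.sqrt (2 / (1 + t)) := by
  have h1 : 0 < 1 + t := by linarith [ht.1]
  rcases (omegaTilde_nonneg x y t).eq_or_lt with h | h
  · rw [← h, div_zero, abs_zero]; exact Real.sqrt_nonneg _
  · refine Real.abs_le_sqrt ?_
    rw [div_pow, div_le_div_iff₀ (by positivity) h1, omegaTilde_sq ht]
    nlinarith [mul_nonneg (by linarith [ht.2] : 0 ≤ 1 - t) (sq_nonneg (x - y))]

/-- The square root costs half a power of `1 + t` and leaves the exponent `μ - 1/2 > -1`. -/
lemma integrable_sqrt_alphaMu {μ : ℝ} (hμ : 0 < μ) :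
    Integrable (fun t => Real.sqrt (2 / (1 + t))) (alphaMu μ) := by
  rw [integrable_alphaMu_iff hμ]
  have := ((integrableOn_jacobi (a := μ - 1) (b := μ - 1 / 2) (by linarith)
    (by linarith)).const_mul (Real.sqrt 2)).div_const (ProbabilityTheory.beta (1 / 2) μ)
  refine (integrableOn_congr_fun (fun t ht => ?_) measurableSet_Ioo).1 this
  have h1 : 0 < 1 + t := by linarith [ht.1]
  rw [alphaDensity, smul_eq_mul, Real.sqrt_div (by norm_num), Real.rpow_sub h1, ← Real.sqrt_eq_rpow]
  have := (beta_half_pos hμ).ne'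
  field_simp

lemma measurable_add_div_omegaTilde (x y : ℝ) :
    Measurable (fun t => (x + y) / omegaTilde x y t) :=
  measurable_const.div (continuous_omegaTilde x y).measurable

/-- Each monomial is translated into its generalized binomial; the series is then integrated
termwise by dominated convergence, since `ω ≤ |x| + |y|`. The hypothesis `x ≠ 0` keeps `ω` positive.
-/
lemma hasSum_genTranslation {μ : ℝ} [Fact (0 < μ)] {a : ℕ → ℂ} {f : ℂ → ℂ}
    (hf : HasEntireSeries a f) {x : ℝ} (hx : x ≠ 0) (y : ℝ) :
    HasSum (fun n => a n * (dunklBinom μ n x y : ℂ)) (genTranslation μ y (fun x : ℝ => f x) x) := by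
  have hμ : 0 < μ := Fact.out
  set w := omegaTilde x y with hw
  set r : ℝ → ℝ := fun t => (x + y) / w t with hr
  have hwc : Continuous w := continuous_omegaTilde x y
  have hrm : Measurable r := measurable_add_div_omegaTilde x y
  set g : ℕ → ℝ → ℝ := fun n t => 1 / 2 * ((1 + r t) * w t ^ n + (1 - r t) * (-w t) ^ n) with hg
  have hgm : ∀ n, Measurable (g n) := fun n => by
    have := hwc.measurable
    simp only [hg]; fun_prop
  set R := |x| + |y| with hR
  have hR0 : 0 ≤ R := by positivity
  set q : ℝ → ℝ := fun t => Real.sqrt (2 / (1 + t)) with hq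
  have hqi : Integrable q (alphaMu μ) := integrable_sqrt_alphaMu hμ
  have hgb : ∀ n, ∀ t ∈ Ioo (-1 : ℝ) 1, |g n t| ≤ (1 + q t) * R ^ n := by
    intro n t ht
    have h1 : |r t| ≤ q t := abs_add_div_omegaTilde_le ht
    have h2 : |w t| ≤ R := by
      rw [abs_of_nonneg (omegaTilde_nonneg _ _ _)]; exact omegaTilde_le ht
    have h3 : |1 + r t| ≤ 1 + q t := (abs_add_le _ _).trans (by rw [abs_one]; linarith)
    have h4 : |1 - r t| ≤ 1 + q t := (abs_sub _ _).trans (by rw [abs_one]; linarith)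
    have h5 : |w t| ^ n ≤ R ^ n := pow_le_pow_left₀ (abs_nonneg _) h2 n
    have h0 : 0 ≤ 1 + q t := by positivity
    calc |g n t| ≤ 1 / 2 * (|1 + r t| * |w t| ^ n + |1 - r t| * |w t| ^ n) := by
          simp only [hg]
          rw [abs_mul, abs_of_pos (by norm_num : (0 : ℝ) < 1 / 2)]
          gcongr
          refine (abs_add_le _ _).trans ?_
          rw [abs_mul, abs_mul, abs_pow, abs_pow, abs_neg]
      _ ≤ 1 / 2 * ((1 + q t) * R ^ n + (1 + q t) * R ^ n) := by gcongr
      _ = _ := by ring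
  -- For even `n` the weights `1 ± r` add up and leave `ω^n`; for odd `n` they subtract and leave `r
  -- ω^n = (x+y) ω^(n-1)`.
  have hgint : ∀ n, ∫ t, g n t ∂(alphaMu μ) = dunklBinom μ n x y := by
    intro n
    rcases n.even_or_odd' with ⟨m, rfl | rfl⟩
    · rw [← alphaMu_integral_pow m x y]
      refine integral_congr_ae ?_
      filter_upwards [ae_alphaMu μ] with t ht
      simp only [hg, (even_two_mul m).neg_pow]
      rw [← omegaTilde_sq ht, pow_mul]
      ring
    · rw [dunklBinom_succ_of_even hμ (even_two_mul m), ← alphaMu_integral_pow m x y,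
        ← integral_const_mul]
      refine integral_congr_ae ?_
      filter_upwards [ae_alphaMu μ] with t ht
      have hp : w t ≠ 0 := (omegaTilde_pos hx ht).ne'
      simp only [hg, (odd_two_mul_add_one m).neg_pow, hr]
      rw [← omegaTilde_sq ht, ← hw, pow_succ, pow_mul]
      field_simp
      ring
  have hG : ∀ s : ℝ, (s = 1 ∨ s = -1) →
      Integrable (fun t => ((1 + s * r t : ℝ) : ℂ) * f (s * w t : ℝ)) (alphaMu μ) := by
    intro s hs
    obtain ⟨C, hC⟩ := (isCompact_Icc (a := -R) (b := R)).exists_bound_of_continuousOn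
      (f := fun z : ℝ => f z) (hf.differentiable.continuous.comp Complex.continuous_ofReal).continuousOn
    refine ((((integrable_const (1 : ℝ)).add hqi).mul_const C)).mono' ?_ ?_
    · have h1 : Measurable fun t => ((1 + s * r t : ℝ) : ℂ) := by fun_prop
      have h2 : Continuous fun t => f (s * w t : ℝ) :=
        hf.differentiable.continuous.comp (by fun_prop)
      exact (h1.mul h2.measurable).aestronglyMeasurable
    · filter_upwards [ae_alphaMu μ] with t ht
      have h1 : |r t| ≤ q t := abs_add_div_omegaTilde_le ht
      have h2 : |w t| ≤ R := by
        rw [abs_of_nonneg (omegaTilde_nonneg _ _ _)]; exact omegaTilde_le ht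
      have hs1 : |s| = 1 := by rcases hs with rfl | rfl <;> simp
      rw [norm_mul, Complex.norm_real, Real.norm_eq_abs]
      refine mul_le_mul ?_ (hC _ ?_) (norm_nonneg _) ?_
      · refine (abs_add_le _ _).trans ?_
        rw [abs_mul, hs1, abs_one, one_mul]
        simpa using h1
      · exact abs_le.1 (by rw [abs_mul, hs1, one_mul]; exact h2)
      · simp only [Pi.add_apply]; positivity
  have hT : genTranslation μ y (fun x : ℝ => f x) x =
      ∫ t, (1 / 2 * ((1 + r t : ℝ) * f (w t : ℝ) + (1 - r t : ℝ) * f (-w t : ℝ)) : ℂ)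
        ∂(alphaMu μ) := by
    have h1 := hG 1 (Or.inl rfl)
    have h2 := hG (-1) (Or.inr rfl)
    simp only [one_mul, neg_mul, ← sub_eq_add_neg] at h1 h2
    rw [integral_const_mul, integral_add h1 h2, mul_add]
    rfl
  rw [hT]
  have := hasSum_integral_of_dominated_convergence (μ := alphaMu μ)
    (F := fun n t => a n * ((g n t : ℝ) : ℂ))
    (f := fun t => (1 / 2 * ((1 + r t : ℝ) * f (w t : ℝ) + (1 - r t : ℝ) * f (-w t : ℝ)) : ℂ))
    (fun n t => (1 + q t) * (‖a n‖ * |R| ^ n)) (fun n => ?_) (fun n => ?_) ?_ ?_ ?_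
  · refine hasSum_of_eq this (fun n => ?_) rfl
    rw [integral_const_mul, ← hgint n]
    exact congrArg _ integral_ofReal.symm
  · have := hgm n
    exact Measurable.aestronglyMeasurable (by fun_prop)
  · filter_upwards [ae_alphaMu μ] with t ht
    rw [norm_mul, Complex.norm_real, Real.norm_eq_abs, abs_of_nonneg hR0]
    calc _ ≤ ‖a n‖ * ((1 + q t) * R ^ n) := by gcongr; exact hgb n t ht
      _ = _ := by ring
  · exact Filter.Eventually.of_forall fun t => (hf.summable_norm R).mul_left _
  · simp only [tsum_mul_left]
    exact ((integrable_const 1).add hqi).mul_const _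
  · refine Filter.Eventually.of_forall fun t => ?_
    refine hasSum_of_eq ((((hf (w t)).mul_left ((1 + r t : ℝ) : ℂ)).add
      ((hf (-w t : ℝ)).mul_left ((1 - r t : ℝ) : ℂ))).mul_left (1 / 2)) (fun n => ?_) rfl
    simp only [hg]
    push_cast
    ring

/-- From `ω ≤ x + y` and total mass one. Applied at `|x|, |y|` it gives absolute convergence of the
double series below, whose coefficients are positive. -/
lemma abs_dunklBinom_le {μ : ℝ} [Fact (0 < μ)] (n : ℕ) {x y : ℝ} (hx : 0 ≤ x) (hy : 0 ≤ y) :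
    dunklBinom μ n x y ≤ (x + y) ^ n := by
  have hμ : 0 < μ := Fact.out
  have even : ∀ m, dunklBinom μ (2 * m) x y ≤ (x + y) ^ (2 * m) := by
    intro m
    rw [← alphaMu_integral_pow m x y]
    have : ∫ t, (x + y) ^ (2 * m) ∂(alphaMu μ) = (x + y) ^ (2 * m) := by simp
    rw [← this]
    refine integral_mono_ae ?_ (integrable_const _) ?_
    · exact integrable_alphaMu_of_continuous (by fun_prop)
    · filter_upwards [ae_alphaMu μ] with t ht
      rw [← omegaTilde_sq ht, ← pow_mul]
      have := omegaTilde_le (x := x) (y := y) ht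
      rw [abs_of_nonneg hx, abs_of_nonneg hy] at this
      exact pow_le_pow_left₀ (omegaTilde_nonneg _ _ _) this _
  rcases n.even_or_odd' with ⟨m, rfl | rfl⟩
  · exact even m
  · rw [dunklBinom_succ_of_even hμ (even_two_mul m), pow_succ, mul_comm]
    gcongr
    exact even m

/-- One absolutely convergent double series is summed in two ways: along antidiagonals it gives the
generalized binomials, by powers of `y` it gives the iterates of `𝔇`. -/
lemma hasSum_translationTerm {μ : ℝ} [Fact (0 < μ)] {a : ℕ → ℂ} {f : ℂ → ℂ}
    (hf : HasEntireSeries a f) (x y : ℝ) :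
    HasSum (translationTerm μ y f x) (∑' n, a n * (dunklBinom μ n x y : ℂ)) := by
  have hμ : 0 < μ := Fact.out
  set c : ℕ × ℕ → ℂ := fun p => a (p.1 + p.2) *
    ((gammaMu μ (p.1 + p.2) / (gammaMu μ p.1 * gammaMu μ p.2) * (x ^ p.1 * y ^ p.2) : ℝ) : ℂ)
    with hc
  set e := Finset.HasAntidiagonal.sigmaAntidiagonalEquivProd (A := ℕ)
  have hfib : ∀ n, ∑ p : Finset.HasAntidiagonal.antidiagonal n, c p =
      a n * (dunklBinom μ n x y : ℂ) := by
    intro n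
    rw [Finset.sum_coe_sort _ c, dunklBinom, Complex.ofReal_sum, Finset.mul_sum]
    refine Finset.sum_congr rfl fun p hp => ?_
    rw [Finset.HasAntidiagonal.mem_antidiagonal] at hp
    simp only [hc, hp]
  have hsum : Summable (c ∘ e) := by
    refine Summable.of_norm ((summable_sigma_of_nonneg fun _ => norm_nonneg _).2
      ⟨fun n => (hasSum_fintype _).summable, ?_⟩)
    refine Summable.of_nonneg_of_le (fun n => tsum_nonneg fun _ => norm_nonneg _) (fun n => ?_)
      (hf.summable_norm (|x| + |y|))
    rw [tsum_fintype]
    have : ∑ p : Finset.HasAntidiagonal.antidiagonal n, ‖c p‖ =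
        ‖a n‖ * dunklBinom μ n |x| |y| := by
      rw [Finset.sum_coe_sort _ (fun p => ‖c p‖), dunklBinom, Finset.mul_sum]
      refine Finset.sum_congr rfl fun p hp => ?_
      rw [Finset.HasAntidiagonal.mem_antidiagonal] at hp
      have h1 := gammaMu_pos hμ n
      have h2 := gammaMu_pos hμ p.1
      have h3 := gammaMu_pos hμ p.2
      simp only [hc, hp]
      rw [norm_mul, Complex.norm_real, Real.norm_eq_abs, abs_mul, abs_mul, abs_pow, abs_pow,
        abs_of_pos (by positivity : 0 < gammaMu μ n / (gammaMu μ p.1 * gammaMu μ p.2))]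
    refine this.le.trans ?_
    rw [abs_of_nonneg (by positivity : 0 ≤ |x| + |y|)]
    gcongr
    exact abs_dunklBinom_le n (abs_nonneg x) (abs_nonneg y)
  have hS := hsum.hasSum
  have h1 : HasSum (fun n => a n * (dunklBinom μ n x y : ℂ)) (∑' p, (c ∘ e) p) := by
    refine hasSum_of_eq (hS.sigma fun n => hasSum_fintype _) (fun n => ?_) rfl
    rw [← hfib n]
    rfl
  rw [h1.tsum_eq]
  -- The swap makes the exponent of `y`, that is the order of `𝔇`, the outer index.
  have h2 : HasSum (c ∘ Equiv.prodComm ℕ ℕ) (∑' p, (c ∘ e) p) :=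
    (Equiv.hasSum_iff _).2 ((Equiv.hasSum_iff e).1 hS)
  refine hasSum_of_eq (h2.prod_fiberwise (fun j => ?_)) (fun j => rfl) rfl
  refine hasSum_of_eq ((hf.dunklDeriv_iterate hμ j x).mul_left ((y : ℂ) ^ j / (gammaMu μ j : ℂ)))
    (fun k => ?_) rfl
  simp only [hc, Function.comp, Equiv.prodComm_apply, Prod.swap_prod_mk]
  push_cast
  have h2 := gammaMu_ne_zero hμ j
  have h3 := gammaMu_ne_zero hμ k
  field_simp

/-- In the Cauchy product of the two series the factor `γ(n)` of the generalized binomial cancels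
the denominator of the coefficient. -/
lemma genTranslation_expMu {μ : ℝ} [Fact (0 < μ)] (c : ℂ) {x : ℝ} (hx : x ≠ 0) (y : ℝ) :
    genTranslation μ y (fun x : ℝ => expMu μ (c * x)) x = expMu μ (c * x) * expMu μ (c * y) := by
  have hμ : 0 < μ := Fact.out
  have hs := hasEntireSeries_expMu hμ c
  refine (hasSum_genTranslation hs hx y).unique ?_
  have hx := (hs x).summable.norm
  have hy := (hs y).summable.norm
  have ex : expMu μ (c * x) = _ := (hs x).tsum_eq.symm
  have ey : expMu μ (c * y) = _ := (hs y).tsum_eq.symm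
  rw [ex, ey, tsum_mul_tsum_eq_tsum_sum_antidiagonal_of_summable_norm hx hy]
  refine hasSum_of_eq (summable_norm_sum_mul_antidiagonal_of_summable_norm hx hy).of_norm.hasSum
    (fun n => ?_) rfl
  rw [dunklBinom, Complex.ofReal_sum, Finset.mul_sum]
  refine Finset.sum_congr rfl fun p hp => ?_
  rw [Finset.HasAntidiagonal.mem_antidiagonal] at hp
  have h1 := gammaMu_ne_zero hμ n
  have h2 := gammaMu_ne_zero hμ p.1
  have h3 := gammaMu_ne_zero hμ p.2
  rw [← hp, pow_add]
  rw [← hp] at h1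
  push_cast
  field_simp

/-! ### The weighted measure -/

/-- The density of `weightMeasure μ`. -/
def weight (μ x : ℝ) : ENNReal := ENNReal.ofReal (|x| ^ (2 * μ))

lemma measurable_weight (μ : ℝ) : Measurable (weight μ) := by
  unfold weight; fun_prop

lemma weight_lt_top (μ x : ℝ) : weight μ x < ⊤ := ENNReal.ofReal_lt_top

lemma weight_ne_zero (μ : ℝ) {x : ℝ} (hx : x ≠ 0) : weight μ x ≠ 0 := by
  rw [weight, Ne, ENNReal.ofReal_eq_zero, not_le]
  exact Real.rpow_pos_of_pos (abs_pos.2 hx) _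

lemma ae_ne_zero : ∀ᵐ x : ℝ, x ≠ 0 := by
  simp [ae_iff]

lemma weightMeasure_ac (μ : ℝ) : weightMeasure μ ≪ volume := withDensity_absolutelyContinuous _ _

/-- The weight vanishes only at `0`, so both measures have the same null sets. -/
lemma ac_weightMeasure (μ : ℝ) : volume ≪ weightMeasure μ := by
  refine withDensity_absolutelyContinuous' (measurable_weight μ).aemeasurable ?_
  filter_upwards [ae_ne_zero] with x hx using weight_ne_zero μ hx

lemma ae_weightMeasure (μ : ℝ) : ae (weightMeasure μ) = ae (volume : Measure ℝ) :=
  le_antisymm (weightMeasure_ac μ).ae_le (ac_weightMeasure μ).ae_le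

lemma lintegral_weightMeasure (μ : ℝ) (f : ℝ → ENNReal) :
    ∫⁻ x, f x ∂(weightMeasure μ) = ∫⁻ x, weight μ x * f x := by
  rw [weightMeasure, lintegral_withDensity_eq_lintegral_mul_non_measurable]
  · rfl
  · exact measurable_weight μ
  · exact Filter.Eventually.of_forall fun t => weight_lt_top μ t

lemma integral_weightMeasure {E : Type*} [NormedAddCommGroup E] [NormedSpace ℝ E] (μ : ℝ)
    (f : ℝ → E) : ∫ x, f x ∂(weightMeasure μ) = ∫ x, (|x| ^ (2 * μ)) • f x := by
  rw [weightMeasure, integral_withDensity_eq_integral_toReal_smul]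
  · refine integral_congr_ae (Filter.Eventually.of_forall fun t => ?_)
    simp only [ENNReal.toReal_ofReal (Real.rpow_nonneg (abs_nonneg t) _)]
  · exact measurable_weight μ
  · exact Filter.Eventually.of_forall fun t => weight_lt_top μ t

lemma integrable_weightMeasure_iff {E : Type*} [NormedAddCommGroup E] [NormedSpace ℝ E] (μ : ℝ)
    (f : ℝ → E) : Integrable f (weightMeasure μ) ↔ Integrable fun x => (|x| ^ (2 * μ)) • f x := by
  rw [weightMeasure, integrable_withDensity_iff_integrable_smul']
  · refine integrable_congr (Filter.Eventually.of_forall fun t => ?_)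
    simp only [ENNReal.toReal_ofReal (Real.rpow_nonneg (abs_nonneg t) _)]
  · exact measurable_weight μ
  · exact Filter.Eventually.of_forall fun t => weight_lt_top μ t

instance sigmaFinite_weightMeasure (μ : ℝ) : SigmaFinite (weightMeasure μ) :=
  SigmaFinite.withDensity_ofReal _

/-! ### The kernel of the generalized translation -/

/-- The cosine of the angle in the triangle with sides `x, y, z`, up to sign. -/
def cosAngle (y x z : ℝ) : ℝ := (z ^ 2 - x ^ 2 - y ^ 2) / (2 * x * y)

open Classical in
/-- For `y ≠ 0`, the kernel of the generalized translation with respect to Lebesgue measure. -/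
def transKernel (μ y x z : ℝ) : ℝ :=
  if cosAngle y x z ∈ Ioo (-1 : ℝ) 1 then
    1 / 2 * (1 + (x + y) / z) * alphaDensity μ (cosAngle y x z) * |z / (x * y)|
  else 0

lemma measurable_cosAngle (y : ℝ) : Measurable fun q : ℝ × ℝ => cosAngle y q.1 q.2 := by
  unfold cosAngle; fun_prop

lemma measurable_transKernel (μ y : ℝ) : Measurable fun q : ℝ × ℝ => transKernel μ y q.1 q.2 := by
  unfold transKernel
  refine Measurable.ite (measurable_cosAngle y measurableSet_Ioo) ?_ measurable_const
  have h1 := (measurable_alphaDensity μ).comp (measurable_cosAngle y)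
  have h2 : Measurable fun q : ℝ × ℝ => 1 / 2 * (1 + (q.1 + y) / q.2) := by fun_prop
  have h3 : Measurable fun q : ℝ × ℝ => |q.2 / (q.1 * y)| :=
    measurable_norm.comp (by fun_prop : Measurable fun q : ℝ × ℝ => q.2 / (q.1 * y))
  exact (h2.mul h1).mul h3

lemma measurable_transKernel_right (μ y x : ℝ) : Measurable (transKernel μ y x) :=
  Measurable.of_uncurry_left (f := transKernel μ y) (measurable_transKernel μ y)

/-- The range of the substitution `z = omegaTilde x y t`. -/
def sideSet (y x : ℝ) : Set ℝ := {z | 0 < z ∧ cosAngle y x z ∈ Ioo (-1 : ℝ) 1}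

lemma measurable_cosAngle_right (y x : ℝ) : Measurable (cosAngle y x) := by
  unfold cosAngle; fun_prop

lemma measurableSet_sideSet (y x : ℝ) : MeasurableSet (sideSet y x) :=
  measurableSet_Ioi.inter (measurable_cosAngle_right y x measurableSet_Ioo)

lemma omegaTilde_cosAngle {x y : ℝ} (hx : x ≠ 0) (hy : y ≠ 0) {z : ℝ} (hz : 0 ≤ z) :
    omegaTilde x y (cosAngle y x z) = z := by
  rw [omegaTilde, cosAngle]
  have : x ^ 2 + 2 * x * y * ((z ^ 2 - x ^ 2 - y ^ 2) / (2 * x * y)) + y ^ 2 = z ^ 2 := by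
    field_simp; ring
  rw [this, Real.sqrt_sq hz]

lemma cosAngle_omegaTilde {x y : ℝ} (hx : x ≠ 0) (hy : y ≠ 0) {t : ℝ} (ht : t ∈ Ioo (-1 : ℝ) 1) :
    cosAngle y x (omegaTilde x y t) = t := by
  rw [cosAngle, omegaTilde_sq ht]; field_simp; ring

lemma injOn_cosAngle {x y : ℝ} (hx : x ≠ 0) (hy : y ≠ 0) : InjOn (cosAngle y x) (sideSet y x) := by
  intro z hz w hw h
  rw [← omegaTilde_cosAngle hx hy hz.1.le, h, omegaTilde_cosAngle hx hy hw.1.le]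

lemma image_cosAngle {x y : ℝ} (hx : x ≠ 0) (hy : y ≠ 0) :
    cosAngle y x '' sideSet y x = Ioo (-1) 1 := by
  ext t
  constructor
  · rintro ⟨z, hz, rfl⟩; exact hz.2
  · intro ht
    refine ⟨omegaTilde x y t, ⟨omegaTilde_pos hx ht, ?_⟩, cosAngle_omegaTilde hx hy ht⟩
    rwa [cosAngle_omegaTilde hx hy ht]

lemma hasDerivAt_cosAngle (y x z : ℝ) : HasDerivAt (cosAngle y x) (z / (x * y)) z := by
  have := (((hasDerivAt_pow 2 z).sub_const (x ^ 2)).sub_const (y ^ 2)).div_const (2 * x * y)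
  refine this.congr_deriv ?_
  rw [mul_assoc]
  simp [mul_div_mul_left]

/-- Change of variables `t = cosAngle y x z` with `dt = z/(xy) dz`; the absolute value covers both
signs of `xy`. -/
lemma setIntegral_Ioo_eq_sideSet {E : Type*} [NormedAddCommGroup E] [NormedSpace ℝ E] {x y : ℝ}
    (hx : x ≠ 0) (hy : y ≠ 0) (f : ℝ → E) :
    ∫ t in Ioo (-1) 1, f t = ∫ z in sideSet y x, |z / (x * y)| • f (cosAngle y x z) := by
  rw [← image_cosAngle hx hy]
  exact integral_image_eq_integral_abs_deriv_smul (measurableSet_sideSet y x)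
    (fun z _ => (hasDerivAt_cosAngle y x z).hasDerivWithinAt) (injOn_cosAngle hx hy) f

lemma setLIntegral_Ioo_eq_sideSet {x y : ℝ} (hx : x ≠ 0) (hy : y ≠ 0) (f : ℝ → ENNReal) :
    ∫⁻ t in Ioo (-1) 1, f t =
      ∫⁻ z in sideSet y x, ENNReal.ofReal |z / (x * y)| * f (cosAngle y x z) := by
  rw [← image_cosAngle hx hy]
  exact lintegral_image_eq_lintegral_abs_deriv_mul (measurableSet_sideSet y x)
    (fun z _ => (hasDerivAt_cosAngle y x z).hasDerivWithinAt) (injOn_cosAngle hx hy) f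

lemma cosAngle_neg (y x z : ℝ) : cosAngle y x (-z) = cosAngle y x z := by
  simp [cosAngle]

lemma transKernel_eq_zero {μ y x z : ℝ} (hz : cosAngle y x z ∉ Ioo (-1 : ℝ) 1) :
    transKernel μ y x z = 0 := if_neg hz

/-- Positive `z` carries the term with `φ(ω)` and negative `z` the term with `φ(-ω)`: the angle is
even in `z`, while `(x+y)/z` is odd. The two half-lines stay separate so that no integrability of
`φ` is needed. -/
lemma genTranslation_eq_setIntegral {μ : ℝ} (hμ : 0 < μ) {x y : ℝ} (hx : x ≠ 0) (hy : y ≠ 0)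
    (φ : ℝ → ℂ) : genTranslation μ y φ x =
      (∫ z in Ioi 0, (transKernel μ y x z : ℂ) * φ z) +
      ∫ z in Ioi 0, (transKernel μ y x (-z) : ℂ) * φ (-z) := by
  have key : ∀ F : ℝ → ℂ, (∀ z, cosAngle y x z ∉ Ioo (-1 : ℝ) 1 → F z = 0) →
      ∫ z in Ioi 0, F z = ∫ z in sideSet y x, F z := fun F hF =>
    setIntegral_eq_of_subset_of_forall_sdiff_eq_zero measurableSet_Ioi (fun z hz => hz.1)
      (fun z hz => hF z fun h => hz.2 ⟨hz.1, h⟩)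
  rw [key _ fun z hz => by rw [transKernel_eq_zero hz]; simp,
    key _ fun z hz => by rw [transKernel_eq_zero (by rwa [cosAngle_neg])]; simp,
    genTranslation, integral_alphaMu hμ, integral_alphaMu hμ, setIntegral_Ioo_eq_sideSet hx hy,
    setIntegral_Ioo_eq_sideSet hx hy, ← integral_const_mul, ← integral_const_mul]
  congr 1 <;>
  · refine setIntegral_congr_fun (measurableSet_sideSet y x) fun z hz => ?_
    simp only [omegaTilde_cosAngle hx hy hz.1.le, transKernel, cosAngle_neg, if_pos hz.2,
      Complex.real_smul, neg_div, abs_neg, div_neg]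
    push_cast
    ring

lemma lintegral_eq_Ioi_add_neg (f : ℝ → ENNReal) (hf : Measurable f) :
    ∫⁻ z, f z = ∫⁻ z in Ioi 0, (f z + f (-z)) := by
  rw [lintegral_add_left hf, ← lintegral_add_compl f (measurableSet_Ioi (a := (0 : ℝ)))]
  congr 1
  rw [compl_Ioi, setLIntegral_congr Iio_ae_eq_Iic.symm,
    ← (Measure.measurePreserving_neg (volume : Measure ℝ)).setLIntegral_comp_preimage
      measurableSet_Iio hf]
  simp

/-- A bound for the norm of the generalized translations. -/
def transConst (μ : ℝ) : ENNReal :=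
  ∫⁻ t, ENNReal.ofReal (1 + Real.sqrt (2 / (1 + t))) ∂(alphaMu μ)

lemma transConst_lt_top {μ : ℝ} [Fact (0 < μ)] : transConst μ < ⊤ := by
  have h := (integrable_const (1 : ℝ)).add (integrable_sqrt_alphaMu (μ := μ) Fact.out)
  exact h.lintegral_lt_top

/-- Undoing the substitution, the contributions of `z` and `-z` together are at most `1 + |(x+y)/z|`
times the density, and that is bounded independently of `x` and `y`. -/
lemma lintegral_transKernel_le {μ : ℝ} (hμ : 0 < μ) {x y : ℝ} (hx : x ≠ 0) (hy : y ≠ 0) :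
    ∫⁻ z, ‖transKernel μ y x z‖ₑ ≤ transConst μ := by
  have hm : Measurable fun z => ‖transKernel μ y x z‖ₑ := (measurable_transKernel_right μ y x).enorm
  rw [lintegral_eq_Ioi_add_neg _ hm, transConst, lintegral_alphaMu,
    setLIntegral_Ioo_eq_sideSet hx hy]
  have e : ∫⁻ z in Ioi 0, (‖transKernel μ y x z‖ₑ + ‖transKernel μ y x (-z)‖ₑ) =
      ∫⁻ z in sideSet y x, (‖transKernel μ y x z‖ₑ + ‖transKernel μ y x (-z)‖ₑ) := by
    rw [← lintegral_indicator measurableSet_Ioi, ← lintegral_indicator (measurableSet_sideSet y x)]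
    refine lintegral_congr fun z => ?_
    by_cases hz : z ∈ sideSet y x
    · rw [indicator_of_mem hz, indicator_of_mem (show z ∈ Ioi 0 from hz.1)]
    · rw [indicator_of_notMem hz]
      by_cases hz0 : z ∈ Ioi (0 : ℝ)
      · have : cosAngle y x z ∉ Ioo (-1 : ℝ) 1 := fun h => hz ⟨hz0, h⟩
        rw [indicator_of_mem hz0, transKernel_eq_zero this,
          transKernel_eq_zero (by rwa [cosAngle_neg])]
        simp
      · rw [indicator_of_notMem hz0]
  rw [e]
  refine setLIntegral_mono' (measurableSet_sideSet y x) fun z hz => ?_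
  have hα := alphaDensity_nonneg hμ hz.2
  have hb := abs_add_div_omegaTilde_le (x := x) (y := y) hz.2
  rw [omegaTilde_cosAngle hx hy hz.1.le] at hb
  simp only [transKernel, cosAngle_neg, if_pos hz.2, Real.enorm_eq_ofReal_abs]
  rw [← ENNReal.ofReal_mul hα, ← ENNReal.ofReal_mul (abs_nonneg _),
    ← ENNReal.ofReal_add (abs_nonneg _) (abs_nonneg _)]
  refine ENNReal.ofReal_le_ofReal ?_
  rw [div_neg, neg_div, abs_neg, abs_mul, abs_mul _ |z / (x * y)|, abs_abs, abs_mul, abs_mul,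
    abs_mul (1 / 2 * (1 + -((x + y) / z))), abs_mul (1 / 2), abs_of_nonneg hα,
    abs_of_pos (by norm_num : (0 : ℝ) < 1 / 2)]
  have h1 : |1 + (x + y) / z| ≤ 1 + |(x + y) / z| := (abs_add_le _ _).trans (by rw [abs_one])
  have h2 : |1 + -((x + y) / z)| ≤ 1 + |(x + y) / z| :=
    (abs_add_le _ _).trans (by rw [abs_one, abs_neg])
  calc _ = 1 / 2 * (|1 + (x + y) / z| + |1 + -((x + y) / z)|) *
        (alphaDensity μ (cosAngle y x z) * |z / (x * y)|) := by ring
    _ ≤ (1 + Real.sqrt (2 / (1 + cosAngle y x z))) *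
        (alphaDensity μ (cosAngle y x z) * |z / (x * y)|) := by
      gcongr
      linarith
    _ = _ := by ring

/-- One factor `1 + τ` is taken out so that `1 - τ` and `1 + τ` both carry the exponent `μ - 1`; the
weight then completes `1 - τ²` to `x²(1 - τ²)`. -/
lemma weight_mul_transKernel_aux {μ : ℝ} {x y z : ℝ} (hx : x ≠ 0) (hy : y ≠ 0)
    (hz : z ≠ 0) (h : cosAngle y x z ∈ Ioo (-1 : ℝ) 1) :
    |x| ^ (2 * μ) * transKernel μ y x z =
      1 / 2 * ((1 + (x + y) / z) * (1 + cosAngle y x z)) *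
        (x ^ 2 * (1 - cosAngle y x z ^ 2)) ^ (μ - 1) * (|x| * |z| / |y|) /
        ProbabilityTheory.beta (1 / 2) μ := by
  rw [transKernel, if_pos h, alphaDensity]
  set τ := cosAngle y x z
  have p1 : 0 < 1 - τ := by linarith [h.2]
  have p2 : 0 < 1 + τ := by linarith [h.1]
  have px : 0 < |x| := abs_pos.2 hx
  have e1 : (1 - τ ^ 2) = (1 - τ) * (1 + τ) := by ring
  have e2 : |x| ^ (2 * μ) = (x ^ 2) ^ (μ - 1) * x ^ 2 := by
    rw [← sq_abs x, ← Real.rpow_natCast_mul px.le, ← Real.rpow_natCast, ← Real.rpow_add px]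
    congr 1; push_cast; ring
  rw [e1, Real.mul_rpow (by positivity) (by positivity), Real.mul_rpow p1.le p2.le, e2,
    Real.rpow_sub_one p2.ne', abs_div, abs_mul, ← sq_abs x]
  have := abs_pos.2 hy
  field_simp

/-- After multiplication by the weight, every factor is unchanged when `x` and `z` are exchanged and
`y` is negated. -/
lemma weight_mul_transKernel {μ : ℝ} {x y z : ℝ} (hx : x ≠ 0) (hy : y ≠ 0) (hz : z ≠ 0) :
    |x| ^ (2 * μ) * transKernel μ y x z = |z| ^ (2 * μ) * transKernel μ (-y) z x := by
  -- Both sides are the squared height over the side `y` of the triangle with sides `x, y, z`.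
  have heron : x ^ 2 * (1 - cosAngle y x z ^ 2) = z ^ 2 * (1 - cosAngle (-y) z x ^ 2) := by
    rw [cosAngle, cosAngle]; field_simp; ring
  have mem : ∀ t : ℝ, t ∈ Ioo (-1 : ℝ) 1 ↔ 0 < 1 - t ^ 2 := fun t => by
    rw [mem_Ioo, ← abs_lt, ← sq_lt_one_iff_abs_lt_one, sub_pos]
  have hiff : cosAngle y x z ∈ Ioo (-1 : ℝ) 1 ↔ cosAngle (-y) z x ∈ Ioo (-1 : ℝ) 1 := by
    rw [mem, mem, ← mul_pos_iff_of_pos_left (by positivity : 0 < x ^ 2), heron,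
      mul_pos_iff_of_pos_left (by positivity : 0 < z ^ 2)]
  by_cases h : cosAngle y x z ∈ Ioo (-1 : ℝ) 1
  · rw [weight_mul_transKernel_aux hx hy hz h,
      weight_mul_transKernel_aux hz (neg_ne_zero.2 hy) hx (hiff.1 h), ← heron, abs_neg]
    -- Both sides equal `(x+y+z)(x-y+z)(-x+y+z)/(2xyz)`.
    have : (1 + (x + y) / z) * (1 + cosAngle y x z) =
        (1 + (z + -y) / x) * (1 + cosAngle (-y) z x) := by
      rw [cosAngle, cosAngle]; field_simp; ring
    rw [this]; ring
  · rw [transKernel_eq_zero h, transKernel_eq_zero (fun h' => h (hiff.2 h'))]; simp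

/-! ### The absolute value of the kernel as an operator -/

/-- The operator whose kernel is the absolute value of that of the generalized translation. -/
def transAbs (μ y : ℝ) (φ : ℝ → ENNReal) (x : ℝ) : ENNReal :=
  ∫⁻ z, ‖transKernel μ y x z‖ₑ * φ z

lemma aemeasurable_transKernel_mul (μ y : ℝ) {φ : ℝ → ENNReal} (hφ : AEMeasurable φ) :
    AEMeasurable (fun q : ℝ × ℝ => ‖transKernel μ y q.1 q.2‖ₑ * φ q.2)
      ((volume : Measure ℝ).prod volume) :=
  (measurable_transKernel μ y).enorm.aemeasurable.mul hφ.comp_snd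

lemma aemeasurable_transAbs (μ y : ℝ) {φ : ℝ → ENNReal} (hφ : AEMeasurable φ) :
    AEMeasurable (transAbs μ y φ) := (aemeasurable_transKernel_mul μ y hφ).lintegral_prod_right'

lemma lintegral_transAbs_mul {μ y : ℝ} (hy : y ≠ 0) {φ g : ℝ → ENNReal} (hφ : AEMeasurable φ)
    (hg : AEMeasurable g) : ∫⁻ x, transAbs μ y φ x * g x ∂(weightMeasure μ) =
      ∫⁻ z, φ z * transAbs μ (-y) g z ∂(weightMeasure μ) := by
  rw [lintegral_weightMeasure, lintegral_weightMeasure]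
  have h1 : ∀ x, weight μ x * (transAbs μ y φ x * g x) =
      ∫⁻ z, weight μ x * g x * (‖transKernel μ y x z‖ₑ * φ z) := fun x => by
    rw [lintegral_const_mul'', transAbs]
    · ring
    · exact ((measurable_transKernel_right μ y x).enorm.aemeasurable.mul hφ)
  have h2 : ∀ z, weight μ z * (φ z * transAbs μ (-y) g z) =
      ∫⁻ x, weight μ z * φ z * (‖transKernel μ (-y) z x‖ₑ * g x) := fun z => by
    rw [lintegral_const_mul'', transAbs]
    · ring
    · exact ((measurable_transKernel_right μ (-y) z).enorm.aemeasurable.mul hg)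
  simp_rw [h1, h2]
  rw [lintegral_lintegral_swap]
  · refine lintegral_congr_ae ?_
    filter_upwards [ae_ne_zero] with z hz
    refine lintegral_congr_ae ?_
    filter_upwards [ae_ne_zero] with x hx
    have := congrArg (fun r : ℝ => ‖r‖ₑ) (weight_mul_transKernel (μ := μ) hx hy hz)
    simp only [enorm_mul] at this
    rw [Real.enorm_of_nonneg (Real.rpow_nonneg (abs_nonneg x) _),
      Real.enorm_of_nonneg (Real.rpow_nonneg (abs_nonneg z) _)] at this
    change weight μ x * _ = weight μ z * _ at this
    calc _ = weight μ x * ‖transKernel μ y x z‖ₑ * (φ z * g x) := by ring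
      _ = _ := by rw [this]; ring
  · exact ((measurable_weight μ).aemeasurable.mul hg).comp_fst.mul
      (aemeasurable_transKernel_mul μ y hφ)

lemma transAbs_const_le {μ : ℝ} (hμ : 0 < μ) {x y : ℝ} (hx : x ≠ 0) (hy : y ≠ 0) (c : ENNReal) :
    transAbs μ y (fun _ => c) x ≤ transConst μ * c := by
  rw [transAbs, lintegral_mul_const'' _ (measurable_transKernel_right μ y x).enorm.aemeasurable]
  gcongr
  exact lintegral_transKernel_le hμ hx hy

/-- The column bound is the row bound for `-y`, by transposition against the constant `1`. -/
lemma lintegral_transAbs_le {μ : ℝ} (hμ : 0 < μ) {y : ℝ} (hy : y ≠ 0) {φ : ℝ → ENNReal}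
    (hφ : AEMeasurable φ) : ∫⁻ x, transAbs μ y φ x ∂(weightMeasure μ) ≤
      transConst μ * ∫⁻ x, φ x ∂(weightMeasure μ) := by
  have := lintegral_transAbs_mul (μ := μ) hy hφ (aemeasurable_const (b := 1))
  simp only [mul_one] at this
  rw [this, mul_comm, ← lintegral_mul_const'' _ (hφ.mono_ac (weightMeasure_ac μ))]
  refine lintegral_mono_ae ?_
  rw [ae_weightMeasure]
  filter_upwards [ae_ne_zero] with z hz
  gcongr
  simpa using transAbs_const_le hμ hz (neg_ne_zero.2 hy) 1

/-- Cauchy–Schwarz for the measure `|K(x,z)| dz`, whose mass is bounded by the row estimate. -/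
lemma transAbs_sq_le {μ : ℝ} (hμ : 0 < μ) {x y : ℝ} (hx : x ≠ 0) (hy : y ≠ 0) {φ : ℝ → ENNReal}
    (hφ : AEMeasurable φ) :
    transAbs μ y φ x ^ 2 ≤ transConst μ * transAbs μ y (fun z => φ z ^ 2) x := by
  have hk := (measurable_transKernel_right μ y x).enorm
  set κ : Measure ℝ := volume.withDensity fun z => ‖transKernel μ y x z‖ₑ
  have hκ : ∀ f : ℝ → ENNReal, transAbs μ y f x = ∫⁻ z, f z ∂κ := fun f => by
    rw [lintegral_withDensity_eq_lintegral_mul_non_measurable _ hk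
      (Filter.Eventually.of_forall fun z => enorm_lt_top)]
    rfl
  have h := ENNReal.lintegral_mul_le_Lp_mul_Lq κ Real.HolderConjugate.two_two
    (hφ.mono_ac (withDensity_absolutelyContinuous _ _)) (aemeasurable_const (b := 1))
  have h1 : ∫⁻ _, (1 : ENNReal) ∂κ ≤ transConst μ := by
    rw [← hκ]
    simpa using transAbs_const_le hμ hx hy 1
  simp only [Pi.mul_apply, mul_one, ENNReal.one_rpow] at h
  rw [hκ, hκ]
  calc (∫⁻ z, φ z ∂κ) ^ 2 ≤ ((∫⁻ z, φ z ^ (2 : ℝ) ∂κ) ^ (1 / 2 : ℝ) *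
        (∫⁻ _, (1 : ENNReal) ∂κ) ^ (1 / 2 : ℝ)) ^ 2 := by gcongr
    _ = (∫⁻ z, φ z ^ (2 : ℝ) ∂κ) * ∫⁻ _, (1 : ENNReal) ∂κ := by
      rw [mul_pow, ← ENNReal.rpow_natCast, ← ENNReal.rpow_natCast, ← ENNReal.rpow_mul,
        ← ENNReal.rpow_mul]
      norm_num
    _ ≤ transConst μ * ∫⁻ z, φ z ^ 2 ∂κ := by
      rw [mul_comm]
      gcongr
      simp

/-- Schur's test: the row bound enters through Cauchy–Schwarz, the column bound through the `L¹_μ`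
estimate. -/
lemma lintegral_transAbs_sq_le {μ : ℝ} (hμ : 0 < μ) {y : ℝ} (hy : y ≠ 0) {φ : ℝ → ENNReal}
    (hφ : AEMeasurable φ) : ∫⁻ x, transAbs μ y φ x ^ 2 ∂(weightMeasure μ) ≤
      transConst μ ^ 2 * ∫⁻ x, φ x ^ 2 ∂(weightMeasure μ) := by
  have hφ2 : AEMeasurable fun x => φ x ^ 2 := hφ.pow_const 2
  calc _ ≤ ∫⁻ x, transConst μ * transAbs μ y (fun z => φ z ^ 2) x ∂(weightMeasure μ) := by
        refine lintegral_mono_ae ?_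
        rw [ae_weightMeasure]
        filter_upwards [ae_ne_zero] with x hx using transAbs_sq_le hμ hx hy hφ
    _ = transConst μ * ∫⁻ x, transAbs μ y (fun z => φ z ^ 2) x ∂(weightMeasure μ) :=
        lintegral_const_mul'' _ ((aemeasurable_transAbs μ y hφ2).mono_ac (weightMeasure_ac μ))
    _ ≤ transConst μ * (transConst μ * ∫⁻ x, φ x ^ 2 ∂(weightMeasure μ)) := by
        gcongr
        exact lintegral_transAbs_le hμ hy hφ2
    _ = _ := by ring

/-! ### The generalized translation as an integral operator -/

/-- Here `ω = |x|`, and the weights `1 ± x/|x|` select `φ(x)`. The kernel degenerates at `y = 0`, so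
this case is always treated apart. -/
lemma genTranslation_zero {μ : ℝ} [Fact (0 < μ)] (φ : ℝ → ℂ) {x : ℝ} (hx : x ≠ 0) :
    genTranslation μ 0 φ x = φ x := by
  have h : ∀ t, omegaTilde x 0 t = |x| := fun t => by simp [omegaTilde, Real.sqrt_sq_eq_abs]
  simp only [genTranslation, h, add_zero, integral_const, probReal_univ, one_smul]
  rcases hx.lt_or_gt with hx | hx
  · rw [abs_of_neg hx, div_neg, div_self hx.ne]
    norm_num
    ring
  · rw [abs_of_pos hx, div_self hx.ne']
    norm_num
    ring

lemma ae_genTranslation_zero {μ : ℝ} [Fact (0 < μ)] (φ : ℝ → ℂ) :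
    genTranslation μ 0 φ =ᵐ[volume] φ := by
  filter_upwards [ae_ne_zero] with x hx using genTranslation_zero φ hx

section Kernel

variable {μ y : ℝ} {φ : ℝ → ℂ}

lemma integrable_transKernel_mul {x : ℝ} (hφ : AEStronglyMeasurable φ volume)
    (hfin : transAbs μ y (fun z => ‖φ z‖ₑ) x < ⊤) :
    Integrable fun z => (transKernel μ y x z : ℂ) * φ z := by
  have hm : AEStronglyMeasurable (fun z => (transKernel μ y x z : ℂ) * φ z) volume :=
    (measurable_transKernel_right μ y x).complex_ofReal.aestronglyMeasurable.mul hφ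
  refine ⟨hm, ?_⟩
  rw [hasFiniteIntegral_iff_enorm]
  refine lt_of_eq_of_lt (lintegral_congr fun z => ?_) hfin
  rw [enorm_mul, ← ofReal_norm (transKernel μ y x z : ℂ), Complex.norm_real,
    ofReal_norm]

/-- Finiteness of the absolute integral is what allows the two half-line integrals to be joined. -/
lemma genTranslation_eq_integral (hμ : 0 < μ) (hy : y ≠ 0) {x : ℝ} (hx : x ≠ 0)
    (hφ : AEStronglyMeasurable φ volume) (hfin : transAbs μ y (fun z => ‖φ z‖ₑ) x < ⊤) :
    genTranslation μ y φ x = ∫ z, (transKernel μ y x z : ℂ) * φ z := by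
  have hi := integrable_transKernel_mul hφ hfin
  rw [genTranslation_eq_setIntegral hμ hx hy,
    integral_comp_neg_Ioi 0 (fun z => (transKernel μ y x z : ℂ) * φ z), neg_zero, add_comm,
    intervalIntegral.integral_Iic_add_Ioi hi.integrableOn hi.integrableOn]

lemma enorm_genTranslation_le (hμ : 0 < μ) (hy : y ≠ 0) {x : ℝ} (hx : x ≠ 0)
    (hφ : AEStronglyMeasurable φ volume) :
    ‖genTranslation μ y φ x‖ₑ ≤ transAbs μ y (fun z => ‖φ z‖ₑ) x := by
  rcases eq_or_ne (transAbs μ y (fun z => ‖φ z‖ₑ) x) ⊤ with h | h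
  · rw [h]; exact le_top
  · rw [genTranslation_eq_integral hμ hy hx hφ h.lt_top]
    refine (enorm_integral_le_lintegral_enorm _).trans (lintegral_mono fun z => le_of_eq ?_)
    rw [enorm_mul, ← ofReal_norm (transKernel μ y x z : ℂ), Complex.norm_real,
      ofReal_norm]

lemma aestronglyMeasurable_genTranslation (hμ : 0 < μ) (hy : y ≠ 0)
    (hφ : AEStronglyMeasurable φ volume) (hfin : ∀ᵐ x, transAbs μ y (fun z => ‖φ z‖ₑ) x < ⊤) :
    AEStronglyMeasurable (genTranslation μ y φ) volume := by
  have hm : AEStronglyMeasurable (fun q : ℝ × ℝ => (transKernel μ y q.1 q.2 : ℂ) * φ q.2)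
      (volume.prod volume) :=
    (measurable_transKernel μ y).complex_ofReal.aestronglyMeasurable.mul hφ.comp_snd
  refine hm.integral_prod_right'.congr ?_
  filter_upwards [ae_ne_zero, hfin] with x hx h
  exact (genTranslation_eq_integral hμ hy hx hφ h).symm

lemma eLpNorm_two_sq (ν : Measure ℝ) (f : ℝ → ℂ) :
    eLpNorm f 2 ν ^ 2 = ∫⁻ x, ‖f x‖ₑ ^ 2 ∂ν := by
  have := eLpNorm_nnreal_pow_eq_lintegral (f := f) (μ := ν) (p := 2) (by norm_num)
  simpa using this

lemma ae_transAbs_lt_top_of_memLp_two [Fact (0 < μ)] (hy : y ≠ 0)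
    (hφ : MemLp φ 2 (weightMeasure μ)) : ∀ᵐ x, transAbs μ y (fun z => ‖φ z‖ₑ) x < ⊤ := by
  have hμ : 0 < μ := Fact.out
  have hm : AEMeasurable (fun z => ‖φ z‖ₑ) := (hφ.1.mono_ac (ac_weightMeasure μ)).enorm
  have h1 := lintegral_transAbs_sq_le hμ hy hm
  rw [← eLpNorm_two_sq] at h1
  have h2 : ∫⁻ x, transAbs μ y (fun z => ‖φ z‖ₑ) x ^ 2 ∂(weightMeasure μ) ≠ ⊤ :=
    ne_top_of_le_ne_top (ENNReal.mul_ne_top (ENNReal.pow_ne_top transConst_lt_top.ne)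
      (ENNReal.pow_ne_top hφ.2.ne)) h1
  have h3 := ae_lt_top' (((aemeasurable_transAbs μ y hm).pow_const 2).mono_ac
    (weightMeasure_ac μ)) h2
  rw [ae_weightMeasure] at h3
  filter_upwards [h3] with x hx
  by_contra h
  rw [not_lt, top_le_iff] at h
  simp [h] at hx

lemma ae_transAbs_lt_top_of_memLp_one [Fact (0 < μ)] (hy : y ≠ 0)
    (hφ : MemLp φ 1 (weightMeasure μ)) : ∀ᵐ x, transAbs μ y (fun z => ‖φ z‖ₑ) x < ⊤ := by
  have hμ : 0 < μ := Fact.out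
  have hm : AEMeasurable (fun z => ‖φ z‖ₑ) := (hφ.1.mono_ac (ac_weightMeasure μ)).enorm
  have h1 := lintegral_transAbs_le hμ hy hm
  rw [← eLpNorm_one_eq_lintegral_enorm] at h1
  have h3 := ae_lt_top' ((aemeasurable_transAbs μ y hm).mono_ac (weightMeasure_ac μ))
    (ne_top_of_le_ne_top (ENNReal.mul_ne_top transConst_lt_top.ne hφ.2.ne) h1)
  rwa [ae_weightMeasure] at h3

lemma transAbs_le_of_memLp_top [Fact (0 < μ)] (hy : y ≠ 0) {x : ℝ} (hx : x ≠ 0) :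
    transAbs μ y (fun z => ‖φ z‖ₑ) x ≤ transConst μ * eLpNorm φ ⊤ volume := by
  refine le_trans (lintegral_mono_ae ?_) (transAbs_const_le Fact.out hx hy _)
  filter_upwards [enorm_ae_le_eLpNormEssSup φ volume] with z hz
  rw [eLpNorm_exponent_top]
  gcongr

lemma ae_transAbs_lt_top_of_memLp_top [Fact (0 < μ)] (hy : y ≠ 0)
    (hφ : MemLp φ ⊤ volume) : ∀ᵐ x, transAbs μ y (fun z => ‖φ z‖ₑ) x < ⊤ := by
  filter_upwards [ae_ne_zero] with x hx
  exact (transAbs_le_of_memLp_top hy hx).trans_lt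
    (ENNReal.mul_lt_top transConst_lt_top hφ.2)

/-! ### Boundedness in `L^∞`, `L¹_μ` and `L²_μ` -/

lemma memLp_top_genTranslation [Fact (0 < μ)] (y : ℝ) (hφ : MemLp φ ⊤ volume) :
    MemLp (genTranslation μ y φ) ⊤ volume := by
  rcases eq_or_ne y 0 with rfl | hy
  · exact hφ.ae_eq (ae_genTranslation_zero φ).symm
  refine ⟨aestronglyMeasurable_genTranslation Fact.out hy hφ.1
    (ae_transAbs_lt_top_of_memLp_top hy hφ), ?_⟩
  rw [eLpNorm_exponent_top]
  refine (essSup_le_of_ae_le (transConst μ * eLpNorm φ ⊤ volume) ?_).trans_lt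
    (ENNReal.mul_lt_top transConst_lt_top hφ.2)
  filter_upwards [ae_ne_zero] with x hx
  exact (enorm_genTranslation_le Fact.out hy hx hφ.1).trans (transAbs_le_of_memLp_top hy hx)

lemma memLp_one_genTranslation [Fact (0 < μ)] (y : ℝ) (hφ : MemLp φ 1 (weightMeasure μ)) :
    MemLp (genTranslation μ y φ) 1 (weightMeasure μ) := by
  rcases eq_or_ne y 0 with rfl | hy
  · exact hφ.ae_eq ((weightMeasure_ac μ).ae_eq (ae_genTranslation_zero φ).symm)
  have hm := hφ.1.mono_ac (ac_weightMeasure μ)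
  refine ⟨(aestronglyMeasurable_genTranslation Fact.out hy hm
    (ae_transAbs_lt_top_of_memLp_one hy hφ)).mono_ac (weightMeasure_ac μ), ?_⟩
  rw [eLpNorm_one_eq_lintegral_enorm]
  refine lt_of_le_of_lt (lintegral_mono_ae ?_)
    ((lintegral_transAbs_le Fact.out hy hm.enorm).trans_lt
      (ENNReal.mul_lt_top transConst_lt_top ?_))
  · rw [ae_weightMeasure]
    filter_upwards [ae_ne_zero] with x hx using enorm_genTranslation_le Fact.out hy hx hm
  · rw [← eLpNorm_one_eq_lintegral_enorm]; exact hφ.2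

/-- A crude bound, needed only for continuity in density arguments. The summand `1` covers `y = 0`.
-/
lemma eLpNorm_two_genTranslation_le [Fact (0 < μ)] (y : ℝ)
    (hφ : MemLp φ 2 (weightMeasure μ)) :
    eLpNorm (genTranslation μ y φ) 2 (weightMeasure μ) ≤
      (1 + transConst μ) * eLpNorm φ 2 (weightMeasure μ) := by
  rcases eq_or_ne y 0 with rfl | hy
  · rw [eLpNorm_congr_ae ((weightMeasure_ac μ).ae_eq (ae_genTranslation_zero φ))]
    exact le_mul_of_one_le_left' le_self_add
  have hm := hφ.1.mono_ac (ac_weightMeasure μ)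
  refine le_trans ?_ (mul_le_mul_left le_add_self _)
  rw [← ENNReal.pow_le_pow_left_iff two_ne_zero, mul_pow, eLpNorm_two_sq, eLpNorm_two_sq]
  refine (lintegral_mono_ae ?_).trans (lintegral_transAbs_sq_le Fact.out hy hm.enorm)
  rw [ae_weightMeasure]
  filter_upwards [ae_ne_zero] with x hx
  gcongr
  exact enorm_genTranslation_le Fact.out hy hx hm

lemma memLp_two_genTranslation [Fact (0 < μ)] (y : ℝ) (hφ : MemLp φ 2 (weightMeasure μ)) :
    MemLp (genTranslation μ y φ) 2 (weightMeasure μ) := by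
  refine ⟨?_, (eLpNorm_two_genTranslation_le y hφ).trans_lt (ENNReal.mul_lt_top
    (ENNReal.add_lt_top.2 ⟨ENNReal.one_lt_top, transConst_lt_top⟩) hφ.2)⟩
  rcases eq_or_ne y 0 with rfl | hy
  · exact hφ.1.congr ((weightMeasure_ac μ).ae_eq (ae_genTranslation_zero φ).symm)
  exact (aestronglyMeasurable_genTranslation Fact.out hy (hφ.1.mono_ac (ac_weightMeasure μ))
    (ae_transAbs_lt_top_of_memLp_two hy hφ)).mono_ac (weightMeasure_ac μ)

lemma genTranslation_sub [Fact (0 < μ)] (y : ℝ) {φ' : ℝ → ℂ} (hφ : MemLp φ 2 (weightMeasure μ))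
    (hφ' : MemLp φ' 2 (weightMeasure μ)) : genTranslation μ y (φ - φ') =ᵐ[volume]
      genTranslation μ y φ - genTranslation μ y φ' := by
  have hμ : 0 < μ := Fact.out
  rcases eq_or_ne y 0 with rfl | hy
  · filter_upwards [ae_ne_zero] with x hx
    simp [genTranslation_zero (μ := μ) _ hx]
  filter_upwards [ae_ne_zero, ae_transAbs_lt_top_of_memLp_two hy hφ,
    ae_transAbs_lt_top_of_memLp_two hy hφ', ae_transAbs_lt_top_of_memLp_two hy (hφ.sub hφ')]
    with x hx h1 h2 h3
  have m1 := hφ.1.mono_ac (ac_weightMeasure μ)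
  have m2 := hφ'.1.mono_ac (ac_weightMeasure μ)
  rw [Pi.sub_apply, genTranslation_eq_integral hμ hy hx m1 h1,
    genTranslation_eq_integral hμ hy hx m2 h2, genTranslation_eq_integral hμ hy hx (m1.sub m2) h3,
    ← integral_sub (integrable_transKernel_mul m1 h1) (integrable_transKernel_mul m2 h2)]
  simp only [Pi.sub_apply, mul_sub]

/-- The transpose of `𝔗_y` is `𝔗_{-y}`. -/
lemma integral_genTranslation_mul [Fact (0 < μ)] (y : ℝ) {g : ℝ → ℂ} (hφ : MemLp φ ⊤ volume)
    (hg : MemLp g 1 (weightMeasure μ)) :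
    ∫ x, genTranslation μ y φ x * g x ∂(weightMeasure μ) =
      ∫ z, φ z * genTranslation μ (-y) g z ∂(weightMeasure μ) := by
  have hμ : 0 < μ := Fact.out
  rcases eq_or_ne y 0 with rfl | hy
  · refine integral_congr_ae ?_
    rw [Filter.EventuallyEq, ae_weightMeasure]
    filter_upwards [ae_ne_zero] with x hx
    rw [neg_zero, genTranslation_zero _ hx, genTranslation_zero _ hx]
  have hy' := neg_ne_zero.2 hy
  have mg := hg.1.mono_ac (ac_weightMeasure μ)
  rw [integral_weightMeasure, integral_weightMeasure]
  have h1 : ∫ x, (|x| ^ (2 * μ)) • (genTranslation μ y φ x * g x) =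
      ∫ x, ∫ z, (|x| ^ (2 * μ)) • (((transKernel μ y x z : ℂ) * φ z) * g x) := by
    refine integral_congr_ae ?_
    filter_upwards [ae_ne_zero, ae_transAbs_lt_top_of_memLp_top (μ := μ) hy hφ] with x hx h
    rw [integral_smul, integral_mul_const, genTranslation_eq_integral hμ hy hx hφ.1 h]
  have h2 : ∫ z, (|z| ^ (2 * μ)) • (φ z * genTranslation μ (-y) g z) =
      ∫ z, ∫ x, (|z| ^ (2 * μ)) • (φ z * ((transKernel μ (-y) z x : ℂ) * g x)) := by
    refine integral_congr_ae ?_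
    filter_upwards [ae_ne_zero, ae_transAbs_lt_top_of_memLp_one hy' hg] with z hz h
    rw [integral_smul, integral_const_mul, genTranslation_eq_integral hμ hy' hz mg h]
  -- After Fubini the integrands agree pointwise by the kernel symmetry; absolute integrability
  -- follows from the uniform row bound, `φ ∈ L^∞` and `g ∈ L¹_μ`.
  rw [h1, h2, integral_integral_swap]
  · refine integral_congr_ae ?_
    filter_upwards [ae_ne_zero] with z hz
    refine integral_congr_ae ?_
    filter_upwards [ae_ne_zero] with x hx
    have := congrArg (fun r : ℝ => (r : ℂ)) (weight_mul_transKernel (μ := μ) hx hy hz)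
    simp only [Complex.ofReal_mul] at this
    simp only [Complex.real_smul]
    linear_combination (φ z * g x) * this
  · have hm : AEStronglyMeasurable (fun q : ℝ × ℝ =>
        (|q.1| ^ (2 * μ)) • (((transKernel μ y q.1 q.2 : ℂ) * φ q.2) * g q.1))
        (volume.prod volume) := by
      have h0 : Measurable fun q : ℝ × ℝ => |q.1| ^ (2 * μ) := by
        have : Measurable fun q : ℝ × ℝ => |q.1| := measurable_norm.comp measurable_fst
        fun_prop
      exact h0.aestronglyMeasurable.smul
        (((measurable_transKernel μ y).complex_ofReal.aestronglyMeasurable.mul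
          hφ.1.comp_snd).mul mg.comp_fst)
    refine ⟨hm, ?_⟩
    rw [hasFiniteIntegral_iff_enorm, Function.uncurry_def, lintegral_prod _ hm.enorm]
    have e : ∀ x, ∫⁻ z, ‖(|x| ^ (2 * μ)) • (((transKernel μ y x z : ℂ) * φ z) * g x)‖ₑ =
        weight μ x * (transAbs μ y (fun z => ‖φ z‖ₑ) x * ‖g x‖ₑ) := by
      intro x
      rw [transAbs, ← lintegral_mul_const' _ _ enorm_ne_top,
        ← lintegral_const_mul' _ _ (weight_lt_top μ x).ne]
      refine lintegral_congr fun z => ?_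
      rw [enorm_smul, enorm_mul, enorm_mul, ← ofReal_norm (transKernel μ y x z : ℂ),
        Complex.norm_real, ofReal_norm,
        Real.enorm_of_nonneg (Real.rpow_nonneg (abs_nonneg x) _)]
      rfl
    simp_rw [e]
    rw [← lintegral_weightMeasure]
    calc _ ≤ ∫⁻ x, (transConst μ * eLpNorm φ ⊤ volume) * ‖g x‖ₑ ∂(weightMeasure μ) := by
          refine lintegral_mono_ae ?_
          rw [ae_weightMeasure]
          filter_upwards [ae_ne_zero] with x hx
          gcongr
          exact transAbs_le_of_memLp_top hy hx
      _ < ⊤ := by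
          rw [lintegral_const_mul'' _ hg.1.enorm, ← eLpNorm_one_eq_lintegral_enorm]
          exact ENNReal.mul_lt_top (ENNReal.mul_lt_top transConst_lt_top hφ.2) hg.2

end Kernel

/-! ### Determination by moments -/

/-- Exponential integrability allows `exp(iξx)` to be expanded under the integral, so the Fourier
transform of `G` vanishes. The positive and negative parts then define finite measures with equal
characteristic functions. -/
lemma ae_eq_zero_of_forall_moment_eq_zero_real {G : ℝ → ℝ} (hm : AEStronglyMeasurable G)
    (hG : ∀ a : ℝ, Integrable fun x => Real.exp (a * |x|) * ‖G x‖)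
    (h0 : ∀ n : ℕ, ∫ x, x ^ n * G x = 0) : G =ᵐ[volume] 0 := by
  have hGi : Integrable G := by
    have := hG 0
    simp only [zero_mul, Real.exp_zero, one_mul] at this
    exact (integrable_norm_iff hm).1 this
  have hchar : ∀ ξ : ℝ, ∫ x : ℝ, Complex.exp (ξ * x * Complex.I) * (G x : ℂ) = 0 := by
    intro ξ
    have hterm : ∀ (n : ℕ) (x : ℝ), ((ξ * x * Complex.I) ^ n / (n.factorial : ℂ)) * (G x : ℂ) =
        (ξ * Complex.I) ^ n / (n.factorial : ℂ) * ((x ^ n * G x : ℝ) : ℂ) := fun n x => by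
      push_cast; ring
    have := hasSum_integral_of_dominated_convergence (μ := (volume : Measure ℝ))
      (F := fun (n : ℕ) x => ((ξ * x * Complex.I) ^ n / (n.factorial : ℂ)) * (G x : ℂ))
      (f := fun x => Complex.exp (ξ * x * Complex.I) * (G x : ℂ))
      (fun n x => (|ξ| * |x|) ^ n / n.factorial * ‖G x‖) (fun n => ?_) (fun n => ?_) ?_ ?_ ?_
    · refine this.unique ?_
      simp_rw [hterm, integral_const_mul]
      refine hasSum_of_eq hasSum_zero (fun n => ?_) rfl
      rw [integral_complex_ofReal, h0]
      simp
    · have h1 : Continuous fun x : ℝ => ((ξ * x * Complex.I) ^ n / (n.factorial : ℂ)) := by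
        fun_prop
      exact h1.aestronglyMeasurable.mul (Complex.continuous_ofReal.comp_aestronglyMeasurable hm)
    · refine Filter.Eventually.of_forall fun x => le_of_eq ?_
      simp
    · exact Filter.Eventually.of_forall fun x =>
        (Real.summable_pow_div_factorial (|ξ| * |x|)).mul_right _
    · refine (hG |ξ|).congr (Filter.Eventually.of_forall fun x => ?_)
      simp only [tsum_mul_right]
      rw [Real.exp_eq_exp_ℝ, NormedSpace.exp_eq_tsum_div]
    · refine Filter.Eventually.of_forall fun x => ?_
      have := NormedSpace.expSeries_div_hasSum_exp (𝔸 := ℂ) (ξ * x * Complex.I)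
      rw [← Complex.exp_eq_exp_ℂ] at this
      exact this.mul_right _
  have hpos := hGi.lintegral_lt_top
  have hneg := hGi.neg.lintegral_lt_top
  have hmp : AEMeasurable fun x => ENNReal.ofReal (G x) := hm.aemeasurable.ennreal_ofReal
  have hmn : AEMeasurable fun x => ENNReal.ofReal (-G x) := hm.aemeasurable.neg.ennreal_ofReal
  set P := (volume : Measure ℝ).withDensity fun x => ENNReal.ofReal (G x) with hP
  set N := (volume : Measure ℝ).withDensity fun x => ENNReal.ofReal (-G x) with hN
  have : IsFiniteMeasure P := isFiniteMeasure_withDensity hpos.ne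
  have : IsFiniteMeasure N := isFiniteMeasure_withDensity hneg.ne
  have hPN : P = N := by
    refine Measure.ext_of_charFun (funext fun ξ => ?_)
    rw [charFun_apply_real, charFun_apply_real, hP, hN,
      integral_withDensity_eq_integral_toReal_smul₀ hmp
        (Filter.Eventually.of_forall fun _ => ENNReal.ofReal_lt_top),
      integral_withDensity_eq_integral_toReal_smul₀ hmn
        (Filter.Eventually.of_forall fun _ => ENNReal.ofReal_lt_top), ← sub_eq_zero]
    have hint : ∀ {H : ℝ → ℝ}, Integrable H →
        Integrable fun x => (ENNReal.ofReal (H x)).toReal • Complex.exp (ξ * x * Complex.I) := by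
      intro H hH
      refine hH.norm.mono' ?_ (Filter.Eventually.of_forall fun x => ?_)
      · exact (hH.1.aemeasurable.ennreal_ofReal.ennreal_toReal.aestronglyMeasurable).smul
          (Continuous.aestronglyMeasurable (by fun_prop))
      · have : ‖Complex.exp (ξ * x * Complex.I)‖ = 1 := by
          exact_mod_cast Complex.norm_exp_ofReal_mul_I (ξ * x)
        rw [norm_smul, this, mul_one, ENNReal.toReal_ofReal', Real.norm_eq_abs,
          Real.norm_eq_abs, abs_of_nonneg (le_max_right _ _)]
        exact max_le (le_abs_self _) (abs_nonneg _)
    have hsub := integral_sub (hint hGi) (hint hGi.neg)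
    simp only [Pi.neg_apply] at hsub
    rw [← hsub, ← hchar ξ]
    refine integral_congr_ae (Filter.Eventually.of_forall fun x => ?_)
    simp only [ENNReal.toReal_ofReal', ← sub_smul]
    have : max (G x) 0 - max (-G x) 0 = G x := by
      rcases le_total 0 (G x) with h | h
      · rw [max_eq_left h, max_eq_right (by linarith), sub_zero]
      · rw [max_eq_right h, max_eq_left (by linarith), zero_sub, neg_neg]
    rw [this, Complex.real_smul, mul_comm]
  have := (withDensity_eq_iff hmp hmn hpos.ne).1 hPN
  filter_upwards [this] with x hx
  rcases le_total 0 (G x) with h | h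
  · rw [ENNReal.ofReal_of_nonpos (by linarith : -G x ≤ 0), ENNReal.ofReal_eq_zero] at hx
    exact le_antisymm hx h
  · rw [ENNReal.ofReal_of_nonpos h, eq_comm, ENNReal.ofReal_eq_zero] at hx
    exact le_antisymm h (neg_nonpos.1 hx)

lemma ae_eq_zero_of_forall_moment_eq_zero {G : ℝ → ℂ} (hm : AEStronglyMeasurable G)
    (hG : ∀ a : ℝ, Integrable fun x => Real.exp (a * |x|) * ‖G x‖)
    (h0 : ∀ n : ℕ, ∫ x : ℝ, (x : ℂ) ^ n * G x = 0) : G =ᵐ[volume] 0 := by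
  have hint : ∀ n : ℕ, Integrable fun x : ℝ => (x : ℂ) ^ n * G x := fun n => by
    refine ((hG 1).const_mul (n.factorial : ℝ)).mono' ?_ (Filter.Eventually.of_forall fun x => ?_)
    · exact (Continuous.aestronglyMeasurable (by fun_prop)).mul hm
    · have := Real.pow_div_factorial_le_exp |x| (abs_nonneg x) n
      rw [div_le_iff₀ (by positivity)] at this
      rw [norm_mul, norm_pow, Complex.norm_real, Real.norm_eq_abs, ← mul_assoc, one_mul,
        mul_comm (n.factorial : ℝ)]
      gcongr
  have hre := ae_eq_zero_of_forall_moment_eq_zero_real (G := fun x => (G x).re)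
    (Complex.continuous_re.comp_aestronglyMeasurable hm) (fun a => ?_) (fun n => ?_)
  have him := ae_eq_zero_of_forall_moment_eq_zero_real (G := fun x => (G x).im)
    (Complex.continuous_im.comp_aestronglyMeasurable hm) (fun a => ?_) (fun n => ?_)
  · filter_upwards [hre, him] with x h1 h2 using Complex.ext h1 h2
  · refine (hG a).mono' ?_ (Filter.Eventually.of_forall fun x => ?_)
    · exact (Continuous.aestronglyMeasurable (by fun_prop)).mul
        (Complex.continuous_im.comp_aestronglyMeasurable hm).norm
    · rw [norm_mul, norm_norm, Real.norm_of_nonneg (Real.exp_pos _).le]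
      gcongr
      exact Complex.abs_im_le_norm _
  · have := (integral_im (hint n)).trans (congrArg Complex.im (h0 n))
    simpa [← Complex.ofReal_pow] using this
  · refine (hG a).mono' ?_ (Filter.Eventually.of_forall fun x => ?_)
    · exact (Continuous.aestronglyMeasurable (by fun_prop)).mul
        (Complex.continuous_re.comp_aestronglyMeasurable hm).norm
    · rw [norm_mul, norm_norm, Real.norm_of_nonneg (Real.exp_pos _).le]
      gcongr
      exact Complex.abs_re_le_norm _
  · have := (integral_re (hint n)).trans (congrArg Complex.re (h0 n))
    simpa [← Complex.ofReal_pow] using this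

/-! ### Gaussian integrals for the weighted measure -/

lemma integrable_abs_rpow_mul_gaussian {b s : ℝ} (hb : 0 < b) (hs : -1 < s) :
    Integrable fun x : ℝ => |x| ^ s * Real.exp (-b * x ^ 2) := by
  have h := integrableOn_rpow_mul_exp_neg_mul_sq hb hs
  have h1 : IntegrableOn (fun x : ℝ => |x| ^ s * Real.exp (-b * x ^ 2)) (Ioi 0) :=
    (integrableOn_congr_fun (fun x hx => by rw [abs_of_pos hx]) measurableSet_Ioi).1 h
  have h2 : IntegrableOn (fun x : ℝ => |x| ^ s * Real.exp (-b * x ^ 2)) (Iio 0) := by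
    rw [← (Measure.measurePreserving_neg (volume : Measure ℝ)).integrableOn_comp_preimage
      (Homeomorph.neg ℝ).measurableEmbedding]
    simpa [Function.comp_def] using h1
  rw [← integrableOn_univ, ← Iic_union_Ioi (a := (0 : ℝ)), integrableOn_union,
    integrableOn_Iic_iff_integrableOn_Iio]
  exact ⟨h2, h1⟩

lemma integrable_exp_abs_mul_gaussian {μ : ℝ} (hμ : 0 < μ) (a : ℝ) {b : ℝ} (hb : 0 < b) :
    Integrable (fun x : ℝ => Real.exp (a * |x|) * Real.exp (-b * x ^ 2)) (weightMeasure μ) := by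
  rw [integrable_weightMeasure_iff]
  refine ((integrable_abs_rpow_mul_gaussian (half_pos hb) (s := 2 * μ) (by linarith)).const_mul
    (Real.exp (a ^ 2 / (2 * b)))).mono' ?_ (Filter.Eventually.of_forall fun x => ?_)
  · have h : Measurable fun x : ℝ => |x| := measurable_norm
    exact Measurable.aestronglyMeasurable (by fun_prop)
  · have h0 : 0 ≤ |x| ^ (2 * μ) := Real.rpow_nonneg (abs_nonneg x) _
    rw [smul_eq_mul, ← Real.exp_add, Real.norm_of_nonneg (by positivity), mul_left_comm,
      ← Real.exp_add]
    refine mul_le_mul_of_nonneg_left (Real.exp_le_exp.2 ?_) h0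
    -- Completing the square: half of the Gaussian absorbs `exp(a|x|)`.
    have : a ^ 2 / (2 * b) + -(b / 2) * x ^ 2 - (a * |x| + -b * x ^ 2) =
        (a - b * |x|) ^ 2 / (2 * b) := by
      rw [← sq_abs x]; field_simp; ring
    have h3 : 0 ≤ (a - b * |x|) ^ 2 / (2 * b) := by positivity
    linarith

/-- The entire function `p(z) exp(-b z²)`. -/
def gaussPolyWith (b : ℝ) (p : Polynomial ℂ) (z : ℂ) : ℂ := p.eval z * Complex.exp (-(b * z ^ 2))

lemma gaussPoly_eq (p : Polynomial ℂ) : gaussPoly p = gaussPolyWith 1 p := by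
  ext z; simp [gaussPoly, gaussPolyWith]

lemma differentiable_gaussPolyWith (b : ℝ) (p : Polynomial ℂ) :
    Differentiable ℂ (gaussPolyWith b p) := by
  unfold gaussPolyWith
  exact p.differentiable.mul (by fun_prop)

lemma gaussPolyWith_add (b : ℝ) (p q : Polynomial ℂ) (z : ℂ) :
    gaussPolyWith b (p + q) z = gaussPolyWith b p z + gaussPolyWith b q z := by
  simp [gaussPolyWith, add_mul]

lemma gaussPolyWith_smul (b : ℝ) (c : ℂ) (p : Polynomial ℂ) (z : ℂ) :
    gaussPolyWith b (c • p) z = c * gaussPolyWith b p z := by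
  simp [gaussPolyWith, mul_assoc]

lemma gaussPolyWith_mul_mul (a b : ℝ) (p q : Polynomial ℂ) (z : ℂ) :
    gaussPolyWith a p z * gaussPolyWith b q z = gaussPolyWith (a + b) (p * q) z := by
  simp only [gaussPolyWith, Polynomial.eval_mul]
  rw [mul_mul_mul_comm, ← Complex.exp_add]
  push_cast
  ring_nf

lemma aestronglyMeasurable_gaussPolyWith (b : ℝ) (p : Polynomial ℂ) (ν : Measure ℝ) :
    AEStronglyMeasurable (fun x : ℝ => gaussPolyWith b p x) ν :=
  ((differentiable_gaussPolyWith b p).continuous.comp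
    Complex.continuous_ofReal).aestronglyMeasurable

lemma exists_norm_eval_le (p : Polynomial ℂ) :
    ∃ C, 0 ≤ C ∧ ∀ x : ℝ, ‖p.eval (x : ℂ)‖ ≤ C * Real.exp |x| := by
  induction p using Polynomial.induction_on' with
  | add p q hp hq =>
    obtain ⟨C, hC, h1⟩ := hp
    obtain ⟨D, hD, h2⟩ := hq
    refine ⟨C + D, by positivity, fun x => ?_⟩
    rw [Polynomial.eval_add, add_mul]
    exact (norm_add_le _ _).trans (add_le_add (h1 x) (h2 x))
  | monomial n a =>
    refine ⟨‖a‖ * n.factorial, by positivity, fun x => ?_⟩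
    have := Real.pow_div_factorial_le_exp |x| (abs_nonneg x) n
    rw [div_le_iff₀ (by positivity)] at this
    rw [Polynomial.eval_monomial, norm_mul, norm_pow, Complex.norm_real, Real.norm_eq_abs,
      mul_assoc]
    gcongr
    linarith

lemma norm_exp_neg_mul_sq (b x : ℝ) :
    ‖Complex.exp (-((b : ℂ) * (x : ℂ) ^ 2))‖ = Real.exp (-b * x ^ 2) := by
  rw [Complex.norm_exp]
  congr 1
  rw [← Complex.ofReal_pow, ← Complex.ofReal_mul, ← Complex.ofReal_neg, Complex.ofReal_re, neg_mul]

lemma exists_norm_gaussPolyWith_le (b : ℝ) (p : Polynomial ℂ) :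
    ∃ C, 0 ≤ C ∧ ∀ x : ℝ, ‖gaussPolyWith b p x‖ ≤ C * (Real.exp |x| * Real.exp (-b * x ^ 2)) := by
  obtain ⟨C, hC, h⟩ := exists_norm_eval_le p
  refine ⟨C, hC, fun x => ?_⟩
  rw [gaussPolyWith, norm_mul, norm_exp_neg_mul_sq, ← mul_assoc]
  gcongr
  exact h x

lemma integrable_gaussPolyWith {μ : ℝ} (hμ : 0 < μ) {b : ℝ} (hb : 0 < b) (p : Polynomial ℂ) :
    Integrable (fun x : ℝ => gaussPolyWith b p x) (weightMeasure μ) := by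
  obtain ⟨C, hC, h⟩ := exists_norm_gaussPolyWith_le b p
  refine ((integrable_exp_abs_mul_gaussian hμ 1 hb).const_mul C).mono'
    (aestronglyMeasurable_gaussPolyWith b p _) (Filter.Eventually.of_forall fun x => ?_)
  simpa using h x

lemma memLp_two_of_exp_bound {μ : ℝ} (hμ : 0 < μ) {b : ℝ} (hb : 0 < b) {f : ℝ → ℂ} {a C : ℝ}
    (hf : AEStronglyMeasurable f (weightMeasure μ))
    (h : ∀ x, ‖f x‖ ≤ C * (Real.exp (a * |x|) * Real.exp (-b * x ^ 2))) :
    MemLp f 2 (weightMeasure μ) := by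
  rw [memLp_two_iff_integrable_sq_norm hf]
  refine ((integrable_exp_abs_mul_gaussian hμ (2 * a) (by positivity : 0 < 2 * b)).const_mul
    (C ^ 2)).mono' (hf.norm.pow 2) (Filter.Eventually.of_forall fun x => ?_)
  rw [norm_pow, norm_norm]
  calc ‖f x‖ ^ 2 ≤ (C * (Real.exp (a * |x|) * Real.exp (-b * x ^ 2))) ^ 2 := by
        gcongr
        exact h x
    _ = _ := by
        rw [mul_pow, mul_pow, ← Real.exp_nat_mul, ← Real.exp_nat_mul]
        push_cast
        ring_nf

lemma memLp_two_gaussPolyWith {μ : ℝ} (hμ : 0 < μ) {b : ℝ} (hb : 0 < b) (p : Polynomial ℂ) :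
    MemLp (fun x : ℝ => gaussPolyWith b p x) 2 (weightMeasure μ) := by
  obtain ⟨C, hC, h⟩ := exists_norm_gaussPolyWith_le b p
  exact memLp_two_of_exp_bound (a := 1) hμ hb (aestronglyMeasurable_gaussPolyWith b p _)
    (by simpa using h)

lemma memLp_one_gaussPolyWith {μ : ℝ} (hμ : 0 < μ) {b : ℝ} (hb : 0 < b) (p : Polynomial ℂ) :
    MemLp (fun x : ℝ => gaussPolyWith b p x) 1 (weightMeasure μ) :=
  memLp_one_iff_integrable.2 (integrable_gaussPolyWith hμ hb p)

/-! ### Functions determined by their integrals against `𝔖` -/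

/-- Functions that are integrable against `exp(a|x| - x²) |x|^{2μ}` for all `a`. -/
def ModerateGrowth (μ : ℝ) (f : ℝ → ℂ) : Prop :=
  AEStronglyMeasurable f volume ∧ ∀ a : ℝ,
    Integrable (fun x => Real.exp (a * |x|) * Real.exp (-1 * x ^ 2) * ‖f x‖) (weightMeasure μ)

section

variable {μ : ℝ} {f g : ℝ → ℂ}

lemma continuous_exp_abs_mul_gaussian (a b : ℝ) :
    Continuous fun x : ℝ => Real.exp (a * |x|) * Real.exp (-b * x ^ 2) := by fun_prop

lemma ModerateGrowth.sub (hf : ModerateGrowth μ f) (hg : ModerateGrowth μ g) :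
    ModerateGrowth μ (f - g) := by
  refine ⟨hf.1.sub hg.1, fun a => ((hf.2 a).add (hg.2 a)).mono' ?_
    (Filter.Eventually.of_forall fun x => ?_)⟩
  · exact (continuous_exp_abs_mul_gaussian a 1).aestronglyMeasurable.mul
      ((hf.1.sub hg.1).mono_ac (weightMeasure_ac μ)).norm
  · have h : 0 ≤ Real.exp (a * |x|) * Real.exp (-1 * x ^ 2) := by positivity
    rw [norm_mul, norm_norm, Real.norm_of_nonneg h, Pi.add_apply, ← mul_add]
    gcongr
    exact norm_sub_le _ _

lemma memLp_top_weightMeasure (hf : MemLp f ⊤ volume) : MemLp f ⊤ (weightMeasure μ) :=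
  ⟨hf.1.mono_ac (weightMeasure_ac μ), by
    rw [eLpNorm_exponent_top, eLpNormEssSup, essSup, ae_weightMeasure]
    simpa [eLpNorm_exponent_top, eLpNormEssSup, essSup] using hf.2⟩

lemma moderateGrowth_of_memLp_top (hμ : 0 < μ) (hf : MemLp f ⊤ volume) : ModerateGrowth μ f := by
  refine ⟨hf.1, fun a => ?_⟩
  exact Integrable.mul_of_top_left (integrable_exp_abs_mul_gaussian hμ a one_pos)
    (memLp_top_weightMeasure hf).norm

lemma moderateGrowth_of_memLp_two (hμ : 0 < μ) (hf : MemLp f 2 (weightMeasure μ)) :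
    ModerateGrowth μ f := by
  refine ⟨hf.1.mono_ac (ac_weightMeasure μ), fun a => ?_⟩
  have h1 : MemLp (fun x => ((Real.exp (a * |x|) * Real.exp (-1 * x ^ 2) : ℝ) : ℂ)) 2
      (weightMeasure μ) := by
    refine memLp_two_of_exp_bound (a := a) (C := 1) hμ one_pos
      (Complex.continuous_ofReal.comp
        (continuous_exp_abs_mul_gaussian a 1)).aestronglyMeasurable fun x => ?_
    rw [Complex.norm_real, Real.norm_of_nonneg (by positivity), one_mul]
  have h2 := memLp_one_iff_integrable.1 (h1.mul hf (r := 1))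
  refine h2.norm.congr (Filter.Eventually.of_forall fun x => ?_)
  simp only [Pi.mul_apply]
  rw [norm_mul, Complex.norm_real, Real.norm_of_nonneg (by positivity), mul_comm]

/-- Moment determinacy applied to `|x|^(2μ) exp(-x²) f`. Moderate growth covers `L^∞` and `L²_μ` at
once. -/
lemma ModerateGrowth.ae_eq_zero (hf : ModerateGrowth μ f)
    (h0 : ∀ n : ℕ, ∫ x : ℝ, f x * gaussPoly (Polynomial.X ^ n) x ∂(weightMeasure μ) = 0) :
    f =ᵐ[volume] 0 := by
  have hw : Measurable fun x : ℝ => |x| ^ (2 * μ) := by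
    have : Measurable fun x : ℝ => |x| := measurable_norm
    fun_prop
  set G : ℝ → ℂ := fun x => ((|x| ^ (2 * μ) * Real.exp (-1 * x ^ 2) : ℝ) : ℂ) * f x with hG
  have hGm : AEStronglyMeasurable G := by
    refine AEStronglyMeasurable.mul ?_ hf.1
    have h2 : Measurable fun x : ℝ => Real.exp (-1 * x ^ 2) := by fun_prop
    exact (hw.mul h2).complex_ofReal.aestronglyMeasurable
  have hGz := ae_eq_zero_of_forall_moment_eq_zero hGm (fun a => ?_) (fun n => ?_)
  · filter_upwards [hGz, ae_ne_zero] with x hx hx0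
    have h1 : |x| ^ (2 * μ) ≠ 0 := (Real.rpow_pos_of_pos (abs_pos.2 hx0) _).ne'
    simp only [hG, Pi.zero_apply, mul_eq_zero, Complex.ofReal_eq_zero] at hx
    simpa [h1] using hx
  · have := (integrable_weightMeasure_iff μ _).1 (hf.2 a)
    refine this.congr (Filter.Eventually.of_forall fun x => ?_)
    have h1 : 0 ≤ |x| ^ (2 * μ) := Real.rpow_nonneg (abs_nonneg x) _
    simp only [hG, norm_mul, Complex.norm_real, smul_eq_mul]
    rw [Real.norm_of_nonneg h1, Real.norm_of_nonneg (Real.exp_pos _).le]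
    ring
  · rw [← h0 n, integral_weightMeasure]
    refine integral_congr_ae (Filter.Eventually.of_forall fun x => ?_)
    simp only [hG, gaussPoly, Complex.real_smul]
    push_cast
    simp
    ring

/-! ### Density of `𝔖` -/

/-- The embedding of `𝔖` into `L²_μ(ℝ)`. -/
def gaussPolyLp (hμ : 0 < μ) : Polynomial ℂ →ₗ[ℂ] Lp ℂ 2 (weightMeasure μ) where
  toFun p := (memLp_two_gaussPolyWith hμ one_pos p).toLp _
  map_add' p q := by
    rw [← MemLp.toLp_add]
    congr 1
    ext x
    exact gaussPolyWith_add 1 p q x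
  map_smul' c p := by
    rw [RingHom.id_apply, ← MemLp.toLp_const_smul]
    congr 1
    ext x
    exact gaussPolyWith_smul 1 c p x

/-- A vector orthogonal to `𝔖` has zero integrals against the real functions `x^n exp(-x²)`, hence
vanishes. -/
lemma exists_eLpNorm_sub_gaussPoly_lt (hμ : 0 < μ) (hf : MemLp f 2 (weightMeasure μ))
    {ε : ENNReal} (hε : 0 < ε) : ∃ p : Polynomial ℂ,
      eLpNorm (fun x : ℝ => f x - gaussPoly p x) 2 (weightMeasure μ) < ε := by
  set S := LinearMap.range (gaussPolyLp hμ)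
  have htop : S.topologicalClosure = ⊤ := by
    rw [Submodule.topologicalClosure_eq_top_iff, Submodule.eq_bot_iff]
    intro u hu
    have hz := (moderateGrowth_of_memLp_two hμ (Lp.memLp u)).ae_eq_zero fun n => ?_
    · rw [Lp.eq_zero_iff_ae_eq_zero]
      exact (weightMeasure_ac μ).ae_eq hz
    · have := (Submodule.mem_orthogonal _ _).1 hu (gaussPolyLp hμ (Polynomial.X ^ n)) ⟨_, rfl⟩
      rw [L2.inner_def] at this
      rw [← this]
      refine integral_congr_ae ?_
      filter_upwards [(memLp_two_gaussPolyWith hμ one_pos (Polynomial.X ^ n)).coeFn_toLp]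
        with x hx
      have e : (gaussPolyLp hμ (Polynomial.X ^ n)) x = gaussPolyWith 1 (Polynomial.X ^ n) x := hx
      rw [e, RCLike.inner_apply, gaussPoly_eq]
      congr 1
      simp [gaussPolyWith, ← Complex.exp_conj]
  have hmem : hf.toLp f ∈ closure (S : Set (Lp ℂ 2 (weightMeasure μ))) := by
    rw [← Submodule.topologicalClosure_coe, htop]
    trivial
  obtain ⟨_, ⟨p, rfl⟩, hp⟩ := EMetric.mem_closure_iff.1 hmem ε hε
  refine ⟨p, ?_⟩
  rw [gaussPoly_eq]
  change edist (hf.toLp f) ((memLp_two_gaussPolyWith hμ one_pos p).toLp _) < ε at hp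
  rwa [Lp.edist_toLp_toLp] at hp

end

/-! ### Moments of Gaussians -/

/-- The moments of `exp(-b x²)` for the weighted measure. -/
def gaussMoment (μ b : ℝ) (n : ℕ) : ℝ := ∫ x : ℝ, x ^ n * Real.exp (-b * x ^ 2) ∂(weightMeasure μ)

lemma integral_weightMeasure_comp_neg (μ : ℝ) (f : ℝ → ℂ) :
    ∫ x, f (-x) ∂(weightMeasure μ) = ∫ x, f x ∂(weightMeasure μ) := by
  rw [integral_weightMeasure, integral_weightMeasure, ← integral_neg_eq_self]
  simp

lemma gaussMoment_odd (μ b : ℝ) {n : ℕ} (hn : Odd n) : gaussMoment μ b n = 0 := by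
  have h : gaussMoment μ b n = -gaussMoment μ b n := by
    rw [gaussMoment, integral_weightMeasure]
    conv_lhs => rw [← integral_neg_eq_self]
    rw [← integral_neg]
    refine integral_congr_ae (Filter.Eventually.of_forall fun x => ?_)
    simp [hn.neg_pow]
  linarith

lemma gaussMoment_even {μ : ℝ} (hμ : 0 < μ) {b : ℝ} (hb : 0 < b) (k : ℕ) :
    gaussMoment μ b (2 * k) = b ^ (-(k + μ + 1 / 2)) * Real.Gamma (k + μ + 1 / 2) := by
  rw [gaussMoment, integral_weightMeasure]
  have h1 := integral_comp_abs (f := fun r : ℝ => r ^ (2 * μ) * (r ^ (2 * k) * Real.exp (-b * r ^ 2)))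
  simp only [sq_abs, (even_two_mul k).pow_abs] at h1
  simp only [smul_eq_mul]
  rw [h1]
  have h2 := integral_rpow_mul_exp_neg_mul_rpow (p := 2) (q := 2 * μ + 2 * k) (b := b) two_pos
    (by have : (0 : ℝ) ≤ k := k.cast_nonneg
        linarith) hb
  have h3 : ∫ x in Ioi (0 : ℝ), x ^ (2 * μ) * (x ^ (2 * k) * Real.exp (-b * x ^ 2)) =
      ∫ x in Ioi (0 : ℝ), x ^ (2 * μ + 2 * k) * Real.exp (-b * x ^ (2 : ℝ)) := by
    refine setIntegral_congr_fun measurableSet_Ioi fun x hx => ?_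
    have hx : 0 < x := hx
    rw [Real.rpow_add hx, Real.rpow_two]
    have : x ^ (2 * (k : ℝ)) = x ^ (2 * k) := by
      rw [← Real.rpow_natCast]; push_cast; rfl
    rw [this]; ring
  rw [h3, h2]
  have e1 : (2 * μ + 2 * k + 1) / 2 = k + μ + 1 / 2 := by ring
  rw [neg_div, e1]
  ring

/-- For even `m` this is `Γ(s+1) = sΓ(s)`; for odd `m` both sides vanish. It is skew-symmetry of `𝔇`
at the level of moments. -/
lemma gaussMoment_add_two {μ : ℝ} (hμ : 0 < μ) {b : ℝ} (hb : 0 < b) (m : ℕ) :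
    2 * b * gaussMoment μ b (m + 2) = dunklCoeff μ (m + 1) * gaussMoment μ b m := by
  rcases m.even_or_odd' with ⟨k, rfl | rfl⟩
  · have e : 2 * k + 2 = 2 * (k + 1) := by ring
    rw [e, gaussMoment_even hμ hb, gaussMoment_even hμ hb, dunklCoeff_odd μ (odd_two_mul_add_one k)]
    have e1 : ((k + 1 : ℕ) : ℝ) + μ + 1 / 2 = (k + μ + 1 / 2) + 1 := by push_cast; ring
    have hp : 0 < (k : ℝ) + μ + 1 / 2 := by positivity
    rw [e1, Real.Gamma_add_one hp.ne', neg_add, Real.rpow_add hb, Real.rpow_neg_one]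
    push_cast
    field_simp
    ring
  · rw [gaussMoment_odd μ b (odd_two_mul_add_one k), gaussMoment_odd μ b (by grind)]
    simp

lemma integral_gaussPolyWith_X_pow (μ b : ℝ) (n : ℕ) :
    ∫ x : ℝ, gaussPolyWith b (Polynomial.X ^ n) x ∂(weightMeasure μ) = (gaussMoment μ b n : ℂ) := by
  rw [gaussMoment, ← integral_complex_ofReal]
  refine integral_congr_ae (Filter.Eventually.of_forall fun x => ?_)
  simp [gaussPolyWith]

/-! ### The Dunkl operator on Gaussian functions -/

lemma coeff_comp_neg_X (q : Polynomial ℂ) (n : ℕ) :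
    (q.comp (-Polynomial.X)).coeff n = q.coeff n * (-1) ^ n := by
  have : (-Polynomial.X : Polynomial ℂ) = Polynomial.C (-1) * Polynomial.X := by simp
  rw [this, Polynomial.comp_C_mul_X_coeff]

/-- The operator `q ↦ e^{bz²} 𝔇_μ (q e^{-bz²})` on polynomials. -/
def dunklGauss (μ b : ℝ) : Polynomial ℂ →ₗ[ℂ] Polynomial ℂ where
  toFun q := Polynomial.derivative q +
    Polynomial.C (μ : ℂ) * Polynomial.divX (q - q.comp (-Polynomial.X)) -
    Polynomial.C ((2 * b : ℝ) : ℂ) * (Polynomial.X * q)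
  map_add' p q := by
    rw [Polynomial.add_comp, add_sub_add_comm, Polynomial.divX_add, Polynomial.derivative_add]
    ring
  map_smul' c p := by
    rw [Polynomial.smul_comp, ← smul_sub, Polynomial.derivative_smul, RingHom.id_apply,
      Polynomial.smul_eq_C_mul, Polynomial.smul_eq_C_mul, Polynomial.divX_C_mul,
      Polynomial.smul_eq_C_mul, Polynomial.smul_eq_C_mul]
    ring

lemma dunklDeriv_gaussPolyWith (μ b : ℝ) (q : Polynomial ℂ) (z : ℂ) :
    dunklDeriv μ (gaussPolyWith b q) z = gaussPolyWith b (dunklGauss μ b q) z := by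
  have hd : HasDerivAt (gaussPolyWith b q) (q.derivative.eval z * Complex.exp (-(b * z ^ 2)) +
      q.eval z * (Complex.exp (-(b * z ^ 2)) * (-(b * (2 * z))))) z := by
    have h1 : HasDerivAt (fun z : ℂ => -((b : ℂ) * z ^ 2)) (-(b * (2 * z))) z := by
      exact ((hasDerivAt_pow 2 z).const_mul (b : ℂ)).fun_neg.congr_deriv (by simp)
    exact (q.hasDerivAt z).mul h1.cexp
  have hX := congrArg (Polynomial.eval z) (Polynomial.divX_mul_X_add (q - q.comp (-Polynomial.X)))
  simp only [Polynomial.eval_add, Polynomial.eval_mul, Polynomial.eval_X, Polynomial.eval_C,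
    Polynomial.coeff_sub, Polynomial.eval_sub, Polynomial.eval_comp, Polynomial.eval_neg] at hX
  have h0 : (q.comp (-Polynomial.X)).coeff 0 = q.coeff 0 := by
    rw [Polynomial.coeff_zero_eq_eval_zero, Polynomial.coeff_zero_eq_eval_zero]
    simp
  rw [h0, sub_self, add_zero] at hX
  by_cases hz : z = 0
  · subst hz
    rw [dunklDeriv, if_pos rfl, hd.deriv]
    have h1 : (Polynomial.divX (q - q.comp (-Polynomial.X))).eval 0 = 2 * q.coeff 1 := by
      rw [← Polynomial.coeff_zero_eq_eval_zero, Polynomial.coeff_divX, Polynomial.coeff_sub,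
        coeff_comp_neg_X]
      simp; ring
    have h2 : (Polynomial.derivative q).eval 0 = q.coeff 1 := by
      rw [← Polynomial.coeff_zero_eq_eval_zero, Polynomial.coeff_derivative]; simp
    simp [gaussPolyWith, dunklGauss, h1, h2]
    ring
  · rw [dunklDeriv, if_neg hz, hd.deriv]
    have h3 : (Polynomial.divX (q - q.comp (-Polynomial.X))).eval z =
        (q.eval z - q.eval (-z)) / z := by
      rw [← hX]; field_simp
    simp only [gaussPolyWith, dunklGauss, LinearMap.coe_mk, AddHom.coe_mk, Polynomial.eval_sub,
      Polynomial.eval_add, Polynomial.eval_mul, Polynomial.eval_C, Polynomial.eval_X, h3, neg_sq]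
    push_cast
    field_simp
    ring

lemma dunklGauss_monomial (μ b : ℝ) (n : ℕ) (c : ℂ) :
    dunklGauss μ b (Polynomial.monomial n c) = Polynomial.monomial (n - 1) (dunklCoeff μ n * c) -
      Polynomial.monomial (n + 1) ((2 * b : ℝ) * c) := by
  have h : Polynomial.monomial n c - (Polynomial.monomial n c).comp (-Polynomial.X) =
      Polynomial.monomial n ((1 - (-1) ^ n) * c) := by
    ext k
    rw [Polynomial.coeff_sub, coeff_comp_neg_X, Polynomial.coeff_monomial,
      Polynomial.coeff_monomial]
    split_ifs with h
    · subst h; ring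
    · simp
  simp only [dunklGauss, LinearMap.coe_mk, AddHom.coe_mk, h, Polynomial.derivative_monomial, Polynomial.X_mul_monomial, Polynomial.C_mul_monomial]
  -- For `n = 0` the truncated exponent `n - 1` is harmless, since its coefficient is zero.
  rcases n with _ | n
  · simp [dunklCoeff_zero]
  · have hX : (Polynomial.monomial (n + 1) ((1 - (-1) ^ (n + 1)) * c)).divX =
        Polynomial.monomial n ((1 - (-1) ^ (n + 1)) * c) := by
      ext k
      simp [Polynomial.coeff_divX, Polynomial.coeff_monomial]
    rw [hX, Nat.add_sub_cancel, Polynomial.C_mul_monomial, ← map_add (Polynomial.monomial n),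
      dunklCoeff]
    congr 2
    push_cast
    ring

/-- Integration of Gaussian functions as a linear functional. -/
def gaussFunctional {μ : ℝ} (hμ : 0 < μ) {b : ℝ} (hb : 0 < b) : Polynomial ℂ →ₗ[ℂ] ℂ where
  toFun p := ∫ x : ℝ, gaussPolyWith b p x ∂(weightMeasure μ)
  map_add' p q := by
    simp only [gaussPolyWith_add]
    exact integral_add (integrable_gaussPolyWith hμ hb p) (integrable_gaussPolyWith hμ hb q)
  map_smul' c p := by
    simp only [gaussPolyWith_smul, RingHom.id_apply, smul_eq_mul]
    exact integral_const_mul _ _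

lemma gaussFunctional_monomial {μ : ℝ} (hμ : 0 < μ) {b : ℝ} (hb : 0 < b) (n : ℕ) (c : ℂ) :
    gaussFunctional hμ hb (Polynomial.monomial n c) = c * gaussMoment μ b n := by
  rw [← Polynomial.C_mul_X_pow_eq_monomial, ← Polynomial.smul_eq_C_mul, map_smul, smul_eq_mul]
  congr 1
  exact integral_gaussPolyWith_X_pow μ b n

/-- By bilinearity only monomials matter. The product of two Gaussians has parameter `b + b`. -/
lemma gaussFunctional_dunklGauss {μ : ℝ} (hμ : 0 < μ) {b : ℝ} (hb : 0 < b)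
    (q r : Polynomial ℂ) : gaussFunctional hμ (add_pos hb hb)
      (dunklGauss μ b q * r + q * dunklGauss μ b r) = 0 := by
  induction q using Polynomial.induction_on' with
  | add p q hp hq =>
    rw [map_add] at hp hq ⊢
    rw [map_add, add_mul, add_mul, map_add, map_add]
    linear_combination hp + hq
  | monomial m c =>
    induction r using Polynomial.induction_on' with
    | add p q hp hq =>
      rw [map_add] at hp hq ⊢
      rw [map_add, mul_add, mul_add, map_add, map_add]
      linear_combination hp + hq
    | monomial n d =>
      simp only [dunklGauss_monomial, sub_mul, mul_sub, Polynomial.monomial_mul_monomial, map_add,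
        map_sub, gaussFunctional_monomial]
      -- For `m + n` even each surviving moment is odd, hence zero. For `m + n = k + 1` odd the
      -- coefficients add up and the moment recurrence cancels the rest.
      rcases Nat.even_or_odd (m + n) with h | h
      · rw [gaussMoment_odd μ (b + b) (show Odd (m + 1 + n) by grind),
          gaussMoment_odd μ (b + b) (show Odd (m + (n + 1)) by grind)]
        have h1 : (dunklCoeff μ m : ℂ) * gaussMoment μ (b + b) (m - 1 + n) = 0 := by
          rcases m with _ | m
          · simp [dunklCoeff_zero]
          · rw [gaussMoment_odd μ (b + b) (show Odd (m + 1 - 1 + n) by grind)]; simp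
        have h2 : (dunklCoeff μ n : ℂ) * gaussMoment μ (b + b) (m + (n - 1)) = 0 := by
          rcases n with _ | n
          · simp [dunklCoeff_zero]
          · rw [gaussMoment_odd μ (b + b) (show Odd (m + (n + 1 - 1)) by grind)]; simp
        rw [Complex.ofReal_zero]
        linear_combination (c * d) * h1 + (c * d) * h2
      · obtain ⟨k, hk⟩ : ∃ k, m + n = k + 1 := ⟨m + n - 1, by grind⟩
        have hrec := gaussMoment_add_two hμ (add_pos hb hb) k
        have h1 : dunklCoeff μ m * gaussMoment μ (b + b) (m - 1 + n) =
            dunklCoeff μ m * gaussMoment μ (b + b) k := by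
          rcases m with _ | m
          · simp [dunklCoeff_zero]
          · congr 2; omega
        have h2 : dunklCoeff μ n * gaussMoment μ (b + b) (m + (n - 1)) =
            dunklCoeff μ n * gaussMoment μ (b + b) k := by
          rcases n with _ | n
          · simp [dunklCoeff_zero]
          · congr 2; omega
        have e1 : m + 1 + n = k + 2 := by omega
        have e2 : m + (n + 1) = k + 2 := by omega
        have h3 := dunklCoeff_add μ h
        rw [hk] at h3
        rw [e1, e2]
        have key : dunklCoeff μ m * gaussMoment μ (b + b) (m - 1 + n) +
            dunklCoeff μ n * gaussMoment μ (b + b) (m + (n - 1)) =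
            2 * (2 * b) * gaussMoment μ (b + b) (k + 2) := by
          rw [h1, h2]
          linear_combination gaussMoment μ (b + b) k * h3 - hrec
        have key' := congrArg (fun r : ℝ => (r : ℂ)) key
        push_cast at key' ⊢
        linear_combination (c * d) * key'

/-- `𝔇_μ` is skew-symmetric on Gaussian functions. -/
lemma integral_dunklGauss_mul {μ : ℝ} (hμ : 0 < μ) {b : ℝ} (hb : 0 < b) (q r : Polynomial ℂ) :
    ∫ x : ℝ, gaussPolyWith b (dunklGauss μ b q) x * gaussPolyWith b r x ∂(weightMeasure μ) =
      -∫ x : ℝ, gaussPolyWith b q x * gaussPolyWith b (dunklGauss μ b r) x ∂(weightMeasure μ) := by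
  have := gaussFunctional_dunklGauss hμ hb q r
  rw [map_add] at this
  simp only [gaussPolyWith_mul_mul]
  exact eq_neg_of_add_eq_zero_left this

/-! ### The generalized Fourier integral -/

/-- The generalized Fourier integral with complex argument. -/
def fourierC (μ : ℝ) (f : ℝ → ℂ) (z : ℂ) : ℂ :=
  (((2 : ℝ) ^ (μ + 1 / 2) * Real.Gamma (μ + 1 / 2) : ℝ) : ℂ)⁻¹ *
    ∫ t, expMu μ (-(Complex.I * z * t)) * f t ∂(weightMeasure μ)

lemma fourierIntegralMu_eq (μ : ℝ) (f : ℝ → ℂ) (x : ℝ) :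
    fourierIntegralMu μ f x = fourierC μ f x := rfl

lemma norm_expMu_kernel_le {μ : ℝ} (hμ : 0 < μ) (x t : ℝ) :
    ‖expMu μ (-(Complex.I * x * t))‖ ≤ 1 := by
  have : -(Complex.I * x * t) = Complex.I * ((-(x * t) : ℝ) : ℂ) := by push_cast; ring
  rw [this]
  exact norm_expMu_I_mul_le hμ _

lemma conj_expMu {μ : ℝ} (hμ : 0 < μ) (z : ℂ) :
    (starRingEnd ℂ) (expMu μ z) = expMu μ ((starRingEnd ℂ) z) := by
  have h1 := hasEntireSeries_expMu hμ 1 z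
  have h2 := hasEntireSeries_expMu hμ 1 ((starRingEnd ℂ) z)
  simp only [one_mul] at h1 h2
  refine ((Complex.hasSum_conj' (L := _)).2 h1).unique (hasSum_of_eq h2 (fun n => ?_) rfl)
  simp

lemma integrable_expMu_mul {μ : ℝ} (hμ : 0 < μ) {f : ℝ → ℂ} (hf : MemLp f 1 (weightMeasure μ))
    (x : ℝ) : Integrable (fun t : ℝ => expMu μ (-(Complex.I * x * t)) * f t) (weightMeasure μ) := by
  refine (memLp_one_iff_integrable.1 hf).bdd_mul (c := 1) ?_
    (Filter.Eventually.of_forall fun t => norm_expMu_kernel_le hμ x t)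
  exact ((continuous_expMu hμ).comp (by fun_prop)).aestronglyMeasurable

lemma integrable_expMu_mul_gaussPolyWith {μ : ℝ} (hμ : 0 < μ) {b : ℝ} (hb : 0 < b)
    (p : Polynomial ℂ) (z : ℂ) :
    Integrable (fun t : ℝ => expMu μ (-(Complex.I * z * t)) * gaussPolyWith b p t)
      (weightMeasure μ) := by
  obtain ⟨C, hC, h⟩ := exists_norm_gaussPolyWith_le b p
  refine ((integrable_exp_abs_mul_gaussian hμ (‖z‖ + 1) hb).const_mul C).mono' ?_
    (Filter.Eventually.of_forall fun t => ?_)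
  · exact (((continuous_expMu hμ).comp (by fun_prop)).aestronglyMeasurable).mul
      (aestronglyMeasurable_gaussPolyWith b p _)
  · rw [norm_mul]
    have h1 := norm_expMu_le hμ (-(Complex.I * z * t))
    have h2 : ‖-(Complex.I * z * t)‖ = ‖z‖ * |t| := by simp
    rw [h2] at h1
    calc _ ≤ Real.exp (‖z‖ * |t|) * (C * (Real.exp |t| * Real.exp (-b * t ^ 2))) := by
          gcongr
          exact h t
      _ = _ := by rw [add_mul, one_mul, Real.exp_add]; ring

/-- The Fourier integral is symmetric. -/
lemma integral_fourierC_mul {μ : ℝ} (hμ : 0 < μ) {f h : ℝ → ℂ} (hf : MemLp f 1 (weightMeasure μ))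
    (hh : MemLp h 1 (weightMeasure μ)) :
    ∫ x : ℝ, fourierC μ f x * h x ∂(weightMeasure μ) =
      ∫ t : ℝ, f t * fourierC μ h t ∂(weightMeasure μ) := by
  simp only [fourierC]
  have e1 : ∀ x : ℝ, (((2 : ℝ) ^ (μ + 1 / 2) * Real.Gamma (μ + 1 / 2) : ℝ) : ℂ)⁻¹ *
      (∫ t : ℝ, expMu μ (-(Complex.I * x * t)) * f t ∂(weightMeasure μ)) * h x =
      (((2 : ℝ) ^ (μ + 1 / 2) * Real.Gamma (μ + 1 / 2) : ℝ) : ℂ)⁻¹ *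
      ∫ t : ℝ, expMu μ (-(Complex.I * x * t)) * (h x * f t) ∂(weightMeasure μ) := fun x => by
    rw [mul_assoc, ← integral_mul_const]
    congr 2 with t
    ring
  have e2 : ∀ t : ℝ, f t * ((((2 : ℝ) ^ (μ + 1 / 2) * Real.Gamma (μ + 1 / 2) : ℝ) : ℂ)⁻¹ *
      (∫ x : ℝ, expMu μ (-(Complex.I * t * x)) * h x ∂(weightMeasure μ))) =
      (((2 : ℝ) ^ (μ + 1 / 2) * Real.Gamma (μ + 1 / 2) : ℝ) : ℂ)⁻¹ *
      ∫ x : ℝ, expMu μ (-(Complex.I * x * t)) * (h x * f t) ∂(weightMeasure μ) := fun t => by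
    rw [mul_left_comm, ← integral_const_mul]
    congr 2 with x
    have : Complex.I * t * x = Complex.I * x * t := by ring
    rw [this]
    ring
  simp_rw [e1, e2, integral_const_mul]
  rw [integral_integral_swap]
  refine Integrable.bdd_mul (c := 1) ((memLp_one_iff_integrable.1 hh).mul_prod
    (memLp_one_iff_integrable.1 hf)) ?_
    (Filter.Eventually.of_forall fun q => norm_expMu_kernel_le hμ q.1 q.2)
  exact ((continuous_expMu hμ).comp (by fun_prop)).aestronglyMeasurable

lemma hasEntireSeries_fourierC {μ : ℝ} (hμ : 0 < μ) {b : ℝ} (hb : 0 < b) (n : ℕ) :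
    HasEntireSeries (fun k => (((2 : ℝ) ^ (μ + 1 / 2) * Real.Gamma (μ + 1 / 2) : ℝ) : ℂ)⁻¹ *
      ((-Complex.I) ^ k / (gammaMu μ k : ℂ) * (gaussMoment μ b (n + k) : ℂ)))
      (fourierC μ fun t => gaussPolyWith b (Polynomial.X ^ n) t) := by
  intro z
  have := hasSum_integral_of_dominated_convergence (μ := weightMeasure μ)
    (F := fun (k : ℕ) (t : ℝ) => (-Complex.I) ^ k / (gammaMu μ k : ℂ) * z ^ k *
      gaussPolyWith b (Polynomial.X ^ (n + k)) t)
    (f := fun t : ℝ => expMu μ (-(Complex.I * z * t)) * gaussPolyWith b (Polynomial.X ^ n) t)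
    (fun k t => (‖z‖ * |t|) ^ k / k.factorial * ‖gaussPolyWith b (Polynomial.X ^ n) t‖)
    (fun k => ?_) (fun k => ?_) ?_ ?_ ?_
  · refine hasSum_of_eq (this.mul_left _) (fun k => ?_) rfl
    rw [integral_const_mul, integral_gaussPolyWith_X_pow]
    ring
  · exact (aestronglyMeasurable_gaussPolyWith b _ _).const_mul _
  · refine Filter.Eventually.of_forall fun t => ?_
    simp only [gaussPolyWith, Polynomial.eval_pow, Polynomial.eval_X, norm_mul, norm_div, norm_pow,
      norm_neg, Complex.norm_I, one_pow, Complex.norm_real, Real.norm_eq_abs,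
      abs_of_pos (gammaMu_pos hμ k)]
    have := factorial_le_gammaMu hμ k
    calc _ = ((‖z‖ * |t|) ^ k / gammaMu μ k) *
          (|t| ^ n * ‖Complex.exp (-((b : ℂ) * (t : ℂ) ^ 2))‖) := by rw [mul_pow, pow_add]; ring
      _ ≤ _ := by gcongr
  · exact Filter.Eventually.of_forall fun t =>
      (Real.summable_pow_div_factorial (‖z‖ * |t|)).mul_right _
  · simp only [tsum_mul_right]
    obtain ⟨C, hC, h⟩ := exists_norm_gaussPolyWith_le b (Polynomial.X ^ n)
    refine ((integrable_exp_abs_mul_gaussian hμ (‖z‖ + 1) hb).const_mul C).mono' ?_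
      (Filter.Eventually.of_forall fun t => ?_)
    · refine AEStronglyMeasurable.mul ?_ (aestronglyMeasurable_gaussPolyWith b _ _).norm
      have : (fun t : ℝ => ∑' k : ℕ, (‖z‖ * |t|) ^ k / k.factorial) =
          fun t => Real.exp (‖z‖ * |t|) := by
        ext t; rw [Real.exp_eq_exp_ℝ, NormedSpace.exp_eq_tsum_div]
      rw [this]
      exact Continuous.aestronglyMeasurable (by fun_prop)
    · have : ∑' k : ℕ, (‖z‖ * |t|) ^ k / k.factorial = Real.exp (‖z‖ * |t|) := by
        rw [Real.exp_eq_exp_ℝ, NormedSpace.exp_eq_tsum_div]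
      rw [this, norm_mul, norm_norm, Real.norm_of_nonneg (Real.exp_pos _).le]
      calc _ ≤ Real.exp (‖z‖ * |t|) * (C * (Real.exp |t| * Real.exp (-b * t ^ 2))) := by
            gcongr
            exact h t
        _ = _ := by rw [add_mul, one_mul, Real.exp_add]; ring
  · refine Filter.Eventually.of_forall fun t => ?_
    have h := hasEntireSeries_expMu hμ (-Complex.I) (z * t)
    have e : -Complex.I * (z * t) = -(Complex.I * z * t) := by ring
    simp only [e] at h
    refine hasSum_of_eq (h.mul_right (gaussPolyWith b (Polynomial.X ^ n) t)) (fun k => ?_) rfl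
    simp only [gaussPolyWith, Polynomial.eval_pow, Polynomial.eval_X, Polynomial.eval_mul, mul_pow,
      pow_add]
    ring

/-- Only even moments contribute, and their factor `Γ(m+μ+1/2)` cancels the one in `γ(2m)`, which
leaves an exponential series. -/
lemma fourierC_gaussian {μ : ℝ} (hμ : 0 < μ) {b : ℝ} (hb : 0 < b) (z : ℂ) :
    fourierC μ (fun t => gaussPolyWith b 1 t) z =
      (((2 * b) ^ (-(μ + 1 / 2)) : ℝ) : ℂ) * gaussPolyWith (1 / (4 * b)) 1 z := by
  have h1 := hasEntireSeries_fourierC hμ hb 0 z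
  simp only [pow_zero, zero_add] at h1
  refine h1.unique ?_
  have h2 : HasSum (fun m : ℕ => (((2 * b) ^ (-(μ + 1 / 2)) : ℝ) : ℂ) *
      ((-((1 / (4 * b) : ℝ) * z ^ 2)) ^ m / m.factorial))
      ((((2 * b) ^ (-(μ + 1 / 2)) : ℝ) : ℂ) * gaussPolyWith (1 / (4 * b)) 1 z) := by
    refine HasSum.mul_left _ ?_
    have := NormedSpace.expSeries_div_hasSum_exp (𝔸 := ℂ) (-((1 / (4 * b) : ℝ) * z ^ 2))
    rw [← Complex.exp_eq_exp_ℂ] at this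
    simpa [gaussPolyWith] using this
  refine (Function.Injective.hasSum_iff (g := fun m : ℕ => 2 * m)
    (fun a b h => by simpa using h) (fun k hk => ?_)).1 (hasSum_of_eq h2 (fun m => ?_) rfl)
  · have : Odd k := by
      rw [← Nat.not_even_iff_odd]
      rintro ⟨m, hm⟩
      exact hk ⟨m, by simp only; omega⟩
    rw [gaussMoment_odd μ b this]; simp
  · simp only [Function.comp]
    rw [gaussMoment_even hμ hb, pow_mul, neg_sq, Complex.I_sq, gammaMu]
    have e1 : (2 * m + 1) / 2 = m := by omega
    have e2 : 2 * m / 2 = m := by omega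
    have hG : Real.Gamma (μ + 1 / 2) ≠ 0 := (Real.Gamma_pos_of_pos (by linarith)).ne'
    have hGm : Real.Gamma (m + μ + 1 / 2) ≠ 0 := (Real.Gamma_pos_of_pos (by positivity)).ne'
    have e3 : b ^ (-((m : ℝ) + μ + 1 / 2)) = (b ^ m)⁻¹ * b ^ (-(μ + 1 / 2)) := by
      rw [← Real.rpow_natCast, ← Real.rpow_neg hb.le, ← Real.rpow_add hb]; congr 1; ring
    have e4 : (2 * b) ^ (-(μ + 1 / 2)) = ((2 : ℝ) ^ (μ + 1 / 2))⁻¹ * b ^ (-(μ + 1 / 2)) := by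
      rw [Real.mul_rpow (by norm_num) hb.le, Real.rpow_neg (by norm_num)]
    have e5 : (-((1 / (4 * b) : ℝ) * z ^ 2)) ^ m =
        (-1) ^ m * (((4 * b) ^ m : ℝ) : ℂ)⁻¹ * z ^ (2 * m) := by
      rw [neg_pow, mul_pow, ← pow_mul]
      push_cast
      rw [one_div, inv_pow]; ring
    have e6 : (2 : ℝ) ^ (2 * m) = 4 ^ m := by rw [pow_mul]; norm_num
    have h2 : ((2 : ℝ) ^ (μ + 1 / 2)) ≠ 0 := by positivity
    rw [e1, e2, e3, e4, e5, e6]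
    have hG' : ((Real.Gamma (μ + 1 / 2) : ℝ) : ℂ) ≠ 0 := by exact_mod_cast hG
    have hGm' : ((Real.Gamma (m + μ + 1 / 2) : ℝ) : ℂ) ≠ 0 := by exact_mod_cast hGm
    have h2' : (((2 : ℝ) ^ (μ + 1 / 2) : ℝ) : ℂ) ≠ 0 := by exact_mod_cast h2
    have hb' : (b : ℂ) ≠ 0 := by exact_mod_cast hb.ne'
    have hf : (m.factorial : ℂ) ≠ 0 := by exact_mod_cast m.factorial_ne_zero
    rw [mul_pow]
    simp only [Complex.ofReal_mul, Complex.ofReal_div, Complex.ofReal_inv, Complex.ofReal_pow,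
      Complex.ofReal_natCast, Complex.ofReal_ofNat]
    generalize ((Real.Gamma (μ + 1 / 2) : ℝ) : ℂ) = G at *
    generalize ((Real.Gamma (m + μ + 1 / 2) : ℝ) : ℂ) = Gm at *
    field_simp

/-- Raising the moment index by one shifts the power series of the transform, which is the effect of
`𝔇` up to the factor `i`. -/
lemma dunklDeriv_fourierC {μ : ℝ} (hμ : 0 < μ) {b : ℝ} (hb : 0 < b) (n : ℕ) (z : ℂ) :
    fourierC μ (fun t => gaussPolyWith b (Polynomial.X ^ (n + 1)) t) z =
      Complex.I * dunklDeriv μ (fourierC μ fun t => gaussPolyWith b (Polynomial.X ^ n) t) z := by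
  refine (hasEntireSeries_fourierC hμ hb (n + 1) z).unique (hasSum_of_eq
    (((hasEntireSeries_fourierC hμ hb n).dunklDeriv μ z).mul_left Complex.I) (fun k => ?_) rfl)
  have e : n + 1 + k = n + (k + 1) := by ring
  beta_reduce
  generalize (((2 : ℝ) ^ (μ + 1 / 2) * Real.Gamma (μ + 1 / 2) : ℝ) : ℂ)⁻¹ = K
  rw [e, gammaMu_succ hμ, pow_succ]
  have h1 := gammaMu_ne_zero hμ k
  have h2 : (dunklCoeff μ (k + 1) : ℂ) ≠ 0 := by exact_mod_cast (dunklCoeff_pos hμ k).ne'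
  have hI : Complex.I * Complex.I = -1 := Complex.I_mul_I
  push_cast
  field_simp
  linear_combination (K * z ^ k * (gaussMoment μ b (n + (k + 1)))) * hI

/-! ### The Plancherel formula on `𝔖` -/

section

variable {μ : ℝ}

/-- The polynomial factor of the Fourier integral of `xⁿ exp(-x²)`. -/
def fourierMonomial (μ : ℝ) : ℕ → Polynomial ℂ
  | 0 => Polynomial.C (((2 * 1) ^ (-(μ + 1 / 2)) : ℝ) : ℂ)
  | n + 1 => Complex.I • dunklGauss μ (1 / 4) (fourierMonomial μ n)

/-- The polynomial `q` such that `q(x) exp(-x²/4)` is the Fourier integral of `p(x) exp(-x²)`. -/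
def fourierPoly (μ : ℝ) : Polynomial ℂ →ₗ[ℂ] Polynomial ℂ :=
  Polynomial.lsum fun n => LinearMap.toSpanSingleton ℂ _ (fourierMonomial μ n)

lemma fourierPoly_monomial (μ : ℝ) (n : ℕ) (c : ℂ) :
    fourierPoly μ (Polynomial.monomial n c) = c • fourierMonomial μ n := by
  simp [fourierPoly, Polynomial.lsum_apply, Polynomial.sum_monomial_index]

lemma gaussPolyWith_C (b : ℝ) (c : ℂ) (z : ℂ) :
    gaussPolyWith b (Polynomial.C c) z = c * gaussPolyWith b 1 z := by
  simp [gaussPolyWith]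

lemma fourierC_X_pow (hμ : 0 < μ) (n : ℕ) :
    fourierC μ (fun t => gaussPolyWith 1 (Polynomial.X ^ n) t) =
      gaussPolyWith (1 / 4) (fourierMonomial μ n) := by
  induction n with
  | zero =>
    ext z
    rw [pow_zero, fourierC_gaussian hμ one_pos, fourierMonomial, gaussPolyWith_C, mul_one, mul_one]
  | succ n ih =>
    ext z
    rw [dunklDeriv_fourierC hμ one_pos, ih, dunklDeriv_gaussPolyWith, fourierMonomial,
      gaussPolyWith_smul]

lemma fourierC_smul (f : ℝ → ℂ) (c z : ℂ) :
    fourierC μ (fun t => c * f t) z = c * fourierC μ f z := by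
  simp only [fourierC, mul_left_comm _ c, integral_const_mul]

lemma fourierC_gaussPoly (hμ : 0 < μ) (p : Polynomial ℂ) :
    fourierC μ (fun t => gaussPolyWith 1 p t) = gaussPolyWith (1 / 4) (fourierPoly μ p) := by
  ext z
  induction p using Polynomial.induction_on' with
  | add p q hp hq =>
    rw [map_add, gaussPolyWith_add, ← hp, ← hq, fourierC, fourierC, fourierC, ← mul_add,
      ← integral_add (integrable_expMu_mul_gaussPolyWith hμ one_pos p z)
        (integrable_expMu_mul_gaussPolyWith hμ one_pos q z)]
    simp only [gaussPolyWith_add, mul_add]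
  | monomial n c =>
    rw [fourierPoly_monomial, gaussPolyWith_smul, ← fourierC_X_pow hμ, ← fourierC_smul,
      ← Polynomial.C_mul_X_pow_eq_monomial, ← Polynomial.smul_eq_C_mul]
    simp only [gaussPolyWith_smul]

lemma fourierIntegralMu_gaussPoly (hμ : 0 < μ) (p : Polynomial ℂ) (x : ℝ) :
    fourierIntegralMu μ (fun t : ℝ => gaussPoly p t) x =
      gaussPolyWith (1 / 4) (fourierPoly μ p) x := by
  rw [fourierIntegralMu_eq, gaussPoly_eq, fourierC_gaussPoly hμ]

/-- Symmetry of the transform moves it onto `exp(-x²/4)`, which returns to `exp(-x²)`; the two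
constants multiply to one. -/
lemma integral_fourierMonomial_mul_zero (hμ : 0 < μ) (n : ℕ) :
    ∫ x : ℝ, gaussPolyWith (1 / 4) (fourierMonomial μ n) x *
      gaussPolyWith (1 / 4) (fourierMonomial μ 0) x ∂(weightMeasure μ) = gaussMoment μ 2 n := by
  have hq : (0 : ℝ) < 1 / 4 := by norm_num
  rw [← fourierC_X_pow hμ n, integral_fourierC_mul hμ (memLp_one_gaussPolyWith hμ one_pos _)
    (memLp_one_gaussPolyWith hμ hq _), ← integral_gaussPolyWith_X_pow]
  refine integral_congr_ae (Filter.Eventually.of_forall fun x => ?_)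
  simp only [fourierMonomial, gaussPolyWith_C, fourierC_smul, fourierC_gaussian hμ hq]
  have h1 : (1 : ℝ) / (4 * (1 / 4)) = 1 := by norm_num
  have h2 : ((2 * 1 : ℝ) ^ (-(μ + 1 / 2))) * (2 * (1 / 4)) ^ (-(μ + 1 / 2)) = 1 := by
    rw [← Real.mul_rpow (by norm_num) (by norm_num)]
    norm_num
  have h2' := congrArg (fun r : ℝ => (r : ℂ)) h2
  simp only [Complex.ofReal_mul, Complex.ofReal_one] at h2'
  have h3 := gaussPolyWith_mul_mul 1 1 (Polynomial.X ^ n) 1 x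
  rw [mul_one, one_add_one_eq_two] at h3
  rw [h1, ← h3]
  linear_combination (gaussPolyWith 1 (Polynomial.X ^ n) x * gaussPolyWith 1 1 x) * h2'

/-- Induction on `n`: skew-symmetry carries each `i𝔇` to the left factor at the cost of a sign. No
inversion formula is needed. -/
lemma integral_fourierMonomial_mul (hμ : 0 < μ) (m n : ℕ) :
    ∫ x : ℝ, gaussPolyWith (1 / 4) (fourierMonomial μ m) x *
      gaussPolyWith (1 / 4) (fourierMonomial μ n) x ∂(weightMeasure μ) =
      (-1) ^ n * gaussMoment μ 2 (m + n) := by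
  induction n generalizing m with
  | zero => simpa using integral_fourierMonomial_mul_zero hμ m
  | succ n ih =>
    have h := integral_dunklGauss_mul hμ (b := 1 / 4) (by norm_num) (fourierMonomial μ m)
      (fourierMonomial μ n)
    have h1 := ih (m + 1)
    rw [fourierMonomial] at h1
    rw [fourierMonomial]
    simp only [gaussPolyWith_smul, mul_assoc, mul_left_comm _ Complex.I,
      integral_const_mul] at h1 ⊢
    have e : m + 1 + n = m + (n + 1) := by ring
    rw [h, e] at h1
    rw [pow_succ]
    linear_combination -h1

/-- Bilinear Parseval identity; the reflection of `r` absorbs the sign `(-1)^n`. -/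
lemma integral_fourierPoly_mul (hμ : 0 < μ) (p r : Polynomial ℂ) :
    ∫ x : ℝ, gaussPolyWith (1 / 4) (fourierPoly μ p) x *
      gaussPolyWith (1 / 4) (fourierPoly μ r) x ∂(weightMeasure μ) =
      ∫ x : ℝ, gaussPolyWith 1 p x * gaussPolyWith 1 (r.comp (-Polynomial.X)) x
        ∂(weightMeasure μ) := by
  have hq : (0 : ℝ) < 1 / 4 + 1 / 4 := by norm_num
  have h2 : (0 : ℝ) < 1 + 1 := by norm_num
  simp only [gaussPolyWith_mul_mul]
  change gaussFunctional hμ hq _ = gaussFunctional hμ h2 _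
  induction p using Polynomial.induction_on' with
  | add p q hp hq => rw [map_add, add_mul, add_mul, map_add, map_add, hp, hq]
  | monomial m c =>
    induction r using Polynomial.induction_on' with
    | add p q hp hq =>
      rw [map_add, mul_add, Polynomial.add_comp, mul_add, map_add, map_add, hp, hq]
    | monomial n d =>
      have hc : (Polynomial.monomial n d).comp (-Polynomial.X) =
          Polynomial.monomial n ((-1) ^ n * d) := by
        ext k
        rw [coeff_comp_neg_X, Polynomial.coeff_monomial, Polynomial.coeff_monomial]
        split_ifs with h
        · subst h; ring
        · simp
      have h := integral_fourierMonomial_mul hμ m n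
      simp only [gaussPolyWith_mul_mul] at h
      change gaussFunctional hμ hq _ = _ at h
      rw [hc, Polynomial.monomial_mul_monomial, gaussFunctional_monomial, fourierPoly_monomial,
        fourierPoly_monomial, smul_mul_smul_comm, map_smul, h, smul_eq_mul, one_add_one_eq_two]
      ring

lemma conj_gaussPolyWith (b : ℝ) (p : Polynomial ℂ) (x : ℝ) :
    (starRingEnd ℂ) (gaussPolyWith b p x) = gaussPolyWith b (p.map (starRingEnd ℂ)) x := by
  simp only [gaussPolyWith, map_mul, ← Complex.exp_conj, map_neg, map_pow, Complex.conj_ofReal]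
  congr 1
  rw [Polynomial.eval_map, ← Polynomial.eval₂_hom, Complex.conj_ofReal]

/-- Conjugating the kernel amounts to `t ↦ -t`. This reflection cancels the one in the bilinear
Parseval identity. -/
lemma conj_fourierPoly (hμ : 0 < μ) (p : Polynomial ℂ) (x : ℝ) :
    (starRingEnd ℂ) (gaussPolyWith (1 / 4) (fourierPoly μ p) x) =
      gaussPolyWith (1 / 4) (fourierPoly μ ((p.map (starRingEnd ℂ)).comp (-Polynomial.X))) x := by
  rw [← fourierC_gaussPoly hμ, ← fourierC_gaussPoly hμ, fourierC, fourierC, map_mul, map_inv₀,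
    Complex.conj_ofReal, ← integral_conj, ← integral_weightMeasure_comp_neg]
  congr 2 with t
  rw [map_mul, conj_expMu hμ, conj_gaussPolyWith]
  congr 1
  · simp
  · simp [gaussPolyWith]

lemma comp_neg_X_comp_neg_X (p : Polynomial ℂ) :
    (p.comp (-Polynomial.X)).comp (-Polynomial.X) = p := by
  rw [Polynomial.comp_assoc]; simp

lemma eLpNorm_two_eq_of_integral_eq {ν : Measure ℝ} {f g : ℝ → ℂ} (hf : MemLp f 2 ν)
    (hg : MemLp g 2 ν) (h : ∫ x, f x * (starRingEnd ℂ) (f x) ∂ν =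
      ∫ x, g x * (starRingEnd ℂ) (g x) ∂ν) : eLpNorm f 2 ν = eLpNorm g 2 ν := by
  have key : ∀ {f : ℝ → ℂ}, ∫ x, f x * (starRingEnd ℂ) (f x) ∂ν =
      ((∫ x, ‖f x‖ ^ 2 ∂ν : ℝ) : ℂ) := fun {f} => by
    rw [← integral_complex_ofReal]
    refine integral_congr_ae (Filter.Eventually.of_forall fun x => ?_)
    simp only [Complex.mul_conj, Complex.normSq_eq_norm_sq]
  rw [key, key, Complex.ofReal_inj] at h
  rw [hf.eLpNorm_eq_integral_rpow_norm two_ne_zero ENNReal.ofNat_ne_top,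
    hg.eLpNorm_eq_integral_rpow_norm two_ne_zero ENNReal.ofNat_ne_top]
  simp [h]

/-- The generalized Fourier integral is isometric on `𝔖`. -/
lemma eLpNorm_fourierPoly (hμ : 0 < μ) (p : Polynomial ℂ) :
    eLpNorm (fun x : ℝ => gaussPolyWith (1 / 4) (fourierPoly μ p) x) 2 (weightMeasure μ) =
      eLpNorm (fun x : ℝ => gaussPolyWith 1 p x) 2 (weightMeasure μ) := by
  refine eLpNorm_two_eq_of_integral_eq (memLp_two_gaussPolyWith hμ (by norm_num) _)
    (memLp_two_gaussPolyWith hμ one_pos _) ?_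
  simp only [conj_fourierPoly hμ, conj_gaussPolyWith]
  rw [integral_fourierPoly_mul hμ, comp_neg_X_comp_neg_X]

end

/-! ### The generalized Fourier transform on `L²_μ(ℝ)` -/

section

variable {μ : ℝ} {f g f' g' : ℝ → ℂ}

lemma isFourierMu_iff (hμ : 0 < μ) : IsFourierMu μ f g ↔
    MemLp f 2 (weightMeasure μ) ∧ MemLp g 2 (weightMeasure μ) ∧
      ∀ ε : ENNReal, 0 < ε → ∃ p : Polynomial ℂ,
        eLpNorm (f - fun x : ℝ => gaussPolyWith 1 p x) 2 (weightMeasure μ) < ε ∧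
        eLpNorm (g - fun x : ℝ => gaussPolyWith (1 / 4) (fourierPoly μ p) x) 2
          (weightMeasure μ) < ε := by
  simp only [IsFourierMu, fourierIntegralMu_gaussPoly hμ]
  simp only [gaussPoly_eq]
  rfl

lemma aestronglyMeasurable_sub_gaussPolyWith (hf : MemLp f 2 (weightMeasure μ)) (b : ℝ)
    (p : Polynomial ℂ) :
    AEStronglyMeasurable (f - fun x : ℝ => gaussPolyWith b p x) (weightMeasure μ) :=
  hf.1.sub (aestronglyMeasurable_gaussPolyWith b p _)

lemma gaussPolyWith_sub (b : ℝ) (p q : Polynomial ℂ) (z : ℂ) :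
    gaussPolyWith b (p - q) z = gaussPolyWith b p z - gaussPolyWith b q z := by
  simp [gaussPolyWith, sub_mul]

lemma IsFourierMu.sub (hμ : 0 < μ) (h : IsFourierMu μ f g) (h' : IsFourierMu μ f' g') :
    IsFourierMu μ (f - f') (g - g') := by
  rw [isFourierMu_iff hμ] at *
  obtain ⟨hf, hg, H⟩ := h
  obtain ⟨hf', hg', H'⟩ := h'
  refine ⟨hf.sub hf', hg.sub hg', fun ε hε => ?_⟩
  obtain ⟨p, h1, h2⟩ := H (ε / 2) (ENNReal.half_pos hε.ne')
  obtain ⟨q, h3, h4⟩ := H' (ε / 2) (ENNReal.half_pos hε.ne')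
  refine ⟨p - q, ?_, ?_⟩
  · have e : (f - f' - fun x : ℝ => gaussPolyWith 1 (p - q) x) =
        (f - fun x : ℝ => gaussPolyWith 1 p x) - (f' - fun x : ℝ => gaussPolyWith 1 q x) := by
      ext x; simp only [Pi.sub_apply, gaussPolyWith_sub]; ring
    rw [e, ← ENNReal.add_halves ε]
    exact (eLpNorm_sub_le (aestronglyMeasurable_sub_gaussPolyWith hf _ _)
      (aestronglyMeasurable_sub_gaussPolyWith hf' _ _) one_le_two).trans_lt
      (ENNReal.add_lt_add h1 h3)
  · have e : (g - g' - fun x : ℝ => gaussPolyWith (1 / 4) (fourierPoly μ (p - q)) x) =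
        (g - fun x : ℝ => gaussPolyWith (1 / 4) (fourierPoly μ p) x) -
        (g' - fun x : ℝ => gaussPolyWith (1 / 4) (fourierPoly μ q) x) := by
      ext x; simp only [Pi.sub_apply, map_sub, gaussPolyWith_sub]; ring
    rw [e, ← ENNReal.add_halves ε]
    exact (eLpNorm_sub_le (aestronglyMeasurable_sub_gaussPolyWith hg _ _)
      (aestronglyMeasurable_sub_gaussPolyWith hg' _ _) one_le_two).trans_lt
      (ENNReal.add_lt_add h2 h4)

lemma eLpNorm_le_add_eLpNorm_sub {ν : Measure ℝ} (hf : AEStronglyMeasurable f ν)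
    (hg : AEStronglyMeasurable g ν) :
    eLpNorm f 2 ν ≤ eLpNorm g 2 ν + eLpNorm (f - g) 2 ν := by
  calc eLpNorm f 2 ν = eLpNorm (g + (f - g)) 2 ν := by rw [add_sub_cancel]
    _ ≤ _ := eLpNorm_add_le hg (hf.sub hg) one_le_two

lemma IsFourierMu.eLpNorm_eq (hμ : 0 < μ) (h : IsFourierMu μ f g) :
    eLpNorm g 2 (weightMeasure μ) = eLpNorm f 2 (weightMeasure μ) := by
  rw [isFourierMu_iff hμ] at h
  obtain ⟨hf, hg, H⟩ := h
  have mf := fun p => aestronglyMeasurable_gaussPolyWith 1 p (weightMeasure μ)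
  have mg := fun p => aestronglyMeasurable_gaussPolyWith (1 / 4) p (weightMeasure μ)
  refine le_antisymm ?_ ?_ <;>
  · refine ENNReal.le_of_forall_pos_le_add fun ε hε _ => ?_
    obtain ⟨p, h1, h2⟩ := H (ε / 2) (ENNReal.half_pos (by exact_mod_cast hε.ne'))
    have a1 := eLpNorm_le_add_eLpNorm_sub hf.1 (mf p)
    have a2 := eLpNorm_le_add_eLpNorm_sub (mf p) hf.1
    have b1 := eLpNorm_le_add_eLpNorm_sub hg.1 (mg (fourierPoly μ p))
    have b2 := eLpNorm_le_add_eLpNorm_sub (mg (fourierPoly μ p)) hg.1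
    rw [eLpNorm_sub_comm] at a2 b2
    rw [eLpNorm_fourierPoly hμ] at b1 b2
    rw [← ENNReal.add_halves (ε : ENNReal), ← add_assoc]
    first
    | exact (b1.trans (add_le_add a2 le_rfl)).trans (add_le_add (add_le_add le_rfl h1.le) h2.le)
    | exact (a1.trans (add_le_add b2 le_rfl)).trans (add_le_add (add_le_add le_rfl h2.le) h1.le)

/-- The graph of the transform is closed. -/
lemma isFourierMu_of_forall_exists (hμ : 0 < μ) (hf : MemLp f 2 (weightMeasure μ))
    (hg : MemLp g 2 (weightMeasure μ)) (H : ∀ ε : ENNReal, 0 < ε → ∃ f' g', IsFourierMu μ f' g' ∧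
      eLpNorm (f - f') 2 (weightMeasure μ) < ε ∧ eLpNorm (g - g') 2 (weightMeasure μ) < ε) :
    IsFourierMu μ f g := by
  rw [isFourierMu_iff hμ]
  refine ⟨hf, hg, fun ε hε => ?_⟩
  obtain ⟨f', g', h, h1, h2⟩ := H (ε / 2) (ENNReal.half_pos hε.ne')
  obtain ⟨hf', hg', H'⟩ := (isFourierMu_iff hμ).1 h
  obtain ⟨p, h3, h4⟩ := H' (ε / 2) (ENNReal.half_pos hε.ne')
  refine ⟨p, ?_, ?_⟩
  · rw [← sub_add_sub_cancel f f', ← ENNReal.add_halves ε]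
    exact (eLpNorm_add_le (hf.1.sub hf'.1) (aestronglyMeasurable_sub_gaussPolyWith hf' _ _)
      one_le_two).trans_lt (ENNReal.add_lt_add h1 h3)
  · rw [← sub_add_sub_cancel g g', ← ENNReal.add_halves ε]
    exact (eLpNorm_add_le (hg.1.sub hg'.1) (aestronglyMeasurable_sub_gaussPolyWith hg' _ _)
      one_le_two).trans_lt (ENNReal.add_lt_add h2 h4)

lemma IsFourierMu.congr (hμ : 0 < μ) (h : IsFourierMu μ f g)
    (hf : f' =ᵐ[weightMeasure μ] f) (hg : g' =ᵐ[weightMeasure μ] g) : IsFourierMu μ f' g' := by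
  refine isFourierMu_of_forall_exists hμ (h.1.ae_eq hf.symm) (h.2.1.ae_eq hg.symm)
    fun ε hε => ⟨f, g, h, ?_, ?_⟩
  · rwa [eLpNorm_congr_ae (hf.sub_eq), eLpNorm_zero]
  · rwa [eLpNorm_congr_ae (hg.sub_eq), eLpNorm_zero]

/-- Approximants from `𝔖` have Cauchy transforms by the isometry; completeness provides the limit.
-/
lemma exists_isFourierMu (hμ : 0 < μ) (hf : MemLp f 2 (weightMeasure μ)) :
    ∃ g, IsFourierMu μ f g := by
  have hq : (0 : ℝ) < 1 / 4 := by norm_num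
  have hpos : ∀ n : ℕ, (0 : ENNReal) < (n : ENNReal)⁻¹ := fun n =>
    ENNReal.inv_pos.2 (ENNReal.natCast_ne_top n)
  choose p hp using fun n : ℕ => exists_eLpNorm_sub_gaussPoly_lt hμ hf (hpos n)
  set F : Polynomial ℂ → Lp ℂ 2 (weightMeasure μ) := fun p =>
    (memLp_two_gaussPolyWith hμ hq (fourierPoly μ p)).toLp _
  set E : Polynomial ℂ → Lp ℂ 2 (weightMeasure μ) := fun p =>
    (memLp_two_gaussPolyWith hμ one_pos p).toLp _
  have hiso : ∀ p q, edist (F p) (F q) = edist (E p) (E q) := fun p q => by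
    rw [Lp.edist_toLp_toLp, Lp.edist_toLp_toLp]
    convert! eLpNorm_fourierPoly hμ (p - q) using 2
    · ext x; simp only [Pi.sub_apply, map_sub, gaussPolyWith_sub]
    · ext x; simp only [Pi.sub_apply, gaussPolyWith_sub]
  have hE : Filter.Tendsto (fun n => E (p n)) Filter.atTop (nhds (hf.toLp f)) := by
    rw [tendsto_iff_edist_tendsto_0]
    refine tendsto_of_tendsto_of_tendsto_of_le_of_le tendsto_const_nhds
      ENNReal.tendsto_inv_nat_nhds_zero (fun _ => zero_le) fun n => ?_
    rw [edist_comm, Lp.edist_toLp_toLp]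
    have := (hp n).le
    rwa [gaussPoly_eq] at this
  have hF : CauchySeq fun n => F (p n) := by
    rw [EMetric.cauchySeq_iff]
    simp only [hiso]
    exact EMetric.cauchySeq_iff.1 hE.cauchySeq
  obtain ⟨G, hG⟩ := cauchySeq_tendsto_of_complete hF
  refine ⟨G, (isFourierMu_iff hμ).2 ⟨hf, Lp.memLp G, fun ε hε => ?_⟩⟩
  have h1 := (tendsto_iff_edist_tendsto_0.1 hE).eventually (gt_mem_nhds hε)
  have h2 := (tendsto_iff_edist_tendsto_0.1 hG).eventually (gt_mem_nhds hε)
  obtain ⟨n, h1, h2⟩ := (h1.and h2).exists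
  refine ⟨p n, ?_, ?_⟩
  · rwa [edist_comm, Lp.edist_toLp_toLp] at h1
  · rw [edist_comm, Lp.edist_def] at h2
    refine lt_of_eq_of_lt (eLpNorm_congr_ae ?_) h2
    exact Filter.EventuallyEq.rfl.sub
      (memLp_two_gaussPolyWith hμ hq (fourierPoly μ (p n))).coeFn_toLp.symm

lemma enorm_integral_mul_le {ν : Measure ℝ} (hf : AEStronglyMeasurable f ν)
    (hg : AEStronglyMeasurable g ν) :
    ‖∫ x, f x * g x ∂ν‖ₑ ≤ eLpNorm f 2 ν * eLpNorm g 2 ν := by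
  refine (enorm_integral_le_lintegral_enorm _).trans ?_
  rw [← eLpNorm_one_eq_lintegral_enorm]
  exact eLpNorm_smul_le_mul_eLpNorm (φ := f) hg hf

lemma eq_zero_of_forall_le_mul {a M : ENNReal} (hM : M ≠ ⊤)
    (h : ∀ ε : ENNReal, 0 < ε → a ≤ ε * M) : a = 0 := by
  have hlim : Filter.Tendsto (fun n : ℕ => (n : ENNReal)⁻¹ * M) Filter.atTop (nhds 0) := by
    simpa using ENNReal.Tendsto.mul_const ENNReal.tendsto_inv_nat_nhds_zero (Or.inr hM)
  exact le_antisymm (ge_of_tendsto' hlim fun n =>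
    h _ (ENNReal.inv_pos.2 (ENNReal.natCast_ne_top n))) zero_le

/-- Symmetry of the Fourier integral on `𝔖`, passed to the closure by Cauchy–Schwarz. -/
lemma IsFourierMu.integral_mul_gaussPolyWith (hμ : 0 < μ) (h : IsFourierMu μ f g)
    (q : Polynomial ℂ) : ∫ x : ℝ, g x * gaussPolyWith 1 q x ∂(weightMeasure μ) =
      ∫ x : ℝ, f x * gaussPolyWith (1 / 4) (fourierPoly μ q) x ∂(weightMeasure μ) := by
  have hq : (0 : ℝ) < 1 / 4 := by norm_num
  obtain ⟨hf, hg, H⟩ := (isFourierMu_iff hμ).1 h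
  have me := fun q => memLp_two_gaussPolyWith hμ one_pos q
  have mF := fun q => memLp_two_gaussPolyWith hμ hq (fourierPoly μ q)
  rw [← sub_eq_zero, ← enorm_eq_zero]
  refine eq_zero_of_forall_le_mul
    (M := eLpNorm (fun x : ℝ => gaussPolyWith 1 q x) 2 (weightMeasure μ) +
      eLpNorm (fun x : ℝ => gaussPolyWith (1 / 4) (fourierPoly μ q) x) 2 (weightMeasure μ))
    (ENNReal.add_ne_top.2 ⟨(me q).2.ne, (mF q).2.ne⟩) fun ε hε => ?_
  obtain ⟨p, h1, h2⟩ := H ε hε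
  have hint : ∀ {u v : ℝ → ℂ}, MemLp u 2 (weightMeasure μ) → MemLp v 2 (weightMeasure μ) →
      Integrable (fun x => u x * v x) (weightMeasure μ) := fun hu hv =>
    memLp_one_iff_integrable.1 (hv.mul hu (r := 1))
  have hsymm : ∫ x : ℝ, gaussPolyWith (1 / 4) (fourierPoly μ p) x * gaussPolyWith 1 q x
        ∂(weightMeasure μ) = ∫ x : ℝ, gaussPolyWith 1 p x *
        gaussPolyWith (1 / 4) (fourierPoly μ q) x ∂(weightMeasure μ) := by
    rw [← fourierC_gaussPoly hμ, ← fourierC_gaussPoly hμ]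
    exact integral_fourierC_mul hμ (memLp_one_gaussPolyWith hμ one_pos _)
      (memLp_one_gaussPolyWith hμ one_pos _)
  have e : ∫ x : ℝ, g x * gaussPolyWith 1 q x ∂(weightMeasure μ) -
      ∫ x : ℝ, f x * gaussPolyWith (1 / 4) (fourierPoly μ q) x ∂(weightMeasure μ) =
      ∫ x : ℝ, (g - fun x : ℝ => gaussPolyWith (1 / 4) (fourierPoly μ p) x) x *
        gaussPolyWith 1 q x ∂(weightMeasure μ) -
      ∫ x : ℝ, (f - fun x : ℝ => gaussPolyWith 1 p x) x *
        gaussPolyWith (1 / 4) (fourierPoly μ q) x ∂(weightMeasure μ) := by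
    simp only [Pi.sub_apply, sub_mul]
    rw [integral_sub (hint hg (me q)) (hint (mF p) (me q)),
      integral_sub (hint hf (mF q)) (hint (me p) (mF q)), hsymm]
    ring
  rw [e]
  refine (enorm_sub_le).trans ?_
  rw [mul_add]
  refine add_le_add ?_ ?_
  · refine (enorm_integral_mul_le (aestronglyMeasurable_sub_gaussPolyWith hg _ _) (me q).1).trans ?_
    gcongr
  · refine (enorm_integral_mul_le (aestronglyMeasurable_sub_gaussPolyWith hf _ _) (mF q).1).trans ?_
    gcongr

lemma memLp_top_fourierC (hμ : 0 < μ) (hf : MemLp f 1 (weightMeasure μ)) :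
    MemLp (fun x : ℝ => fourierC μ f x) ⊤ volume := by
  have hfi := memLp_one_iff_integrable.1 hf
  refine memLp_top_of_bound (Continuous.aestronglyMeasurable ?_)
    (‖(((2 : ℝ) ^ (μ + 1 / 2) * Real.Gamma (μ + 1 / 2) : ℝ) : ℂ)⁻¹‖ *
      ∫ t, ‖f t‖ ∂(weightMeasure μ)) (Filter.Eventually.of_forall fun x => ?_)
  · refine continuous_const.mul (continuous_of_dominated (bound := fun t => ‖f t‖) (fun x => ?_)
      (fun x => Filter.Eventually.of_forall fun t => ?_) hfi.norm
      (Filter.Eventually.of_forall fun t => ?_))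
    · exact (integrable_expMu_mul hμ hf x).1
    · rw [norm_mul]
      exact mul_le_of_le_one_left (norm_nonneg _) (norm_expMu_kernel_le hμ x t)
    · exact ((continuous_expMu hμ).comp (by fun_prop)).mul continuous_const
  · rw [fourierC, norm_mul]
    gcongr
    refine norm_integral_le_of_norm_le hfi.norm (Filter.Eventually.of_forall fun t => ?_)
    rw [norm_mul]
    exact mul_le_of_le_one_left (norm_nonneg _) (norm_expMu_kernel_le hμ x t)

/-- On `L¹_μ ∩ L²_μ` the generalized Fourier transform is given by the integral. -/
lemma isFourierMu_fourierC (hμ : 0 < μ) (hf1 : MemLp f 1 (weightMeasure μ))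
    (hf : MemLp f 2 (weightMeasure μ)) : IsFourierMu μ f (fun x : ℝ => fourierC μ f x) := by
  obtain ⟨g, hg⟩ := exists_isFourierMu hμ hf
  have htop := memLp_top_fourierC hμ hf1
  -- The bounded integral transform and the `L²` transform have the same integrals against `𝔖`,
  -- hence coincide almost everywhere.
  have hz := ((moderateGrowth_of_memLp_top hμ htop).sub
    (moderateGrowth_of_memLp_two hμ hg.2.1)).ae_eq_zero fun n => ?_
  · refine hg.congr hμ Filter.EventuallyEq.rfl ?_
    filter_upwards [(weightMeasure_ac μ).ae_eq hz] with x hx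
    exact sub_eq_zero.1 hx
  · have h1 : Integrable (fun x : ℝ => fourierC μ f x * gaussPolyWith 1 (Polynomial.X ^ n) x)
        (weightMeasure μ) :=
      (integrable_gaussPolyWith hμ one_pos _).mul_of_top_right (memLp_top_weightMeasure htop)
    have h2 : Integrable (fun x : ℝ => g x * gaussPolyWith 1 (Polynomial.X ^ n) x)
        (weightMeasure μ) := memLp_one_iff_integrable.1
      ((memLp_two_gaussPolyWith hμ one_pos _).mul hg.2.1 (r := 1))
    simp only [Pi.sub_apply, sub_mul, gaussPoly_eq]
    rw [integral_sub h1 h2, hg.integral_mul_gaussPolyWith hμ,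
      integral_fourierC_mul hμ hf1 (memLp_one_gaussPolyWith hμ one_pos _),
      fourierC_gaussPoly hμ, sub_self]

/-! ### Translation and the Fourier transform -/

/-- The translation is transposed onto the bounded kernel `e_μ(-ixt)`, where the product formula
with shift `-y` extracts `e_μ(iyx)`. -/
lemma fourierC_genTranslation [Fact (0 < μ)] (y : ℝ) (hf : MemLp f 1 (weightMeasure μ)) (x : ℝ) :
    fourierC μ (genTranslation μ y f) x = expMu μ (Complex.I * y * x) * fourierC μ f x := by
  have hμ : 0 < μ := Fact.out
  have htop : MemLp (fun t : ℝ => expMu μ (-(Complex.I * x) * t)) ⊤ volume := by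
    refine memLp_top_of_bound ?_ 1 (Filter.Eventually.of_forall fun t => ?_)
    · exact ((continuous_expMu hμ).comp (by fun_prop)).aestronglyMeasurable
    · rw [neg_mul]; exact norm_expMu_kernel_le hμ x t
  have h := integral_genTranslation_mul (-y) htop hf
  rw [neg_neg] at h
  have e' : ∀ t : ℝ, -(Complex.I * x * t) = -(Complex.I * x) * t := fun t => by ring
  simp only [fourierC, e']
  have key : ∫ t, genTranslation μ (-y) (fun t : ℝ => expMu μ (-(Complex.I * x) * t)) t * f t
      ∂(weightMeasure μ) = expMu μ (Complex.I * y * x) *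
        ∫ t : ℝ, expMu μ (-(Complex.I * x) * t) * f t ∂(weightMeasure μ) := by
    rw [← integral_const_mul]
    refine integral_congr_ae ?_
    rw [Filter.EventuallyEq, ae_weightMeasure]
    filter_upwards [ae_ne_zero] with t ht
    rw [genTranslation_expMu _ ht]
    have e : -(Complex.I * x) * ((-y : ℝ) : ℂ) = Complex.I * y * x := by push_cast; ring
    rw [e]
    ring
  rw [← h, key]
  ring

lemma norm_expMu_mul_le (hμ : 0 < μ) (y t : ℝ) (z : ℂ) :
    ‖expMu μ (Complex.I * y * t) * z‖ ≤ ‖z‖ := by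
  have : Complex.I * y * t = Complex.I * ((y * t : ℝ) : ℂ) := by push_cast; ring
  rw [norm_mul, this]
  exact mul_le_of_le_one_left (norm_nonneg _) (norm_expMu_I_mul_le hμ _)

lemma eLpNorm_expMu_mul_le (hμ : 0 < μ) (y : ℝ) (g : ℝ → ℂ) :
    eLpNorm (fun t : ℝ => expMu μ (Complex.I * y * t) * g t) 2 (weightMeasure μ) ≤
      eLpNorm g 2 (weightMeasure μ) :=
  eLpNorm_mono fun t => norm_expMu_mul_le hμ y t (g t)

lemma memLp_expMu_mul (hμ : 0 < μ) (y : ℝ) (hg : MemLp g 2 (weightMeasure μ)) :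
    MemLp (fun t : ℝ => expMu μ (Complex.I * y * t) * g t) 2 (weightMeasure μ) :=
  ⟨((continuous_expMu hμ).comp (by fun_prop)).aestronglyMeasurable.mul hg.1,
    (eLpNorm_expMu_mul_le hμ y g).trans_lt hg.2⟩

/-- The relation holds for Gaussian functions, whose translates lie in `L¹_μ ∩ L²_μ`, and both sides
are continuous in `L²_μ`. -/
lemma IsFourierMu.genTranslation [Fact (0 < μ)] (y : ℝ) (h : IsFourierMu μ f g) :
    IsFourierMu μ (genTranslation μ y f) (fun t : ℝ => expMu μ (Complex.I * y * t) * g t) := by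
  have hμ : 0 < μ := Fact.out
  obtain ⟨hf, hg, H⟩ := (isFourierMu_iff hμ).1 h
  refine isFourierMu_of_forall_exists hμ (memLp_two_genTranslation y hf) (memLp_expMu_mul hμ y hg)
    fun ε hε => ?_
  have hC0 : (1 + transConst μ) ≠ 0 := by simp
  have hC : (1 + transConst μ) ≠ ⊤ :=
    ENNReal.add_ne_top.2 ⟨ENNReal.one_ne_top, transConst_lt_top.ne⟩
  -- Dividing by `1 + transConst μ` compensates the norm bound for the translation.
  obtain ⟨p, h1, h2⟩ := H (min ε (ε / (1 + transConst μ)))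
    (lt_min hε (ENNReal.div_pos hε.ne' hC))
  set e : ℝ → ℂ := fun x => gaussPolyWith 1 p x
  have he1 : MemLp e 1 (weightMeasure μ) := memLp_one_gaussPolyWith hμ one_pos p
  have he2 : MemLp e 2 (weightMeasure μ) := memLp_two_gaussPolyWith hμ one_pos p
  refine ⟨GenHermite.genTranslation μ y e, _, isFourierMu_fourierC hμ (memLp_one_genTranslation y he1)
    (memLp_two_genTranslation y he2), ?_, ?_⟩
  · rw [← eLpNorm_congr_ae ((weightMeasure_ac μ).ae_eq (genTranslation_sub y hf he2))]
    refine (eLpNorm_two_genTranslation_le y (hf.sub he2)).trans_lt ?_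
    rw [mul_comm, ← ENNReal.lt_div_iff_mul_lt (Or.inl hC0) (Or.inl hC)]
    exact h1.trans_le (min_le_right _ _)
  · refine lt_of_le_of_lt ?_ (h2.trans_le (min_le_left _ _))
    refine le_trans (le_of_eq ?_) (eLpNorm_expMu_mul_le hμ y _)
    congr 1
    ext t
    simp only [Pi.sub_apply, fourierC_genTranslation y he1, e, fourierC_gaussPoly hμ]
    ring

end

/-! ### The translation of bounded functions -/

section

variable {μ : ℝ} {φ ψ ψ' : ℝ → ℂ}

lemma integrable_mul_gaussPoly (hμ : 0 < μ) (hψ : MemLp ψ ⊤ volume) (p : Polynomial ℂ) :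
    Integrable (fun x : ℝ => ψ x * gaussPoly p x) (weightMeasure μ) := by
  rw [gaussPoly_eq]
  exact (integrable_gaussPolyWith hμ one_pos p).mul_of_top_right (memLp_top_weightMeasure hψ)

lemma isBoundedTranslate_of_ae_eq [Fact (0 < μ)] (y : ℝ) (hφ : MemLp φ ⊤ volume)
    (h : ψ =ᵐ[volume] genTranslation μ y φ) : IsBoundedTranslate μ y φ ψ := by
  have hμ : 0 < μ := Fact.out
  refine ⟨(memLp_top_genTranslation y hφ).ae_eq h.symm, fun p => ?_⟩
  have hp1 : MemLp (fun x : ℝ => gaussPoly p x) 1 (weightMeasure μ) := by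
    rw [gaussPoly_eq]; exact memLp_one_gaussPolyWith hμ one_pos p
  obtain ⟨a, ha⟩ := exists_hasEntireSeries (f := gaussPoly p)
    (by rw [gaussPoly_eq]; exact differentiable_gaussPolyWith 1 p)
  -- The series is summed at every real point; its integral form is needed only away from `0`.
  have hae : (fun x : ℝ => ∑' n, a n * (dunklBinom μ n x (-y) : ℂ)) =ᵐ[weightMeasure μ]
      genTranslation μ (-y) (fun x : ℝ => gaussPoly p x) := by
    rw [Filter.EventuallyEq, ae_weightMeasure]
    filter_upwards [ae_ne_zero] with x hx using (hasSum_genTranslation ha hx (-y)).tsum_eq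
  refine ⟨_, fun x => by simpa using hasSum_translationTerm ha x (-y), ?_, ?_⟩
  · exact (memLp_one_iff_integrable.1 (memLp_one_genTranslation (-y) hp1)).congr hae.symm
  · rw [integral_congr_ae (g := fun x => genTranslation μ y φ x * gaussPoly p x),
      integral_genTranslation_mul y hφ hp1]
    · refine integral_congr_ae ?_
      filter_upwards [hae] with x hx
      rw [hx]
    · filter_upwards [(weightMeasure_ac μ).ae_eq h] with x hx
      rw [hx]

/-- The function `h` in the definition is fixed by its pointwise series, so two solutions have equal
integrals against `𝔖`. -/
lemma IsBoundedTranslate.ae_eq (hμ : 0 < μ) {y : ℝ} (h : IsBoundedTranslate μ y φ ψ)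
    (h' : IsBoundedTranslate μ y φ ψ') : ψ =ᵐ[volume] ψ' := by
  have hz := ((moderateGrowth_of_memLp_top hμ h.1).sub
    (moderateGrowth_of_memLp_top hμ h'.1)).ae_eq_zero fun n => ?_
  · filter_upwards [hz] with x hx
    exact sub_eq_zero.1 hx
  · obtain ⟨u, hu, -, hu'⟩ := h.2 (Polynomial.X ^ n)
    obtain ⟨v, hv, -, hv'⟩ := h'.2 (Polynomial.X ^ n)
    have huv : u = v := funext fun x => (hu x).unique (hv x)
    simp only [Pi.sub_apply, sub_mul]
    rw [integral_sub (integrable_mul_gaussPoly hμ h.1 _) (integrable_mul_gaussPoly hμ h'.1 _), hu',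
      hv', huv, sub_self]

lemma genTranslation_comm (μ x y : ℝ) (φ : ℝ → ℂ) :
    genTranslation μ y φ x = genTranslation μ x φ y := by
  have h : ∀ t, omegaTilde x y t = omegaTilde y x t := fun t => by
    simp only [omegaTilde]; congr 1; ring
  simp only [genTranslation, h, add_comm x y]

end

end GenHermite

end

/-! ### Assembly of the theorem -/

theorem theorem4p8 (μ : ℝ) (hμ : 0 < μ) :
    (∀ φ : ℝ → ℂ, MeasureTheory.MemLp φ ⊤ MeasureTheory.volume →
      (∀ (y : ℝ) (ψ : ℝ → ℂ), GenHermite.IsBoundedTranslate μ y φ ψ ↔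
        ψ =ᵐ[MeasureTheory.volume] GenHermite.genTranslation μ y φ) ∧
      ∀ᵐ q : ℝ × ℝ, GenHermite.genTranslation μ q.2 φ q.1 =
        GenHermite.genTranslation μ q.1 φ q.2) ∧
    (∀ (y : ℝ) (φ : ℝ → ℂ), MeasureTheory.MemLp φ 2 (GenHermite.weightMeasure μ) →
      (∀ ψ : ℝ → ℂ, GenHermite.IsL2Translate μ y φ ψ ↔
        ψ =ᵐ[MeasureTheory.volume] GenHermite.genTranslation μ y φ) ∧
      MeasureTheory.MemLp (GenHermite.genTranslation μ y φ) 2 (GenHermite.weightMeasure μ) ∧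
      MeasureTheory.eLpNorm (GenHermite.genTranslation μ y φ) 2 (GenHermite.weightMeasure μ) ≤
        MeasureTheory.eLpNorm φ 2 (GenHermite.weightMeasure μ)) := by
  have : Fact (0 < μ) := ⟨hμ⟩
  refine ⟨fun φ hφ => ⟨fun y ψ => ⟨fun h => ?_, GenHermite.isBoundedTranslate_of_ae_eq y hφ⟩, ?_⟩,
    fun y φ hφ => ⟨fun ψ => ⟨?_, fun h => ?_⟩, GenHermite.memLp_two_genTranslation y hφ, ?_⟩⟩
  · exact h.ae_eq hμ (GenHermite.isBoundedTranslate_of_ae_eq y hφ Filter.EventuallyEq.rfl)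
  · exact Filter.Eventually.of_forall fun q => GenHermite.genTranslation_comm μ q.1 q.2 φ
  · rintro ⟨g, hg, hψ⟩
    -- Two functions with the same transform differ by one with transform zero, which has norm zero
    -- by the isometry.
    have h := (hψ.sub hμ (hg.genTranslation y)).eLpNorm_eq hμ
    rw [sub_self, eLpNorm_zero, eq_comm, eLpNorm_eq_zero_iff
      (hψ.1.1.sub (GenHermite.memLp_two_genTranslation y hφ).1) two_ne_zero] at h
    filter_upwards [(GenHermite.ac_weightMeasure μ).ae_eq h] with x hx
    exact sub_eq_zero.1 hx
  · obtain ⟨g, hg⟩ := GenHermite.exists_isFourierMu hμ hφ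
    exact ⟨g, hg, (hg.genTranslation y).congr hμ ((GenHermite.weightMeasure_ac μ).ae_eq h)
      Filter.EventuallyEq.rfl⟩
  · obtain ⟨g, hg⟩ := GenHermite.exists_isFourierMu hμ hφ
    -- Plancherel on both sides replaces the crude kernel constant by the bound `|e_μ(iyt)| ≤ 1`.
    rw [← (hg.genTranslation y).eLpNorm_eq hμ, ← hg.eLpNorm_eq hμ]
    exact GenHermite.eLpNorm_expMu_mul_le hμ y g
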